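/- **Sturm Comparison Theorem.** Let $(V,\omega)$ be a finite-dimensional real symplectic vector space. *The Salamon–Zehnder invariant.* For $A\in \mathrm{Sp}(V,\omega)$ let $$\rho(A)=(-1)^{m_0/2}\prod_{\mu}\mu^{m_+(\mu)}\in S^1\subset\mathbb C ,$$ where $m_0$ is the (even) number of negative real eigenvalues of $A$ counted with algebraic multiplicity, $\mu$ runs over the eigenvalues of $A$ in $S^1\setminus\{\pm1\}$, and $m_+(\mu)$ is the largest complex dimension of a subspace of the generalized $\mu$-eigenspace of $A$ in $V\otimes\mathbb C$ on which the Hermitian form $z\mapsto i\,\omega_{\mathbb C}(\bar z,z)$ is positive definite, where $\omega_{\mathbb C}$ is the complex bilinear extension of $\omega$. (This is the Salamon–Zehnder map; $\rho(A)=\det_{\mathbb C}A$ if $A$ is unitary with respect to a complex structure $J$ for which $\omega(\cdot,J\cdot)$ is an inner product.) For a continuous path $\Phi\colon[a,b]\to \mathrm{Sp}(V,\omega)$ choose a continuous $\theta\colon[a,b]\to\mathbb R$ with $\rho(\Phi(t))=e^{i\theta(t)}$ and put $\Delta(\Phi)=(\theta(b)-\theta(a))/\pi$. *Linear Hamiltonian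 flows.* Let $H(t)$, $t\in[0,T]$, be a time-dependent quadratic Hamiltonian on $V$, i.e. a family of quadratic forms depending continuously on $t$. A linear flow of $H$ is a path $\Phi_H\colon[0,T]\to \mathrm{Sp}(V,\omega)$ with arbitrary initial value $\Phi_H(0)\in \mathrm{Sp}(V,\omega)$ (for instance the identity) satisfying the Hamilton equation $\omega(w,\dot\Phi_H(t)v)=d(H(t))_{\Phi_H(t)v}(w)$ for all $v,w\in V$. For $V=\mathbb R^{2n}=\mathbb C^n$ with $J$ the multiplication by $i$, $\omega(x,Jy)=\langle x,y\rangle$ and $H(t)(x)=\tfrac12\langle S(t)x,x\rangle$, this is $\dot\Phi_H=J\,S(t)\,\Phi_H$. *Statement.* For every $d$ there is a constant $C>0$, depending only on $d$, such that the following holds. Let $(V,\omega)$ be a symplectic vector space with $\dim V=d$, let $T\ge 0$, let $H_0,H_1$ be time-dependent quadratic Hamiltonians on $V$ such that $H_1(t)-H_0(t)$ is a non-negative function on $V$ for all $t\in[0,T]$, and let $\Phi_{H_0},\Phi_{H_1}$ be linear flows of $H_0,H_1$. Then $\rho\circ\Phi_{H_0}$ and $\rho\circ\Phi_{H_1}$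 have continuous arguments $\theta$ on $[0,T]$ as above, so that $\Delta$ is defined, and $$\Delta\big(\Phi_{H_1}|_{[0,t]}\big)\ \ge\ \Delta\big(\Phi_{H_0}|_{[0,t]}\big)-C\qquad\text{for all } t\in[0,T].$$ -/

import Mathlib

open scoped TensorProduct

universe u

namespace SalamonZehnder

variable {V : Type u} [AddCommGroup V] [Module ℝ V]

/-- The endomorphism `A` preserves the form `ω`. When `ω` is a symplectic form on a
finite-dimensional space this says `A ∈ Sp(V, ω)` (such an `A` is automatically invertible). -/
def IsSymplecticMap (ω : LinearMap.BilinForm ℝ V) (A : Module.End ℝ V) : Prop :=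
  ∀ x y : V, ω (A x) (A y) = ω x y

/-- Complex conjugation `x + i y ↦ x - i y` on the complexification `ℂ ⊗[ℝ] V`. -/
noncomputable def conjC (V : Type u) [AddCommGroup V] [Module ℝ V] :
    (ℂ ⊗[ℝ] V) →ₗ[ℝ] (ℂ ⊗[ℝ] V) :=
  LinearMap.rTensor V Complex.conjAe.toLinearMap

/-- The Hermitian quadratic form `z ↦ i ω_ℂ(z̄, z)` on the complexification of `V`, where `ω_ℂ` is
the complex bilinear extension of `ω`. It is real valued for alternating `ω`: its value at
`z = x + i y` is `2 ω(y, x)`. -/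
noncomputable def kreinForm (ω : LinearMap.BilinForm ℝ V) (z : ℂ ⊗[ℝ] V) : ℝ :=
  (Complex.I * (LinearMap.BilinForm.baseChange ℂ ω) (conjC V z) z).re

/-- The positive index `m₊(μ)`: the largest complex dimension of a subspace of the generalized
`μ`-eigenspace of the complexification of `A` on which the form `i ω_ℂ(z̄, z)` is positive
definite. -/
noncomputable def posIndex (ω : LinearMap.BilinForm ℝ V) (A : Module.End ℝ V) (μ : ℂ) : ℕ :=
  sSup {d : ℕ | ∃ W : Submodule ℂ (ℂ ⊗[ℝ] V),
    W ≤ Module.End.maxGenEigenspace (LinearMap.baseChange ℂ A) μ ∧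
    (∀ z ∈ W, z ≠ 0 → 0 < kreinForm ω z) ∧ Module.finrank ℂ W = d}

open Classical in
/-- The eigenvalues of (the complexification of) `A` on the unit circle, other than `1` and `-1`. -/
noncomputable def circleEigenvalues [FiniteDimensional ℝ V] (A : Module.End ℝ V) : Finset ℂ :=
  ((A.charpoly.map (algebraMap ℝ ℂ)).roots.toFinset).filter
    (fun μ => ‖μ‖ = 1 ∧ μ ≠ 1 ∧ μ ≠ -1)

open Classical in
/-- The number of negative real eigenvalues of `A`, counted with algebraic multiplicity.
It is even when `A` is symplectic. -/
noncomputable def negCount [FiniteDimensional ℝ V] (A : Module.End ℝ V) : ℕ :=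
  (A.charpoly.roots.filter (fun r => r < 0)).card

/-- The Salamon--Zehnder map `ρ : Sp(V, ω) → S¹ ⊆ ℂ`, given by the formula of Salamon and Zehnder
`ρ(A) = (-1)^(m₀ / 2) ∏ μ ^ m₊(μ)`, the product over the eigenvalues `μ ∈ S¹ \ {1, -1}`, where `m₀`
is the number of negative real eigenvalues counted with algebraic multiplicity.

Only the eigenvalues on the unit circle enter, apart from the sign. The sign of the Hermitian form
in `posIndex` is the one for which `ρ(A)` is the complex determinant of `A` whenever `A` is unitary
for a complex structure `J` such that `ω(·, J ·)` is an inner product. -/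
noncomputable def rho [FiniteDimensional ℝ V] (ω : LinearMap.BilinForm ℝ V)
    (A : Module.End ℝ V) : ℂ :=
  (-1) ^ (negCount A / 2) * ∏ μ ∈ circleEigenvalues A, μ ^ posIndex ω A μ

/-- `θ` is a continuous choice of the argument of `ρ(Φ(t))` for `t ∈ [a, b]`. -/
def IsAngle [FiniteDimensional ℝ V] (ω : LinearMap.BilinForm ℝ V) (Φ : ℝ → Module.End ℝ V)
    (a b : ℝ) (θ : ℝ → ℝ) : Prop :=
  ContinuousOn θ (Set.Icc a b) ∧
    ∀ t ∈ Set.Icc a b, rho ω (Φ t) = Complex.exp ((θ t : ℂ) * Complex.I)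

open Classical in
/-- The Salamon--Zehnder invariant `Δ(Φ|_[a,b]) = (θ(b) - θ(a)) / π` of the path `Φ` over `[a, b]`,
for any continuous argument `θ` of `ρ ∘ Φ` on `[a, b]`; two such `θ` differ by a constant, so that
the choice is immaterial. (The value is `0` if there is no such `θ`.) -/
noncomputable def Delta [FiniteDimensional ℝ V] (ω : LinearMap.BilinForm ℝ V)
    (Φ : ℝ → Module.End ℝ V) (a b : ℝ) : ℝ :=
  if h : ∃ θ : ℝ → ℝ, IsAngle ω Φ a b θ then (h.choose b - h.choose a) / Real.pi else 0

/-- `Φ` is a linear Hamiltonian flow on `[0, T]` of the time-dependent quadratic Hamiltonian `H`: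
`Φ(0)` is symplectic and `ω(w, Φ'(t) v) = d(H_t)_{Φ(t) v}(w)` for all `v`, `w`. The differential of
a quadratic form `q` at `x` is `w ↦ q (x + w) - q x - q w`, the polar form of `q`. With
`V = ℝ²ⁿ = ℂⁿ`, `J` the multiplication by `i`, `ω(x, J y) = ⟨x, y⟩` and
`H_t(x) = ⟨S_t x, x⟩ / 2` this is the equation `Φ' = J S Φ`. The derivatives of the
functions `ω(w, Φ(t) v)` are those of the coordinates of `Φ(t)`, as `ω` is nondegenerate. -/
def IsHamiltonianFlow (ω : LinearMap.BilinForm ℝ V) (H : ℝ → QuadraticForm ℝ V) (T : ℝ)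
    (Φ : ℝ → Module.End ℝ V) : Prop :=
  IsSymplecticMap ω (Φ 0) ∧
    ∀ t ∈ Set.Icc 0 T, ∀ v w : V,
      HasDerivWithinAt (fun s => ω w (Φ s v)) (QuadraticMap.polar (H t) (Φ t v) w)
        (Set.Icc 0 T) t

end SalamonZehnder

/-! On V ⊗ ℂ, of complex dimension 2n, the Hermitian form i ω(z̄, w) has signature (n, n). In an
orthonormal basis compatible with conjugation a symplectic map becomes a matrix M in U(n, n), whose
upper left block a is invertible. The theorem is proved by comparing ρ with the direction of det a,
which is much easier to differentiate.

The comparison rests on one estimate. If a frame f spans a maximal non-negative subspace, then a⁻¹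
(M f)₁ f₁⁻¹ has positive definite Hermitian part (`accretive_relMatrix`). Its determinant therefore
has a canonical continuous argument `relArg M f`, bounded by nπ/2, and this argument satisfies an
exact cocycle identity (`relArg_cocycle`). If the subspace is invariant, M f = f R, the cocycle
applied to the powers M^(2^k) telescopes: `relArg M f` equals a series `correction M` that does not
involve f. Hence det R has the direction of det a · exp(i · correction M), where the correction is
continuous and bounded by nπ/2 (`exists_pos_det_eq`).

An invariant maximal non-negative subspace L exists (`exists_isInvariantPair`), and a dimension
count over the spectrum determines the multiplicities on L: m₊(μ) on the unit circle, and
complementary ones at μ and 1/μ̄ off it (`finrank_inf_of_isInvariantPair`). Thus det(A|L) has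
direction ρ(A) (`det_restrict_eq_rho`), and ρ(A) is the direction of det a · exp(i · correction)
(`IsSplitBasis.exists_rho_eq`). In particular ρ has a continuous argument along every flow.

For the flows, put N = Φ₀⁻¹ Φ₁. Since H₁ - H₀ is non-negative, the upper left determinant of N
rotates in the positive direction (`hasDerivWithinAt_det_quotientMatrix`). As Φ₁ = Φ₀ N, the upper
left determinant of Φ₁ is the product of those of Φ₀ and N and of an accretive determinant. So the
argument for Φ₁ is the argument for Φ₀, plus a nondecreasing function, plus terms bounded in terms
of n alone (`exists_angles`). -/

namespace SalamonZehnder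

/-! ### Determinants of accretive matrices and their arguments. -/

open Matrix Complex

/-- A complex square matrix with positive definite Hermitian part. -/
def Accretive {n : ℕ} (M : Matrix (Fin n) (Fin n) ℂ) : Prop :=
  ∀ x : Fin n → ℂ, x ≠ 0 → 0 < (star x ⬝ᵥ (M *ᵥ x)).re

/-- The sum of the arguments of the pivots of a matrix, a continuous argument of the determinant
on the accretive matrices. -/
noncomputable def argDet : (n : ℕ) → Matrix (Fin n) (Fin n) ℂ → ℝ
  | 0, _ => 0
  | n + 1, M =>
      arg (M.det / (M.submatrix Fin.succ Fin.succ).det) + argDet n (M.submatrix Fin.succ Fin.succ)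

lemma Accretive.det_ne_zero {n : ℕ} {M : Matrix (Fin n) (Fin n) ℂ} (h : Accretive M) :
    M.det ≠ 0 := by
  intro h0
  obtain ⟨x, hx, hM⟩ := Matrix.exists_mulVec_eq_zero_iff.mpr h0
  have := h x hx
  simp [hM] at this

lemma Accretive.minor {n : ℕ} {M : Matrix (Fin (n + 1)) (Fin (n + 1)) ℂ} (h : Accretive M) :
    Accretive (M.submatrix Fin.succ Fin.succ) := by
  intro x hx
  have hx' : (Fin.cons 0 x : Fin (n + 1) → ℂ) ≠ 0 := by
    intro h0
    apply hx
    ext i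
    simpa using congrFun h0 i.succ
  have := h _ hx'
  simpa [dotProduct, Matrix.mulVec, Fin.sum_univ_succ] using this

/-- The quotient is the Schur complement of the minor. Testing accretivity on the first column y of
the adjugate, where M y = det M · e₀ and y₀ is the minor, gives the quotient times the squared
modulus of the minor. -/
lemma Accretive.pivot_re_pos {n : ℕ} {M : Matrix (Fin (n + 1)) (Fin (n + 1)) ℂ}
    (h : Accretive M) : 0 < (M.det / (M.submatrix Fin.succ Fin.succ).det).re := by
  have hd := h.det_ne_zero
  have hm := h.minor.det_ne_zero
  set y : Fin (n + 1) → ℂ := M.adjugate *ᵥ Pi.single 0 1 with hy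
  have hMy : M *ᵥ y = M.det • Pi.single 0 1 := by
    rw [hy, Matrix.mulVec_mulVec, Matrix.mul_adjugate, Matrix.smul_mulVec, Matrix.one_mulVec]
  have hy0 : y 0 = (M.submatrix Fin.succ Fin.succ).det := by
    simp [hy, Matrix.adjugate_fin_succ_eq_det_submatrix]
  have hyne : y ≠ 0 := fun h0 => hm (by rw [← hy0, h0]; rfl)
  have := h y hyne
  rw [hMy] at this
  have h2 : star y ⬝ᵥ (M.det • Pi.single 0 1 : Fin (n + 1) → ℂ)
      = M.det / (M.submatrix Fin.succ Fin.succ).det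
        * (normSq (M.submatrix Fin.succ Fin.succ).det : ℂ) := by
    rw [dotProduct_smul, dotProduct_single, Complex.normSq_eq_conj_mul_self]
    simp only [Pi.star_apply, hy0, RCLike.star_def, mul_one, smul_eq_mul]
    field_simp
  rw [h2, re_mul_ofReal] at this
  exact pos_of_mul_pos_left this (normSq_nonneg _)

lemma abs_argDet_le : ∀ {n : ℕ} {M : Matrix (Fin n) (Fin n) ℂ}, Accretive M →
    |argDet n M| ≤ n * (Real.pi / 2)
  | 0, _, _ => by simp [argDet]
  | n + 1, M, h => by
    have h1 := abs_argDet_le h.minor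
    have h2 := abs_arg_le_pi_div_two_iff.mpr h.pivot_re_pos.le
    rw [argDet]
    push_cast
    refine (abs_add_le _ _).trans ?_
    linarith

lemma Accretive.det_eq : ∀ {n : ℕ} {M : Matrix (Fin n) (Fin n) ℂ}, Accretive M →
    M.det = ‖M.det‖ * exp (argDet n M * I)
  | 0, _, _ => by simp [argDet]
  | n + 1, M, h => by
    have h1 := h.minor.det_eq
    have hm := h.minor.det_ne_zero
    rw [argDet]
    push_cast
    rw [add_mul, exp_add]
    have h2 := norm_mul_exp_arg_mul_I (M.det / (M.submatrix Fin.succ Fin.succ).det)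
    rw [norm_div, ofReal_div] at h2
    have h3 : (‖(M.submatrix Fin.succ Fin.succ).det‖ : ℂ) ≠ 0 := by
      simpa using hm
    generalize arg (M.det / (M.submatrix Fin.succ Fin.succ).det) = a at h2 ⊢
    rw [div_mul_eq_mul_div, div_eq_div_iff h3 hm] at h2
    refine mul_right_cancel₀ h3 ?_
    rw [← h2]
    nth_rewrite 1 [h1]
    ring

lemma argDet_one : ∀ n : ℕ, argDet n 1 = 0
  | 0 => rfl
  | n + 1 => by
    have : (1 : Matrix (Fin (n + 1)) (Fin (n + 1)) ℂ).submatrix Fin.succ Fin.succ = 1 :=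
      Matrix.submatrix_one _ (Fin.succ_injective n)
    rw [argDet, this, argDet_one n]
    simp

/-- The pivots stay in the open right half plane, away from the branch cut of `arg`. -/
lemma continuousOn_argDet : ∀ n : ℕ, ContinuousOn (argDet n) {M | Accretive M}
  | 0 => continuousOn_const
  | n + 1 => by
    have hc : Continuous fun M : Matrix (Fin (n + 1)) (Fin (n + 1)) ℂ =>
        M.submatrix Fin.succ Fin.succ := by fun_prop
    have h1 : ContinuousOn (fun M : Matrix (Fin (n + 1)) (Fin (n + 1)) ℂ =>
        argDet n (M.submatrix Fin.succ Fin.succ)) {M | Accretive M} :=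
      (continuousOn_argDet n).comp hc.continuousOn (fun M hM => hM.minor)
    refine ContinuousOn.add (fun M hM => ?_) h1
    have hM' : Accretive M := hM
    refine ContinuousAt.continuousWithinAt ?_
    refine ContinuousAt.comp
      (f := fun M : Matrix (Fin (n + 1)) (Fin (n + 1)) ℂ =>
        M.det / (M.submatrix Fin.succ Fin.succ).det)
      (continuousAt_arg (Or.inl hM'.pivot_re_pos)) ?_
    exact ContinuousAt.div (by fun_prop) (by fun_prop) hM'.minor.det_ne_zero

end SalamonZehnder

/-! ### The group U(n, n) acting on maximal non-negative subspaces. -/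

namespace SalamonZehnder

open Matrix Complex

/-- Two continuous arguments of the same function on a preconnected set differ by a constant. -/
lemma sub_eq_sub_of_exp_eq {α : Type*} [TopologicalSpace α] {s : Set α} (hs : IsPreconnected s)
    {f g : α → ℝ} (hf : ContinuousOn f s) (hg : ContinuousOn g s)
    (h : ∀ x ∈ s, exp (f x * I) = exp (g x * I)) {x y : α} (hx : x ∈ s) (hy : y ∈ s) :
    f x - g x = f y - g y := by
  have h1 : Set.EqOn f (fun z => g z + (f y - g y)) s := by
    refine Circle.isCoveringMap_exp.eqOn_of_comp_eqOn hs hf (hg.add continuousOn_const) ?_ hy ?_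
    · intro z hz
      apply Circle.ext
      have e1 := h z hz
      have e2 := h y hy
      simp only [Function.comp_apply, Circle.coe_exp, ofReal_add, ofReal_sub, add_mul, sub_mul,
        exp_add, exp_sub]
      rw [e1, e2, div_self (exp_ne_zero _), mul_one]
    · ring
  have := h1 hx
  simp only at this
  linarith

variable {n : ℕ}

/-- The Hermitian form of signature `(n, n)` on `ℂⁿ ⊕ ℂⁿ`. -/
noncomputable def splitForm (x : Fin n ⊕ Fin n → ℂ) : ℝ :=
  ∑ i, normSq (x (Sum.inl i)) - ∑ i, normSq (x (Sum.inr i))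

/-- The matrices which preserve the Hermitian form of signature `(n, n)`. -/
def IsPseudoUnitary (M : Matrix (Fin n ⊕ Fin n) (Fin n ⊕ Fin n) ℂ) : Prop :=
  Mᴴ * fromBlocks 1 0 0 (-1) * M = fromBlocks 1 0 0 (-1)

lemma IsPseudoUnitary.one : IsPseudoUnitary (1 : Matrix (Fin n ⊕ Fin n) (Fin n ⊕ Fin n) ℂ) := by
  simp [IsPseudoUnitary]

lemma IsPseudoUnitary.mul {M N : Matrix (Fin n ⊕ Fin n) (Fin n ⊕ Fin n) ℂ}
    (hM : IsPseudoUnitary M) (hN : IsPseudoUnitary N) : IsPseudoUnitary (M * N) := by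
  unfold IsPseudoUnitary at *
  calc _ = Nᴴ * (Mᴴ * fromBlocks 1 0 0 (-1) * M) * N := by
        simp only [conjTranspose_mul, Matrix.mul_assoc]
    _ = _ := by rw [hM, hN]

lemma IsPseudoUnitary.pow {M : Matrix (Fin n ⊕ Fin n) (Fin n ⊕ Fin n) ℂ}
    (hM : IsPseudoUnitary M) (k : ℕ) : IsPseudoUnitary (M ^ k) := by
  induction k with
  | zero => simpa using IsPseudoUnitary.one
  | succ k ih => rw [pow_succ]; exact ih.mul hM

lemma signature_mul_self : (fromBlocks 1 0 0 (-1) : Matrix (Fin n ⊕ Fin n) (Fin n ⊕ Fin n) ℂ)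
    * fromBlocks 1 0 0 (-1) = 1 := by
  simp [fromBlocks_multiply]

/-- With G the signature matrix, G Mᴴ G is a left inverse of M, hence also a right inverse. -/
lemma IsPseudoUnitary.conjTranspose {M : Matrix (Fin n ⊕ Fin n) (Fin n ⊕ Fin n) ℂ}
    (hM : IsPseudoUnitary M) : IsPseudoUnitary Mᴴ := by
  unfold IsPseudoUnitary at *
  rw [conjTranspose_conjTranspose]
  have h1 : (fromBlocks 1 0 0 (-1) * Mᴴ * fromBlocks 1 0 0 (-1)) * M = 1 := by
    rw [Matrix.mul_assoc, Matrix.mul_assoc, ← Matrix.mul_assoc Mᴴ, hM, signature_mul_self]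
  have h2 := mul_eq_one_comm.mp h1
  calc _ = (M * (fromBlocks 1 0 0 (-1) * Mᴴ * fromBlocks 1 0 0 (-1)))
        * fromBlocks 1 0 0 (-1) := by
        simp only [Matrix.mul_assoc, signature_mul_self, Matrix.mul_one]
    _ = _ := by rw [h2, Matrix.one_mul]

lemma sum_normSq_eq (x : Fin n → ℂ) : ((∑ i, normSq (x i) : ℝ) : ℂ) = star x ⬝ᵥ x := by
  simp [dotProduct, normSq_eq_conj_mul_self]

lemma splitForm_eq (x : Fin n ⊕ Fin n → ℂ) :
    (splitForm x : ℂ) = star x ⬝ᵥ (fromBlocks 1 0 0 (-1) *ᵥ x) := by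
  have : (fromBlocks 1 0 0 (-1) : Matrix (Fin n ⊕ Fin n) (Fin n ⊕ Fin n) ℂ)
      = diagonal (Sum.elim 1 (-1)) := by
    ext (i | i) (j | j) <;> simp [diagonal_apply, one_apply]
    split_ifs <;> simp
  rw [this]
  simp [splitForm, dotProduct, mulVec_diagonal, normSq_eq_conj_mul_self, sub_eq_add_neg]

lemma IsPseudoUnitary.splitForm_mulVec {M : Matrix (Fin n ⊕ Fin n) (Fin n ⊕ Fin n) ℂ}
    (hM : IsPseudoUnitary M) (x : Fin n ⊕ Fin n → ℂ) : splitForm (M *ᵥ x) = splitForm x := by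
  apply ofReal_injective
  rw [splitForm_eq, splitForm_eq, star_mulVec, ← dotProduct_mulVec, mulVec_mulVec, mulVec_mulVec,
    hM]

/-- A basis of a maximal non-negative subspace of `ℂⁿ ⊕ ℂⁿ`. -/
def IsFrame (f : Matrix (Fin n ⊕ Fin n) (Fin n) ℂ) : Prop :=
  (∀ x, 0 ≤ splitForm (f *ᵥ x)) ∧ ∀ x, f *ᵥ x = 0 → x = 0

lemma sum_normSq_nonneg (x : Fin n → ℂ) : 0 ≤ ∑ i, normSq (x i) :=
  Finset.sum_nonneg fun _ _ => normSq_nonneg _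

lemma sum_normSq_eq_zero {x : Fin n → ℂ} : ∑ i, normSq (x i) = 0 ↔ x = 0 := by
  rw [Finset.sum_eq_zero_iff_of_nonneg fun _ _ => normSq_nonneg _, funext_iff]
  simp

/-- A vector killed by the upper block has form value minus the squared norm of its lower part;
non-negativity forces that part to vanish too. -/
lemma IsFrame.det_ne_zero {f : Matrix (Fin n ⊕ Fin n) (Fin n) ℂ} (hf : IsFrame f) :
    f.toRows₁.det ≠ 0 := by
  intro h0
  obtain ⟨x, hx, h1⟩ := Matrix.exists_mulVec_eq_zero_iff.mpr h0
  apply hx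
  apply hf.2
  have h2 := hf.1 x
  have h3 : ∀ i, (f *ᵥ x) (Sum.inl i) = 0 := fun i => congrFun h1 i
  simp only [splitForm, h3, map_zero, Finset.sum_const_zero, zero_sub] at h2
  have h4 : (fun i => (f *ᵥ x) (Sum.inr i)) = 0 := by
    rw [← sum_normSq_eq_zero]
    exact le_antisymm (by linarith) (sum_normSq_nonneg _)
  ext (i | i)
  · exact h3 i
  · exact congrFun h4 i

lemma IsFrame.mul {M : Matrix (Fin n ⊕ Fin n) (Fin n ⊕ Fin n) ℂ} (hM : IsPseudoUnitary M)
    {f : Matrix (Fin n ⊕ Fin n) (Fin n) ℂ} (hf : IsFrame f) : IsFrame (M * f) := by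
  refine ⟨fun x => ?_, fun x hx => hf.2 x ?_⟩
  · rw [← mulVec_mulVec, hM.splitForm_mulVec]
    exact hf.1 x
  · rw [← mulVec_mulVec] at hx
    have h1 : (fromBlocks 1 0 0 (-1) * Mᴴ * fromBlocks 1 0 0 (-1)) * M = 1 := by
      rw [Matrix.mul_assoc, Matrix.mul_assoc, ← Matrix.mul_assoc Mᴴ, hM, signature_mul_self]
    rw [← one_mulVec (f *ᵥ x), ← h1, ← mulVec_mulVec, hx, mulVec_zero]

/-- The standard positive frame. -/
def stdFrame (n : ℕ) : Matrix (Fin n ⊕ Fin n) (Fin n) ℂ := fromRows 1 0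

lemma splitForm_sumElim (x y : Fin n → ℂ) :
    splitForm (Sum.elim x y) = ∑ i, normSq (x i) - ∑ i, normSq (y i) := rfl

/-- The frames normalized to be graphs over the standard frame. -/
lemma isFrame_fromRows_one {K : Matrix (Fin n) (Fin n) ℂ}
    (hK : ∀ x, ∑ i, normSq ((K *ᵥ x) i) ≤ ∑ i, normSq (x i)) : IsFrame (fromRows 1 K) := by
  refine ⟨fun x => ?_, fun x hx => ?_⟩
  · rw [fromRows_mulVec, splitForm_sumElim, one_mulVec]
    exact sub_nonneg.mpr (hK x)
  · ext i
    simpa [fromRows_mulVec] using congrFun hx (Sum.inl i)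

lemma isFrame_stdFrame : IsFrame (stdFrame n) :=
  isFrame_fromRows_one fun x => by simpa using sum_normSq_nonneg x

lemma mul_stdFrame_toRows₁ (M : Matrix (Fin n ⊕ Fin n) (Fin n ⊕ Fin n) ℂ) :
    (M * stdFrame n).toRows₁ = M.toBlocks₁₁ := by
  conv_lhs => rw [← fromBlocks_toBlocks M]
  rw [stdFrame, fromBlocks_mul_fromRows]
  simp

lemma IsPseudoUnitary.det_ne_zero {M : Matrix (Fin n ⊕ Fin n) (Fin n ⊕ Fin n) ℂ}
    (hM : IsPseudoUnitary M) : M.toBlocks₁₁.det ≠ 0 := by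
  rw [← mul_stdFrame_toRows₁]
  exact (isFrame_stdFrame.mul hM).det_ne_zero

/-- A maximal non-negative subspace is the graph of a contraction K. Scaling K to 0 then makes the
space of such subspaces contractible, which is what `relArg_cocycle` needs. -/
lemma IsFrame.exists_contraction {f : Matrix (Fin n ⊕ Fin n) (Fin n) ℂ} (hf : IsFrame f) :
    ∃ K : Matrix (Fin n) (Fin n) ℂ, (∀ x, ∑ i, normSq ((K *ᵥ x) i) ≤ ∑ i, normSq (x i)) ∧
      f = fromRows 1 K * f.toRows₁ := by
  have hu := hf.det_ne_zero.isUnit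
  refine ⟨f.toRows₂ * f.toRows₁⁻¹, fun x => ?_, ?_⟩
  · have := hf.1 (f.toRows₁⁻¹ *ᵥ x)
    nth_rewrite 1 [← fromRows_toRows f] at this
    rw [fromRows_mulVec, splitForm_sumElim, mulVec_mulVec, mulVec_mulVec,
      Matrix.mul_nonsing_inv _ hu, one_mulVec] at this
    linarith
  · nth_rewrite 1 [← fromRows_toRows f]
    rw [fromRows_mul, Matrix.one_mul, Matrix.mul_assoc, Matrix.nonsing_inv_mul _ hu,
      Matrix.mul_one]

/-- The matrix comparing the action of `M` on the frame `f` with that on the standard frame. -/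
noncomputable def relMatrix (M : Matrix (Fin n ⊕ Fin n) (Fin n ⊕ Fin n) ℂ)
    (f : Matrix (Fin n ⊕ Fin n) (Fin n) ℂ) : Matrix (Fin n) (Fin n) ℂ :=
  M.toBlocks₁₁⁻¹ * (M * f).toRows₁ * f.toRows₁⁻¹

lemma toRows₁_mul {m : Type*} (f : Matrix (Fin n ⊕ Fin n) (Fin n) ℂ) (R : Matrix (Fin n) m ℂ) :
    (f * R).toRows₁ = f.toRows₁ * R := rfl

/-- Only the subspace spanned by the frame matters, so frames may be normalized to graphs. -/
lemma relMatrix_mul (M : Matrix (Fin n ⊕ Fin n) (Fin n ⊕ Fin n) ℂ)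
    (f : Matrix (Fin n ⊕ Fin n) (Fin n) ℂ) {R : Matrix (Fin n) (Fin n) ℂ} (hR : R.det ≠ 0) :
    relMatrix M (f * R) = relMatrix M f := by
  rw [relMatrix, relMatrix, ← Matrix.mul_assoc M, toRows₁_mul, toRows₁_mul, Matrix.mul_inv_rev]
  simp only [Matrix.mul_assoc]
  rw [← Matrix.mul_assoc R, Matrix.mul_nonsing_inv _ hR.isUnit, Matrix.one_mul]

lemma relMatrix_stdFrame {M : Matrix (Fin n ⊕ Fin n) (Fin n ⊕ Fin n) ℂ}
    (hM : IsPseudoUnitary M) : relMatrix M (stdFrame n) = 1 := by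
  rw [relMatrix, mul_stdFrame_toRows₁, Matrix.nonsing_inv_mul _ hM.det_ne_zero.isUnit]
  simp [stdFrame]

lemma re_dotProduct_ge (u k : Fin n → ℂ) :
    -(∑ i, normSq (u i) + ∑ i, normSq (k i)) ≤ 2 * (star u ⬝ᵥ k).re := by
  rw [dotProduct, re_sum, ← Finset.sum_add_distrib, ← Finset.sum_neg_distrib, Finset.mul_sum]
  refine Finset.sum_le_sum fun i _ => ?_
  simp only [normSq_apply, Pi.star_apply, RCLike.star_def, mul_re, conj_re, conj_im]
  nlinarith [sq_nonneg ((u i).re + (k i).re), sq_nonneg ((u i).im + (k i).im)]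

/-- For the graph of K the matrix is 1 + a⁻¹ b K, with a, b the upper blocks of M. Put y = (a⁻¹)ᴴ x.
Since Mᴴ preserves the form, |x|² - |bᴴ y|² = |y|² > 0, so the pairing of bᴴ y with K x, where |K x|
≤ |x|, cannot outweigh |x|². -/
lemma accretive_relMatrix {M : Matrix (Fin n ⊕ Fin n) (Fin n ⊕ Fin n) ℂ}
    (hM : IsPseudoUnitary M) {f : Matrix (Fin n ⊕ Fin n) (Fin n) ℂ} (hf : IsFrame f) :
    Accretive (relMatrix M f) := by
  obtain ⟨K, hK, hfK⟩ := hf.exists_contraction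
  rw [hfK, relMatrix_mul _ _ hf.det_ne_zero]
  intro x hx
  have hu := hM.det_ne_zero.isUnit
  set a := M.toBlocks₁₁ with ha
  set b := M.toBlocks₁₂ with hb
  have hrel : relMatrix M (fromRows 1 K) = 1 + a⁻¹ * b * K := by
    rw [relMatrix, ← ha]
    conv_lhs => rw [← fromBlocks_toBlocks M, fromBlocks_mul_fromRows]
    rw [toRows₁_fromRows, toRows₁_fromRows, ← ha, ← hb, inv_one, Matrix.mul_one, Matrix.mul_one,
      Matrix.mul_add, Matrix.nonsing_inv_mul _ hu, Matrix.mul_assoc]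
  set y : Fin n → ℂ := (a⁻¹)ᴴ *ᵥ x with hy
  have hxy : aᴴ *ᵥ y = x := by
    rw [hy, mulVec_mulVec, ← conjTranspose_mul, Matrix.nonsing_inv_mul _ hu, conjTranspose_one,
      one_mulVec]
  have hy0 : y ≠ 0 := by
    intro h0
    apply hx
    rw [← hxy, h0, mulVec_zero]
  have hq := hM.conjTranspose.splitForm_mulVec (Sum.elim y 0)
  rw [← fromBlocks_toBlocks M, fromBlocks_conjTranspose, fromBlocks_mulVec] at hq
  simp only [Sum.elim_comp_inl, Sum.elim_comp_inr, mulVec_zero, add_zero, splitForm_sumElim,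
    ← ha, ← hb, hxy] at hq
  have hypos : 0 < ∑ i, normSq (y i) :=
    lt_of_le_of_ne (sum_normSq_nonneg y) fun h => hy0 (sum_normSq_eq_zero.mp h.symm)
  have hin : star x ⬝ᵥ (relMatrix M (fromRows 1 K) *ᵥ x)
      = ((∑ i, normSq (x i) : ℝ) : ℂ) + star (bᴴ *ᵥ y) ⬝ᵥ (K *ᵥ x) := by
    rw [hrel, add_mulVec, one_mulVec, dotProduct_add, sum_normSq_eq]
    congr 1
    rw [hy, star_mulVec, star_mulVec, conjTranspose_conjTranspose, conjTranspose_conjTranspose,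
      vecMul_vecMul, ← dotProduct_mulVec, mulVec_mulVec]
  rw [hin, add_re, ofReal_re]
  have h1 := re_dotProduct_ge (bᴴ *ᵥ y) (K *ᵥ x)
  have h2 := hK x
  simp only [Pi.zero_apply, map_zero, Finset.sum_const_zero, sub_zero] at hq
  linarith

/-- The argument of the determinant of `relMatrix`. -/
noncomputable def relArg (M : Matrix (Fin n ⊕ Fin n) (Fin n ⊕ Fin n) ℂ)
    (f : Matrix (Fin n ⊕ Fin n) (Fin n) ℂ) : ℝ :=
  argDet n (relMatrix M f)

lemma exp_eq_of_pos_mul_eq {θ η : ℝ} {r s : ℝ} (hr : 0 < r) (hs : 0 < s)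
    (h : r * exp (θ * I) = s * exp (η * I)) : exp (θ * I) = exp (η * I) := by
  have h1 := congrArg norm h
  simp only [norm_mul, norm_real, norm_exp_ofReal_mul_I, mul_one, Real.norm_eq_abs,
    abs_of_pos hr, abs_of_pos hs] at h1
  rw [h1] at h
  exact mul_left_cancel₀ (by exact_mod_cast hs.ne') h

/-- The cocycle identity modulo 2π, which is multiplicativity of the determinant. -/
lemma relArg_cocycle_exp {M N : Matrix (Fin n ⊕ Fin n) (Fin n ⊕ Fin n) ℂ}
    (hM : IsPseudoUnitary M) (hN : IsPseudoUnitary N) {f : Matrix (Fin n ⊕ Fin n) (Fin n) ℂ}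
    (hf : IsFrame f) :
    exp (((relArg (M * N) f + relArg M (N * stdFrame n) : ℝ) : ℂ) * I)
      = exp (((relArg M (N * f) + relArg N f : ℝ) : ℂ) * I) := by
  have e1 := accretive_relMatrix (hM.mul hN) hf
  have e2 := accretive_relMatrix hM (isFrame_stdFrame.mul hN)
  have e3 := accretive_relMatrix hM (hf.mul hN)
  have e4 := accretive_relMatrix hN hf
  refine exp_eq_of_pos_mul_eq
    (mul_pos (norm_pos_iff.mpr e1.det_ne_zero) (norm_pos_iff.mpr e2.det_ne_zero))
    (mul_pos (norm_pos_iff.mpr e3.det_ne_zero) (norm_pos_iff.mpr e4.det_ne_zero)) ?_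
  have hdet : (relMatrix (M * N) f).det * (relMatrix M (N * stdFrame n)).det
      = (relMatrix M (N * f)).det * (relMatrix N f).det := by
    have h1 := (hM.mul hN).det_ne_zero
    have h2 := hM.det_ne_zero
    have h3 := hN.det_ne_zero
    have h4 := hf.det_ne_zero
    have h5 := (hf.mul hN).det_ne_zero
    simp only [relMatrix, det_mul, ← Matrix.mul_assoc, mul_stdFrame_toRows₁, det_nonsing_inv,
      Ring.inverse_eq_inv']
    field_simp
  calc _ = (‖(relMatrix (M * N) f).det‖ * exp (argDet n (relMatrix (M * N) f) * I))
        * (‖(relMatrix M (N * stdFrame n)).det‖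
          * exp (argDet n (relMatrix M (N * stdFrame n)) * I)) := by
        simp only [relArg, ofReal_add, ofReal_mul, add_mul, exp_add]
        ring
    _ = (‖(relMatrix M (N * f)).det‖ * exp (argDet n (relMatrix M (N * f)) * I))
        * (‖(relMatrix N f).det‖ * exp (argDet n (relMatrix N f) * I)) := by
        rw [← e1.det_eq, ← e2.det_eq, ← e3.det_eq, ← e4.det_eq, hdet]
    _ = _ := by
        simp only [relArg, ofReal_add, ofReal_mul, add_mul, exp_add]
        ring

lemma continuousOn_relArg {α : Type*} [TopologicalSpace α] {s : Set α}
    {M : α → Matrix (Fin n ⊕ Fin n) (Fin n ⊕ Fin n) ℂ} {f : α → Matrix (Fin n ⊕ Fin n) (Fin n) ℂ}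
    (hM : ContinuousOn M s) (hf : ContinuousOn f s) (hMu : ∀ t ∈ s, IsPseudoUnitary (M t))
    (hff : ∀ t ∈ s, IsFrame (f t)) : ContinuousOn (fun t => relArg (M t) (f t)) s := by
  refine (continuousOn_argDet n).comp ?_ (fun t ht => accretive_relMatrix (hMu t ht) (hff t ht))
  have hinv : ∀ g : α → Matrix (Fin n) (Fin n) ℂ, ContinuousOn g s →
      (∀ t ∈ s, (g t).det ≠ 0) → ContinuousOn (fun t => (g t)⁻¹) s := by
    intro g hg h0
    simp only [Matrix.inv_def, Ring.inverse_eq_inv']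
    refine ContinuousOn.smul (ContinuousOn.inv₀ ?_ h0) ?_
    · exact (Continuous.matrix_det continuous_id).comp_continuousOn hg
    · exact (Continuous.matrix_adjugate continuous_id).comp_continuousOn hg
  have hr : Continuous (toRows₁ : Matrix (Fin n ⊕ Fin n) (Fin n) ℂ → _) := by
    unfold toRows₁
    fun_prop
  have hb : Continuous (toBlocks₁₁ : Matrix (Fin n ⊕ Fin n) (Fin n ⊕ Fin n) ℂ → _) := by
    unfold toBlocks₁₁
    fun_prop
  unfold relMatrix
  refine ContinuousOn.mul (ContinuousOn.mul (hinv _ (hb.comp_continuousOn hM)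
    fun t ht => (hMu t ht).det_ne_zero) ?_) (hinv _ (hr.comp_continuousOn hf)
    fun t ht => (hff t ht).det_ne_zero)
  refine hr.comp_continuousOn ?_
  have : Continuous fun p : Matrix (Fin n ⊕ Fin n) (Fin n ⊕ Fin n) ℂ ×
    Matrix (Fin n ⊕ Fin n) (Fin n) ℂ => p.1 * p.2 := by fun_prop
  exact this.comp_continuousOn (hM.prodMk hf)

/-- Both sides are continuous along the graphs of sK, 0 ≤ s ≤ 1, and agree modulo 2π. At s = 0 the
frame is the standard one and both equal `relArg M (N * stdFrame n)`, so no multiple of 2π survives.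
-/
lemma relArg_cocycle {M N : Matrix (Fin n ⊕ Fin n) (Fin n ⊕ Fin n) ℂ}
    (hM : IsPseudoUnitary M) (hN : IsPseudoUnitary N) {f : Matrix (Fin n ⊕ Fin n) (Fin n) ℂ}
    (hf : IsFrame f) :
    relArg (M * N) f + relArg M (N * stdFrame n) = relArg M (N * f) + relArg N f := by
  obtain ⟨K, hK, hfK⟩ := hf.exists_contraction
  have hd := hf.det_ne_zero
  have key : relArg (M * N) (fromRows 1 K) + relArg M (N * stdFrame n)
      = relArg M (N * (fromRows 1 K : Matrix (Fin n ⊕ Fin n) (Fin n) ℂ)) + relArg N (fromRows 1 K) := by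
    have hfr : ∀ s ∈ Set.Icc (0 : ℝ) 1, IsFrame (fromRows 1 ((s : ℂ) • K)) := by
      intro s hs
      refine isFrame_fromRows_one fun x => ?_
      refine le_trans (Finset.sum_le_sum fun i _ => ?_) (hK x)
      rw [smul_mulVec, Pi.smul_apply, smul_eq_mul, normSq_mul, normSq_ofReal]
      have : s * s ≤ 1 := by nlinarith [hs.1, hs.2]
      exact mul_le_of_le_one_left (normSq_nonneg _) this
    have hcf : ContinuousOn (fun s : ℝ => (fromRows 1 ((s : ℂ) • K) :
        Matrix (Fin n ⊕ Fin n) (Fin n) ℂ)) (Set.Icc 0 1) := by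
      refine Continuous.continuousOn (continuous_matrix ?_)
      rintro (i | i) j
      · simp only [fromRows_apply_inl]
        fun_prop
      · simp only [fromRows_apply_inr, Matrix.smul_apply]
        fun_prop
    have hcN : ContinuousOn (fun s : ℝ => N * (fromRows 1 ((s : ℂ) • K) :
        Matrix (Fin n ⊕ Fin n) (Fin n) ℂ)) (Set.Icc 0 1) :=
      (Continuous.matrix_mul continuous_const continuous_id).comp_continuousOn hcf
    have := sub_eq_sub_of_exp_eq (isPreconnected_Icc (a := (0 : ℝ)) (b := 1))
      (f := fun s => relArg (M * N) (fromRows 1 ((s : ℂ) • K)) + relArg M (N * stdFrame n))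
      (g := fun s => relArg M
        (N * (fromRows 1 ((s : ℂ) • K) : Matrix (Fin n ⊕ Fin n) (Fin n) ℂ)) + relArg N (fromRows 1 ((s : ℂ) • K)))
      ((continuousOn_relArg continuousOn_const hcf (fun _ _ => hM.mul hN) hfr).add
        continuousOn_const)
      ((continuousOn_relArg continuousOn_const hcN (fun _ _ => hM)
        (fun s hs => (hfr s hs).mul hN)).add
        (continuousOn_relArg continuousOn_const hcf (fun _ _ => hN) hfr))
      (fun s hs => relArg_cocycle_exp hM hN (hfr s hs))
      (Set.right_mem_Icc.mpr zero_le_one) (Set.left_mem_Icc.mpr zero_le_one)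
    have h0 : (fromRows 1 (((0 : ℝ) : ℂ) • K) : Matrix (Fin n ⊕ Fin n) (Fin n) ℂ)
        = stdFrame n := by simp [stdFrame]
    have e1 : relArg (M * N) (stdFrame n) = 0 := by
      rw [relArg, relMatrix_stdFrame (hM.mul hN), argDet_one]
    have e2 : relArg N (stdFrame n) = 0 := by rw [relArg, relMatrix_stdFrame hN, argDet_one]
    simp only [h0, e1, e2, ofReal_one, one_smul] at this
    linarith
  have hre : ∀ P, relArg P f = relArg P (fromRows 1 K) := fun P => by
    rw [relArg, relArg]
    conv_lhs => rw [hfK]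
    rw [relMatrix_mul _ _ hd]
  have hre2 : relArg M (N * f) = relArg M (N * (fromRows 1 K : Matrix (Fin n ⊕ Fin n) (Fin n) ℂ)) := by
    rw [relArg, relArg]
    conv_lhs => rw [hfK]
    rw [← Matrix.mul_assoc, relMatrix_mul _ _ hd]
  rw [hre, hre, hre2, key]

lemma abs_relArg_le {M : Matrix (Fin n ⊕ Fin n) (Fin n ⊕ Fin n) ℂ}
    (hM : IsPseudoUnitary M) {f : Matrix (Fin n ⊕ Fin n) (Fin n) ℂ} (hf : IsFrame f) :
    |relArg M f| ≤ n * (Real.pi / 2) :=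
  abs_argDet_le (accretive_relMatrix hM hf)

/-! ### The bounded correction and determinants on invariant subspaces. -/

/-- The correction which turns the argument of the determinant of the upper left block into a
homogeneous quantity. -/
noncomputable def correction (M : Matrix (Fin n ⊕ Fin n) (Fin n ⊕ Fin n) ℂ) : ℝ :=
  ∑' k : ℕ, (1 / 2 : ℝ) ^ (k + 1) * relArg (M ^ 2 ^ k) (M ^ 2 ^ k * stdFrame n)

lemma norm_correction_term_le {M : Matrix (Fin n ⊕ Fin n) (Fin n ⊕ Fin n) ℂ}
    (hM : IsPseudoUnitary M) (k : ℕ) :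
    ‖(1 / 2 : ℝ) ^ (k + 1) * relArg (M ^ 2 ^ k) (M ^ 2 ^ k * stdFrame n)‖
      ≤ n * (Real.pi / 2) / 2 * (1 / 2) ^ k := by
  have := abs_relArg_le (hM.pow (2 ^ k)) (isFrame_stdFrame.mul (hM.pow (2 ^ k)))
  rw [norm_mul, Real.norm_eq_abs (relArg _ _), Real.norm_of_nonneg (by positivity), pow_succ]
  have h2 : (0 : ℝ) ≤ (1 / 2) ^ k := by positivity
  nlinarith

lemma summable_correction_bound :
    Summable fun k : ℕ => n * (Real.pi / 2) / 2 * (1 / 2 : ℝ) ^ k :=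
  (summable_geometric_two).mul_left _

lemma abs_correction_le {M : Matrix (Fin n ⊕ Fin n) (Fin n ⊕ Fin n) ℂ}
    (hM : IsPseudoUnitary M) : |correction M| ≤ n * (Real.pi / 2) := by
  have := tsum_of_norm_bounded
    ((hasSum_geometric_two).mul_left ((n : ℝ) * (Real.pi / 2) / 2)) (norm_correction_term_le hM)
  rw [Real.norm_eq_abs] at this
  unfold correction
  linarith

/-- The geometric bound on the terms does not depend on M, so the series converges uniformly. The
continuity of the argument of ρ comes from here. -/
lemma continuousOn_correction {α : Type*} [TopologicalSpace α] {s : Set α}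
    {M : α → Matrix (Fin n ⊕ Fin n) (Fin n ⊕ Fin n) ℂ} (hM : ContinuousOn M s)
    (hMu : ∀ t ∈ s, IsPseudoUnitary (M t)) : ContinuousOn (fun t => correction (M t)) s := by
  refine continuousOn_tsum (fun k => ?_) summable_correction_bound
    (fun k t ht => norm_correction_term_le (hMu t ht) k)
  have hp : ContinuousOn (fun t => M t ^ 2 ^ k) s := hM.pow _
  refine continuousOn_const.mul (continuousOn_relArg hp ?_ (fun t ht => (hMu t ht).pow _)
    (fun t ht => isFrame_stdFrame.mul ((hMu t ht).pow _)))
  exact (Continuous.matrix_mul continuous_id continuous_const).comp_continuousOn hp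

/-- On an invariant maximal non-negative subspace the corrected determinant of the upper left
block has the direction of the determinant. -/
theorem exists_pos_det_eq {M : Matrix (Fin n ⊕ Fin n) (Fin n ⊕ Fin n) ℂ}
    (hM : IsPseudoUnitary M) {f : Matrix (Fin n ⊕ Fin n) (Fin n) ℂ} (hf : IsFrame f)
    {R : Matrix (Fin n) (Fin n) ℂ} (hR : M * f = f * R) :
    ∃ r : ℝ, 0 < r ∧ R.det = r * (M.toBlocks₁₁.det * exp (correction M * I)) := by
  have hpow : ∀ k, M ^ k * f = f * R ^ k := by
    intro k
    induction k with
    | zero => simp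
    | succ k ih => rw [pow_succ, Matrix.mul_assoc, hR, ← Matrix.mul_assoc, ih, pow_succ,
        Matrix.mul_assoc]
  have hRd : R.det ≠ 0 := by
    intro h0
    apply (hf.mul hM).det_ne_zero
    rw [hR, toRows₁_mul, det_mul, h0, mul_zero]
  -- The cocycle for the product of M^(2^k) with itself. As M^(2^k) f spans the same subspace as f,
  -- both terms on its right side equal `relArg (M ^ 2 ^ k) f`; dividing by 2^(k+1) makes the series
  -- telescope.
  have hstep : ∀ k : ℕ, (1 / 2 : ℝ) ^ (k + 1) * relArg (M ^ 2 ^ k) (M ^ 2 ^ k * stdFrame n)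
      = (1 / 2) ^ k * relArg (M ^ 2 ^ k) f - (1 / 2) ^ (k + 1) * relArg (M ^ 2 ^ (k + 1)) f := by
    intro k
    have := relArg_cocycle (hM.pow (2 ^ k)) (hM.pow (2 ^ k)) hf
    rw [hpow, relArg, relArg, relArg, relArg, relMatrix_mul _ _ (by
      rw [det_pow]; exact pow_ne_zero _ hRd), ← pow_add, ← two_mul, ← pow_succ'] at this
    simp only [relArg]
    rw [pow_succ]
    linear_combination (1 / 2 : ℝ) ^ k * (1 / 2) * this
  have hsum : HasSum (fun k : ℕ => (1 / 2 : ℝ) ^ (k + 1)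
      * relArg (M ^ 2 ^ k) (M ^ 2 ^ k * stdFrame n)) (relArg M f) := by
    have hs : Summable (fun k : ℕ => (1 / 2 : ℝ) ^ (k + 1)
        * relArg (M ^ 2 ^ k) (M ^ 2 ^ k * stdFrame n)) :=
      Summable.of_norm_bounded summable_correction_bound (norm_correction_term_le hM)
    have ht := hs.hasSum.tendsto_sum_nat
    have ht2 : Filter.Tendsto (fun m : ℕ => ∑ k ∈ Finset.range m, (1 / 2 : ℝ) ^ (k + 1)
        * relArg (M ^ 2 ^ k) (M ^ 2 ^ k * stdFrame n)) Filter.atTop (nhds (relArg M f - 0)) := by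
      have : ∀ m : ℕ, ∑ k ∈ Finset.range m, (1 / 2 : ℝ) ^ (k + 1)
          * relArg (M ^ 2 ^ k) (M ^ 2 ^ k * stdFrame n)
          = relArg M f - (1 / 2) ^ m * relArg (M ^ 2 ^ m) f := by
        intro m
        rw [Finset.sum_congr rfl fun k _ => hstep k, Finset.sum_range_sub']
        simp
      simp only [this]
      refine tendsto_const_nhds.sub ?_
      refine squeeze_zero_norm (a := fun m : ℕ => (1 / 2 : ℝ) ^ m * (n * (Real.pi / 2)))
        (fun m => ?_) ?_
      · rw [norm_mul, Real.norm_of_nonneg (by positivity), Real.norm_eq_abs]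
        exact mul_le_mul_of_nonneg_left (abs_relArg_le (hM.pow _) hf) (by positivity)
      · have := (tendsto_pow_atTop_nhds_zero_of_lt_one (r := (1 / 2 : ℝ)) (by norm_num)
          (by norm_num)).mul_const (n * (Real.pi / 2))
        simpa using this
    rw [sub_zero] at ht2
    rw [← tendsto_nhds_unique ht ht2]
    exact hs.hasSum
  have hacc := accretive_relMatrix hM hf
  have hM0 := hM.det_ne_zero
  have hf0 := hf.det_ne_zero
  refine ⟨‖(relMatrix M f).det‖, norm_pos_iff.mpr hacc.det_ne_zero, ?_⟩
  have h1 := hacc.det_eq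
  have h2 : (relMatrix M f).det = R.det / M.toBlocks₁₁.det := by
    simp only [relMatrix, hR, toRows₁_mul, det_mul, det_nonsing_inv, Ring.inverse_eq_inv']
    field_simp
  have h3 : correction M = argDet n (relMatrix M f) := hsum.tsum_eq
  rw [h3]
  calc R.det = (relMatrix M f).det * M.toBlocks₁₁.det := by rw [h2]; field_simp
    _ = _ := by
      nth_rewrite 1 [h1]
      ring

end SalamonZehnder

/-! ### Invariant semidefinite subspaces of isometries of a Hermitian form. -/

namespace SalamonZehnder

open Module Complex

section Krein

variable {E : Type*} [AddCommGroup E] [Module ℂ E]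

/-- A nondegenerate Hermitian form. -/
structure IsKrein (κ : E →ₗ⋆[ℂ] E →ₗ[ℂ] ℂ) : Prop where
  symm : ∀ x y, κ y x = starRingEnd ℂ (κ x y)
  nondeg : ∀ x, (∀ y, κ x y = 0) → x = 0

variable {κ : E →ₗ⋆[ℂ] E →ₗ[ℂ] ℂ}

lemma IsKrein.neg (hκ : IsKrein κ) : IsKrein (-κ) :=
  ⟨fun x y => by simp [hκ.symm x y], fun x h => hκ.nondeg x fun y => by simpa using h y⟩

lemma IsKrein.eq_zero_comm (hκ : IsKrein κ) {x y : E} (h : κ x y = 0) : κ y x = 0 := by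
  rw [hκ.symm x y, h, map_zero]

lemma IsKrein.self_eq (hκ : IsKrein κ) (x : E) : κ x x = ((κ x x).re : ℂ) :=
  (conj_eq_iff_re.mp (hκ.symm x x).symm).symm

lemma IsKrein.self_eq_zero (hκ : IsKrein κ) {x : E} (h : (κ x x).re = 0) : κ x x = 0 := by
  rw [hκ.self_eq, h, ofReal_zero]

lemma form_add_of_ortho (hκ : IsKrein κ) {x y : E} (h : κ x y = 0) :
    κ (x + y) (x + y) = κ x x + κ y y := by
  simp [h, hκ.eq_zero_comm h]

/-- In a semidefinite subspace the isotropic vectors are in the radical. -/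
lemma eq_zero_of_isotropic (hκ : IsKrein κ) {U : Submodule ℂ E}
    (hU : ∀ x ∈ U, 0 ≤ (κ x x).re) {x y : E} (hx : x ∈ U) (hy : y ∈ U)
    (h0 : (κ x x).re = 0) : κ x y = 0 := by
  by_contra hne
  set c := κ x y with hc
  have hpos : 0 < normSq c := normSq_pos.mpr hne
  -- Chosen so that the form takes the value -1 at s c x + y.
  set s : ℝ := -((κ y y).re + 1) / (2 * normSq c) with hs
  have h1 := hU (((s : ℂ) * c) • x + y) (U.add_mem (U.smul_mem _ hx) hy)
  have hyx : κ y x = starRingEnd ℂ c := hκ.symm x y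
  have h2 : κ (((s : ℂ) * c) • x + y) (((s : ℂ) * c) • x + y)
      = ((2 * s * normSq c : ℝ) : ℂ) + κ y y := by
    simp only [map_add, map_smulₛₗ, LinearMap.add_apply, LinearMap.smul_apply, hyx, ← hc,
      hκ.self_eq_zero h0, map_mul, conj_ofReal, smul_eq_mul, ofReal_mul,
      normSq_eq_conj_mul_self, ofReal_ofNat, RingHom.id_apply]
    ring
  rw [h2, add_re, ofReal_re] at h1
  have h3 : 2 * s * normSq c = -((κ y y).re + 1) := by
    rw [hs]
    field_simp
  linarith

variable [FiniteDimensional ℂ E]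

lemma finrank_le_inf_orthogonal (F U : Submodule ℂ E) :
    finrank ℂ F ≤ finrank ℂ (F ⊓ U.orthogonalBilin κ : Submodule ℂ E) + finrank ℂ U := by
  let b := finBasis ℂ U
  let φ : E →ₗ[ℂ] (Fin (finrank ℂ U) → ℂ) := LinearMap.pi fun i => κ (b i)
  have hker : LinearMap.ker φ = U.orthogonalBilin κ := by
    ext x
    rw [LinearMap.mem_ker, Submodule.mem_orthogonalBilin_iff]
    constructor
    · intro h u hu
      have h1 := congrArg (Submodule.subtype U) (b.sum_repr ⟨u, hu⟩)
      rw [map_sum] at h1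
      rw [show u = U.subtype ⟨u, hu⟩ from rfl, ← h1]
      simp only [map_smul, map_sum, LinearMap.sum_apply, map_smulₛₗ, LinearMap.smul_apply]
      refine Finset.sum_eq_zero fun i _ => ?_
      have := congrFun h i
      simp only [φ, LinearMap.pi_apply, Pi.zero_apply] at this
      simp [this]
    · intro h
      ext i
      exact h (b i) (b i).2
  have h1 := LinearMap.finrank_range_add_finrank_ker (φ.domRestrict F)
  have h2 : finrank ℂ (LinearMap.range (φ.domRestrict F)) ≤ finrank ℂ U := by
    refine (Submodule.finrank_le _).trans ?_
    simp
  have h3 : finrank ℂ (LinearMap.ker (φ.domRestrict F))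
      = finrank ℂ (F ⊓ U.orthogonalBilin κ : Submodule ℂ E) := by
    rw [← hker, ← Submodule.map_comap_subtype, Submodule.finrank_map_subtype_eq]
    rfl
  omega

/-- By nondegeneracy the functionals attached to a basis of U are independent, so they map E onto
ℂ^(dim U). -/
lemma finrank_orthogonal_add (hκ : IsKrein κ) (U : Submodule ℂ E) :
    finrank ℂ (U.orthogonalBilin κ) + finrank ℂ U = finrank ℂ E := by
  let b := finBasis ℂ U
  let φ : E →ₗ[ℂ] (Fin (finrank ℂ U) → ℂ) := LinearMap.pi fun i => κ (b i)
  have hle := finrank_le_inf_orthogonal (κ := κ) ⊤ U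
  rw [top_inf_eq, finrank_top] at hle
  have hker : U.orthogonalBilin κ ≤ LinearMap.ker φ := by
    intro x hx
    rw [LinearMap.mem_ker]
    ext i
    exact hx (b i) (b i).2
  have hr : LinearMap.range φ = ⊤ := by
    by_contra hne
    obtain ⟨f, hf, hle⟩ := Submodule.exists_le_ker_of_lt_top _ (lt_top_iff_ne_top.mpr hne)
    apply hf
    have h1 : ∀ x, ∑ i, f (Pi.single i 1) * κ (b i) x = 0 := by
      intro x
      have h2 : f (φ x) = 0 := hle ⟨x, rfl⟩
      rw [← Finset.univ_sum_single (φ x), map_sum] at h2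
      rw [← h2]
      refine Finset.sum_congr rfl fun i _ => ?_
      have : (Pi.single i (φ x i) : Fin (finrank ℂ U) → ℂ) = φ x i • Pi.single i 1 := by
        rw [← Pi.single_smul, smul_eq_mul, mul_one]
      rw [this, map_smul, smul_eq_mul, mul_comm]
      rfl
    have h2 : ∑ i, starRingEnd ℂ (f (Pi.single i 1)) • (b i : E) = 0 := by
      apply hκ.nondeg
      intro x
      simpa using h1 x
    have h3 : ∑ i, starRingEnd ℂ (f (Pi.single i 1)) • b i = 0 := by
      apply U.injective_subtype
      simpa using h2
    have h4 := Fintype.linearIndependent_iff.mp b.linearIndependent _ h3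
    refine LinearMap.pi_ext' fun i => ?_
    ext
    simpa using h4 i
  have h1 := LinearMap.finrank_range_add_finrank_ker φ
  rw [hr, finrank_top, finrank_fin_fun] at h1
  have := Submodule.finrank_mono hker
  omega

/-- A pair of orthogonal invariant subspaces, one non-negative and the other non-positive. -/
structure IsInvariantPair (κ : E →ₗ⋆[ℂ] E →ₗ[ℂ] ℂ) (A : End ℂ E) (L N : Submodule ℂ E) :
    Prop where
  mapsTo_left : ∀ x ∈ L, A x ∈ L
  mapsTo_right : ∀ x ∈ N, A x ∈ N
  nonneg : ∀ x ∈ L, 0 ≤ (κ x x).re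
  nonpos : ∀ x ∈ N, (κ x x).re ≤ 0
  ortho : ∀ x ∈ L, ∀ y ∈ N, κ x y = 0

variable {A : End ℂ E} {L N : Submodule ℂ E}

omit [FiniteDimensional ℂ E] in
lemma IsInvariantPair.swap (hκ : IsKrein κ) (h : IsInvariantPair κ A L N) :
    IsInvariantPair (-κ) A N L where
  mapsTo_left := h.mapsTo_right
  mapsTo_right := h.mapsTo_left
  nonneg x hx := by simpa using h.nonpos x hx
  nonpos x hx := by simpa using h.nonneg x hx
  ortho x hx y hy := by simpa using hκ.eq_zero_comm (h.ortho y hy x hx)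

omit [FiniteDimensional ℂ E] in
lemma IsInvariantPair.sup_left (hκ : IsKrein κ) (h : IsInvariantPair κ A L N)
    {S : Submodule ℂ E} (hS : ∀ x ∈ S, A x ∈ S) (hS0 : ∀ x ∈ S, 0 ≤ (κ x x).re)
    (hSo : S ≤ (L ⊔ N).orthogonalBilin κ) : IsInvariantPair κ A (L ⊔ S) N where
  mapsTo_left x hx := by
    obtain ⟨l, hl, s, hs, rfl⟩ := Submodule.mem_sup.mp hx
    rw [map_add]
    exact Submodule.add_mem_sup (h.mapsTo_left l hl) (hS s hs)
  mapsTo_right := h.mapsTo_right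
  nonneg x hx := by
    obtain ⟨l, hl, s, hs, rfl⟩ := Submodule.mem_sup.mp hx
    rw [form_add_of_ortho hκ (hSo hs l (Submodule.mem_sup_left hl)), add_re]
    exact add_nonneg (h.nonneg l hl) (hS0 s hs)
  nonpos := h.nonpos
  ortho x hx y hy := by
    obtain ⟨l, hl, s, hs, rfl⟩ := Submodule.mem_sup.mp hx
    rw [map_add, LinearMap.add_apply, h.ortho l hl y hy,
      hκ.eq_zero_comm (hSo hs y (Submodule.mem_sup_right hy)), add_zero]

/-- An isometry maps an invariant subspace onto itself. -/
lemma exists_mem_apply_eq (hκ : IsKrein κ) (hA : ∀ x y, κ (A x) (A y) = κ x y)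
    {U : Submodule ℂ E} (hU : ∀ x ∈ U, A x ∈ U) {u : E} (hu : u ∈ U) : ∃ v ∈ U, A v = u := by
  have hinj : Function.Injective A := by
    rw [← LinearMap.ker_eq_bot, LinearMap.ker_eq_bot']
    intro x hx
    apply hκ.nondeg
    intro y
    rw [← hA, hx, map_zero, LinearMap.zero_apply]
  have hinj' : Function.Injective (A.restrict hU) := fun x y h =>
    Subtype.ext (hinj (congrArg Subtype.val h))
  obtain ⟨v, hv⟩ := LinearMap.surjective_of_injective hinj' ⟨u, hu⟩
  exact ⟨v, v.2, congrArg Subtype.val hv⟩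

lemma orthogonal_mapsTo (hκ : IsKrein κ) (hA : ∀ x y, κ (A x) (A y) = κ x y)
    {U : Submodule ℂ E} (hU : ∀ x ∈ U, A x ∈ U) {x : E} (hx : x ∈ U.orthogonalBilin κ) :
    A x ∈ U.orthogonalBilin κ := by
  intro u hu
  obtain ⟨v, hv, rfl⟩ := exists_mem_apply_eq hκ hA hU hu
  show κ (A v) (A x) = 0
  rw [hA]
  exact hx v hv

/-- Outside of a smaller invariant subspace there is an eigenvector modulo that subspace. -/
lemma exists_eigenvector_mod {R U : Submodule ℂ E} (hR : ∀ x ∈ R, A x ∈ R)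
    (hRU : ¬ R ≤ U) : ∃ (ν : ℂ) (y : E), y ∈ R ∧ y ∉ U ∧ A y - ν • y ∈ U := by
  obtain ⟨ν, hν⟩ : ∃ ν : ℂ, ¬ R ⊓ A.maxGenEigenspace ν ≤ U := by
    by_contra! hall
    apply hRU
    rw [Submodule.eq_iSup_inf_genEigenspace ⊤ hR A.iSup_maxGenEigenspace_eq_top]
    exact iSup_le hall
  obtain ⟨x, ⟨hxR, hxE⟩, hxU⟩ := Set.not_subset.mp hν
  obtain ⟨k, hk⟩ := (End.mem_maxGenEigenspace _ _ _).mp hxE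
  classical
  -- The last iterate of x under A - ν that is still outside U is the required vector.
  have hex : ∃ k : ℕ, ((A - ν • (1 : End ℂ E)) ^ k) x ∈ U := ⟨k, by rw [hk]; exact U.zero_mem⟩
  have hmem : ∀ k : ℕ, ((A - ν • (1 : End ℂ E)) ^ k) x ∈ R := by
    intro k
    induction k with
    | zero => simpa using hxR
    | succ k ih =>
      rw [pow_succ', End.mul_apply, LinearMap.sub_apply]
      exact R.sub_mem (hR _ ih) (R.smul_mem _ ih)
  obtain ⟨j, hj⟩ : ∃ j, Nat.find hex = j + 1 := by
    refine Nat.exists_eq_succ_of_ne_zero fun h0 => hxU ?_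
    have := Nat.find_spec hex
    rw [h0] at this
    simpa using this
  refine ⟨ν, ((A - ν • (1 : End ℂ E)) ^ j) x, hmem j, Nat.find_min hex (by omega), ?_⟩
  have := Nat.find_spec hex
  rw [hj, pow_succ', End.mul_apply] at this
  exact this

/-- To adjoin y to L invariantly, A y - ν y must be adjoined as well. It lies in the intersection of
L ⊔ N with its orthogonal, a totally isotropic invariant subspace that can be added at no cost to
the sign of the form. -/
lemma IsInvariantPair.exists_larger (hκ : IsKrein κ) (hA : ∀ x y, κ (A x) (A y) = κ x y)
    (h : IsInvariantPair κ A L N) {ν : ℂ} {y : E} (hy : y ∈ (L ⊔ N).orthogonalBilin κ)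
    (hyU : y ∉ L ⊔ N) (hAy : A y - ν • y ∈ L ⊔ N) (hy0 : 0 ≤ (κ y y).re) :
    ∃ L', IsInvariantPair κ A L' N ∧ finrank ℂ L < finrank ℂ L' := by
  have hU : ∀ x ∈ L ⊔ N, A x ∈ L ⊔ N := by
    intro x hx
    obtain ⟨l, hl, s, hs, rfl⟩ := Submodule.mem_sup.mp hx
    rw [map_add]
    exact Submodule.add_mem_sup (h.mapsTo_left l hl) (h.mapsTo_right s hs)
  set R := (L ⊔ N).orthogonalBilin κ with hR
  have hRm : ∀ x ∈ R, A x ∈ R := fun x hx => orthogonal_mapsTo hκ hA hU hx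
  set S := (R ⊓ (L ⊔ N)) ⊔ Submodule.span ℂ {y} with hS
  have hSR : S ≤ R := sup_le inf_le_left ((Submodule.span_singleton_le_iff_mem _ _).mpr hy)
  have hyS : y ∈ S := Submodule.mem_sup_right (Submodule.mem_span_singleton_self y)
  refine ⟨L ⊔ S, h.sup_left hκ ?_ ?_ hSR, ?_⟩
  · intro x hx
    obtain ⟨q, hq, z, hz, rfl⟩ := Submodule.mem_sup.mp hx
    obtain ⟨c, rfl⟩ := Submodule.mem_span_singleton.mp hz
    rw [map_add, map_smul]
    refine S.add_mem (Submodule.mem_sup_left ⟨hRm q hq.1, hU q hq.2⟩) (S.smul_mem c ?_)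
    rw [← sub_add_cancel (A y) (ν • y)]
    exact S.add_mem (Submodule.mem_sup_left ⟨R.sub_mem (hRm y hy) (R.smul_mem ν hy), hAy⟩)
      (S.smul_mem ν hyS)
  · intro x hx
    obtain ⟨q, hq, z, hz, rfl⟩ := Submodule.mem_sup.mp hx
    obtain ⟨c, rfl⟩ := Submodule.mem_span_singleton.mp hz
    have h1 : κ q (c • y) = 0 := by
      rw [map_smul, show κ q y = 0 from hy q hq.2, smul_zero]
    have h2 : κ q q = 0 := hq.1 q hq.2
    have h3 : κ (c • y) (c • y) = (normSq c : ℂ) * κ y y := by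
      rw [normSq_eq_conj_mul_self]
      simp only [map_smulₛₗ, LinearMap.smul_apply, smul_eq_mul, RingHom.id_apply]
      ring
    rw [form_add_of_ortho hκ h1, h2, zero_add, h3, re_ofReal_mul]
    exact mul_nonneg (normSq_nonneg _) hy0
  · refine Submodule.finrank_lt_finrank_of_lt (lt_of_le_of_ne le_sup_left fun heq => hyU ?_)
    refine Submodule.mem_sup_left ?_
    rw [heq]
    exact Submodule.mem_sup_right hyS

/-- An isometry has an invariant pair of complementary dimensions. -/
theorem exists_isInvariantPair (hκ : IsKrein κ) (hA : ∀ x y, κ (A x) (A y) = κ x y) :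
    ∃ L N : Submodule ℂ E, IsInvariantPair κ A L N ∧
      finrank ℂ E ≤ finrank ℂ L + finrank ℂ N := by
  set D : Set ℕ := {m | ∃ L N : Submodule ℂ E, IsInvariantPair κ A L N ∧
    finrank ℂ L + finrank ℂ N = m} with hD
  have hne : D.Nonempty := ⟨_, ⊥, ⊥, ⟨by simp, by simp, by simp, by simp, by simp⟩, rfl⟩
  have hbdd : BddAbove D := by
    refine ⟨finrank ℂ E + finrank ℂ E, ?_⟩
    rintro m ⟨L, N, -, rfl⟩
    exact add_le_add (Submodule.finrank_le _) (Submodule.finrank_le _)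
  -- A pair with dim L + dim N maximal.
  obtain ⟨L, N, h, hm⟩ := Nat.sSup_mem hne hbdd
  have hmax : ∀ L' N', IsInvariantPair κ A L' N' →
      finrank ℂ L' + finrank ℂ N' ≤ finrank ℂ L + finrank ℂ N := fun L' N' h' => by
    rw [hm]
    exact le_csSup hbdd ⟨L', N', h', rfl⟩
  have hU : ∀ x ∈ L ⊔ N, A x ∈ L ⊔ N := by
    intro x hx
    obtain ⟨l, hl, s, hs, rfl⟩ := Submodule.mem_sup.mp hx
    rw [map_add]
    exact Submodule.add_mem_sup (h.mapsTo_left l hl) (h.mapsTo_right s hs)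
  set R := (L ⊔ N).orthogonalBilin κ with hR
  have hRm : ∀ x ∈ R, A x ∈ R := fun x hx => orthogonal_mapsTo hκ hA hU hx
  have hneg : (N ⊔ L).orthogonalBilin (-κ) = R := by
    ext x
    rw [sup_comm, hR]
    simp
  -- Otherwise an eigenvector of A on R modulo L ⊔ N enlarges L or N, according to the sign of its
  -- form value.
  have hRU : R ≤ L ⊔ N := by
    by_contra hcon
    obtain ⟨ν, y, hyR, hyU, hAy⟩ := exists_eigenvector_mod hRm hcon
    rcases le_total 0 (κ y y).re with h0 | h0
    · obtain ⟨L', h1, h2⟩ := h.exists_larger hκ hA hyR hyU hAy h0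
      have := hmax L' N h1
      omega
    · obtain ⟨N', h1, h2⟩ := (h.swap hκ).exists_larger hκ.neg (fun x y => by simp [hA])
        (by rw [hneg]; exact hyR) (by rwa [sup_comm]) (by rwa [sup_comm]) (by simpa using h0)
      have h3 := h1.swap hκ.neg
      rw [neg_neg] at h3
      have := hmax L N' h3
      omega
  -- R is now isotropic, so by maximality both L and N absorb it. Then dim L + dim N ≥ dim (L ⊔ N) +
  -- dim R = dim E.
  have hR0 : ∀ x ∈ R, κ x x = 0 := fun x hx => hx x (hRU hx)
  have hRL : R ≤ L := by
    have h1 := hmax _ _ (h.sup_left hκ hRm (fun x hx => by rw [hR0 x hx]; simp) le_rfl)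
    have := Submodule.eq_of_le_of_finrank_le (le_sup_left : L ≤ L ⊔ R) (by omega)
    rw [this]
    exact le_sup_right
  have hRN : R ≤ N := by
    have h1 := ((h.swap hκ).sup_left hκ.neg hRm (fun x hx => by simp [hR0 x hx])
      (by rw [hneg])).swap hκ.neg
    rw [neg_neg] at h1
    have h2 := hmax _ _ h1
    have := Submodule.eq_of_le_of_finrank_le (le_sup_left : N ≤ N ⊔ R) (by omega)
    rw [this]
    exact le_sup_right
  refine ⟨L, N, h, ?_⟩
  have h1 := Submodule.finrank_sup_add_finrank_inf_eq L N
  have h2 := Submodule.finrank_mono (le_inf hRL hRN)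
  have h3 := finrank_orthogonal_add hκ (L ⊔ N)
  rw [← hR] at h3
  omega

omit [FiniteDimensional ℂ E] in
-- Induction on the sum of the nilpotency exponents: once x or y is replaced by its image under A -
-- μ or A - ν the pairing vanishes, and expanding κ(Ax, Ay) = κ(x, y) leaves (1 - μ̄ν) κ(x, y) = 0.
lemma form_eq_zero_of_mem_maxGenEigenspace (hA : ∀ x y, κ (A x) (A y) = κ x y) {μ ν : ℂ}
    (hμν : starRingEnd ℂ μ * ν ≠ 1) {x y : E} (hx : x ∈ A.maxGenEigenspace μ)
    (hy : y ∈ A.maxGenEigenspace ν) : κ x y = 0 := by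
  obtain ⟨j, hj⟩ := (End.mem_maxGenEigenspace _ _ _).mp hx
  obtain ⟨k, hk⟩ := (End.mem_maxGenEigenspace _ _ _).mp hy
  clear hx hy
  induction hm : j + k using Nat.strong_induction_on generalizing j k x y with
  | _ m ih =>
    rcases j with _ | j
    · simp only [pow_zero, End.one_apply] at hj
      simp [hj]
    rcases k with _ | k
    · simp only [pow_zero, End.one_apply] at hk
      simp [hk]
    rw [pow_succ, End.mul_apply] at hj hk
    have h1 := ih (j + (k + 1)) (by omega) j hj (k + 1) (y := y)
      (by rwa [pow_succ, End.mul_apply]) rfl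
    have h2 := ih (j + 1 + k) (by omega) (j + 1) (x := x)
      (by rwa [pow_succ, End.mul_apply]) k hk rfl
    have h3 := ih (j + k) (by omega) j hj k hk rfl
    have h4 := hA x y
    simp only [LinearMap.sub_apply, LinearMap.smul_apply, End.one_apply, map_sub, map_smulₛₗ,
      smul_eq_mul, RingHom.id_apply] at h1 h2 h3
    have h5 : (1 - starRingEnd ℂ μ * ν) * κ x y = 0 := by
      linear_combination h3 + starRingEnd ℂ μ * h2 + ν * h1 - h4
    exact (mul_eq_zero.mp h5).resolve_left (sub_ne_zero.mpr hμν.symm)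

end Krein

end SalamonZehnder

/-! ### Multiplicities of eigenvalues on invariant semidefinite subspaces. -/

namespace SalamonZehnder

open Module Complex

section Multiplicity

variable {E : Type*} [AddCommGroup E] [Module ℂ E] {κ : E →ₗ⋆[ℂ] E →ₗ[ℂ] ℂ} {A : End ℂ E}

/-- The positive index of a Hermitian form on a generalized eigenspace. -/
noncomputable def posIdx (κ : E →ₗ⋆[ℂ] E →ₗ[ℂ] ℂ) (A : End ℂ E) (μ : ℂ) : ℕ :=
  sSup {d : ℕ | ∃ W : Submodule ℂ E, W ≤ A.maxGenEigenspace μ ∧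
    (∀ z ∈ W, z ≠ 0 → 0 < (κ z z).re) ∧ finrank ℂ W = d}

variable [FiniteDimensional ℂ E]

omit [FiniteDimensional ℂ E] in
lemma finrank_restrict_maxGenEigenspace {U : Submodule ℂ E} (hU : ∀ x ∈ U, A x ∈ U) (μ : ℂ) :
    finrank ℂ (End.maxGenEigenspace (A.restrict hU) μ)
      = finrank ℂ (U ⊓ A.maxGenEigenspace μ : Submodule ℂ E) := by
  have h := Submodule.inf_genEigenspace A U (k := ⊤) (μ := μ) hU
  rw [show U ⊓ A.maxGenEigenspace μ = _ from h, Submodule.finrank_map_subtype_eq]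

lemma count_roots_restrict {U : Submodule ℂ E} (hU : ∀ x ∈ U, A x ∈ U) (μ : ℂ) :
    (A.restrict hU).charpoly.roots.count μ
      = finrank ℂ (U ⊓ A.maxGenEigenspace μ : Submodule ℂ E) := by
  rw [Polynomial.count_roots, ← LinearMap.finrank_maxGenEigenspace_eq,
    finrank_restrict_maxGenEigenspace]

lemma count_roots_eq (A : End ℂ E) (μ : ℂ) :
    A.charpoly.roots.count μ = finrank ℂ (A.maxGenEigenspace μ) := by
  rw [Polynomial.count_roots, LinearMap.finrank_maxGenEigenspace_eq]

lemma mem_roots_iff (A : End ℂ E) (μ : ℂ) :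
    μ ∈ A.charpoly.roots.toFinset ↔ 0 < finrank ℂ (A.maxGenEigenspace μ) := by
  rw [Multiset.mem_toFinset, ← Multiset.count_pos, count_roots_eq]

lemma roots_restrict_subset {U : Submodule ℂ E} (hU : ∀ x ∈ U, A x ∈ U) :
    (A.restrict hU).charpoly.roots.toFinset ⊆ A.charpoly.roots.toFinset := by
  intro μ hμ
  rw [mem_roots_iff, finrank_restrict_maxGenEigenspace] at hμ
  rw [mem_roots_iff]
  exact hμ.trans_le (Submodule.finrank_mono inf_le_right)

lemma det_restrict_eq {U : Submodule ℂ E} (hU : ∀ x ∈ U, A x ∈ U) :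
    LinearMap.det (A.restrict hU) = ∏ μ ∈ A.charpoly.roots.toFinset,
      μ ^ finrank ℂ (U ⊓ A.maxGenEigenspace μ : Submodule ℂ E) := by
  rw [End.det_eq_prod_roots_charpoly_of_splits (IsAlgClosed.splits _),
    Finset.prod_multiset_count_of_subset _ _ (roots_restrict_subset hU)]
  exact Finset.prod_congr rfl fun μ _ => by rw [count_roots_restrict]

lemma sum_finrank_inf {U : Submodule ℂ E} (hU : ∀ x ∈ U, A x ∈ U) :
    ∑ μ ∈ A.charpoly.roots.toFinset, finrank ℂ (U ⊓ A.maxGenEigenspace μ : Submodule ℂ E)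
      = finrank ℂ U := by
  rw [← LinearMap.charpoly_natDegree (A.restrict hU),
    (IsAlgClosed.splits (A.restrict hU).charpoly).natDegree_eq_card_roots,
    ← Multiset.toFinset_sum_count_eq]
  symm
  rw [Finset.sum_congr rfl fun μ _ => count_roots_restrict hU μ]
  refine Finset.sum_subset (roots_restrict_subset hU) fun μ _ hμ => ?_
  rw [← count_roots_restrict hU, Multiset.count_eq_zero]
  simpa using hμ

lemma sum_finrank_maxGenEigenspace (A : End ℂ E) :
    ∑ μ ∈ A.charpoly.roots.toFinset, finrank ℂ (A.maxGenEigenspace μ) = finrank ℂ E := by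
  rw [← LinearMap.charpoly_natDegree A,
    (IsAlgClosed.splits A.charpoly).natDegree_eq_card_roots, ← Multiset.toFinset_sum_count_eq]
  exact Finset.sum_congr rfl fun μ _ => (count_roots_eq A μ).symm

variable (hκ : IsKrein κ) (hA : ∀ x y, κ (A x) (A y) = κ x y)
include hκ hA

lemma finrank_maxGenEigenspace_zero : finrank ℂ (A.maxGenEigenspace 0) = 0 := by
  have h : A.maxGenEigenspace 0 = ⊥ := by
    rw [eq_bot_iff]
    intro x hx
    refine hκ.nondeg x fun y => ?_
    have hy : y ∈ ⨆ ν, A.maxGenEigenspace ν := by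
      rw [A.iSup_maxGenEigenspace_eq_top]; trivial
    refine Submodule.iSup_induction _ (motive := fun y => κ x y = 0) hy
      (fun ν z hz => form_eq_zero_of_mem_maxGenEigenspace hA (by simp) hx hz) (map_zero _)
      (fun z w hz hw => by rw [map_add, hz, hw, add_zero])
  rw [h, finrank_bot]

/-- The generalized eigenspace of μ pairs only with that of 1/μ̄, so the orthogonal of X contains
every other one and is transverse to this one. -/
lemma finrank_orthogonal_inf_maxGenEigenspace {X : Submodule ℂ E} {μ : ℂ}
    (hX : X ≤ A.maxGenEigenspace μ) :
    finrank ℂ (X.orthogonalBilin κ ⊓ A.maxGenEigenspace (starRingEnd ℂ μ)⁻¹ : Submodule ℂ E)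
      + finrank ℂ X = finrank ℂ (A.maxGenEigenspace (starRingEnd ℂ μ)⁻¹) := by
  have hsup : X.orthogonalBilin κ ⊔ A.maxGenEigenspace (starRingEnd ℂ μ)⁻¹ = ⊤ := by
    rw [eq_top_iff, ← A.iSup_maxGenEigenspace_eq_top]
    refine iSup_le fun ν => ?_
    by_cases hν : starRingEnd ℂ μ * ν = 1
    · rw [eq_inv_of_mul_eq_one_right hν]
      exact le_sup_right
    · refine le_trans ?_ le_sup_left
      intro y hy x hx
      exact form_eq_zero_of_mem_maxGenEigenspace hA hν (hX hx) hy
  have h1 := Submodule.finrank_sup_add_finrank_inf_eq (X.orthogonalBilin κ)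
    (A.maxGenEigenspace (starRingEnd ℂ μ)⁻¹)
  rw [hsup, finrank_top] at h1
  have h2 := finrank_orthogonal_add hκ X
  omega

lemma orthogonal_inf_maxGenEigenspace (μ : ℂ) :
    (A.maxGenEigenspace μ).orthogonalBilin κ ⊓ A.maxGenEigenspace (starRingEnd ℂ μ)⁻¹ = ⊥ := by
  rw [eq_bot_iff]
  rintro y ⟨hy1, hy2⟩
  refine hκ.nondeg y fun x => hκ.eq_zero_comm ?_
  have hx : x ∈ ⨆ ν, A.maxGenEigenspace ν := by
    rw [A.iSup_maxGenEigenspace_eq_top]; trivial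
  refine Submodule.iSup_induction _ (motive := fun x => κ x y = 0) hx ?_ (by simp)
    (fun z w hz hw => by rw [map_add, LinearMap.add_apply, hz, hw, add_zero])
  intro ν z hz
  by_cases hν : ν = μ
  · subst hν
    exact hy1 z hz
  · refine form_eq_zero_of_mem_maxGenEigenspace hA (fun h => hν ?_) hz hy2
    have h0 : starRingEnd ℂ μ ≠ 0 := fun h0 => by simp [h0] at h
    rw [mul_inv_eq_one₀ h0] at h
    exact RingHom.injective _ h

lemma finrank_maxGenEigenspace_conj_inv (μ : ℂ) :
    finrank ℂ (A.maxGenEigenspace (starRingEnd ℂ μ)⁻¹) = finrank ℂ (A.maxGenEigenspace μ) := by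
  have := finrank_orthogonal_inf_maxGenEigenspace hκ hA (le_refl (A.maxGenEigenspace μ))
  rw [orthogonal_inf_maxGenEigenspace hκ hA, finrank_bot] at this
  omega

/-- Off the unit circle the generalized eigenspace is isotropic, so its part in L is orthogonal to
all of the semidefinite L, in particular to the part of L at 1/μ̄. -/
lemma finrank_inf_add_conj_inv_le {L : Submodule ℂ E} (hL : ∀ x ∈ L, 0 ≤ (κ x x).re) {μ : ℂ}
    (hμ : ‖μ‖ ≠ 1) :
    finrank ℂ (L ⊓ A.maxGenEigenspace μ : Submodule ℂ E)
      + finrank ℂ (L ⊓ A.maxGenEigenspace (starRingEnd ℂ μ)⁻¹ : Submodule ℂ E)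
      ≤ finrank ℂ (A.maxGenEigenspace μ) := by
  have h1 := finrank_orthogonal_inf_maxGenEigenspace hκ hA
    (inf_le_right : L ⊓ A.maxGenEigenspace μ ≤ A.maxGenEigenspace μ)
  rw [finrank_maxGenEigenspace_conj_inv hκ hA μ] at h1
  have h2 : L ⊓ A.maxGenEigenspace (starRingEnd ℂ μ)⁻¹
      ≤ (L ⊓ A.maxGenEigenspace μ).orthogonalBilin κ ⊓ A.maxGenEigenspace (starRingEnd ℂ μ)⁻¹ := by
    rintro y ⟨hy1, hy2⟩
    refine ⟨?_, hy2⟩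
    rintro x ⟨hx1, hx2⟩
    refine eq_zero_of_isotropic hκ hL hx1 hy1 ?_
    rw [form_eq_zero_of_mem_maxGenEigenspace hA _ hx2 hx2, zero_re]
    rw [← normSq_eq_conj_mul_self, normSq_eq_norm_sq]
    intro h
    apply hμ
    have h' : ‖μ‖ ^ 2 = 1 := by exact_mod_cast h
    nlinarith [norm_nonneg μ]
  have := Submodule.finrank_mono h2
  omega

omit hκ hA in
lemma bddAbove_posIdx (κ : E →ₗ⋆[ℂ] E →ₗ[ℂ] ℂ) (A : End ℂ E) (μ : ℂ) :
    BddAbove {d : ℕ | ∃ W : Submodule ℂ E, W ≤ A.maxGenEigenspace μ ∧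
      (∀ z ∈ W, z ≠ 0 → 0 < (κ z z).re) ∧ finrank ℂ W = d} := by
  refine ⟨finrank ℂ E, ?_⟩
  rintro d ⟨W, -, -, rfl⟩
  exact Submodule.finrank_le _

omit hκ hA in
lemma le_posIdx {W : Submodule ℂ E} {μ : ℂ} (hW : W ≤ A.maxGenEigenspace μ)
    (hpos : ∀ z ∈ W, z ≠ 0 → 0 < (κ z z).re) : finrank ℂ W ≤ posIdx κ A μ :=
  le_csSup (bddAbove_posIdx κ A μ) ⟨W, hW, hpos, rfl⟩

omit hκ hA in
lemma exists_posIdx (κ : E →ₗ⋆[ℂ] E →ₗ[ℂ] ℂ) (A : End ℂ E) (μ : ℂ) :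
    ∃ W : Submodule ℂ E, W ≤ A.maxGenEigenspace μ ∧
      (∀ z ∈ W, z ≠ 0 → 0 < (κ z z).re) ∧ finrank ℂ W = posIdx κ A μ :=
  Nat.sSup_mem (s := {d : ℕ | ∃ W : Submodule ℂ E, W ≤ A.maxGenEigenspace μ ∧
      (∀ z ∈ W, z ≠ 0 → 0 < (κ z z).re) ∧ finrank ℂ W = d})
    ⟨0, ⊥, bot_le, fun _ hz h0 => absurd ((Submodule.mem_bot ℂ).mp hz) h0, finrank_bot ℂ E⟩
    (bddAbove_posIdx κ A μ)

omit hκ hA in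
lemma finrank_add_le_of_disjoint {U W F : Submodule ℂ E} (hU : U ≤ F) (hW : W ≤ F)
    (h : ∀ x ∈ U, x ∈ W → x = 0) : finrank ℂ U + finrank ℂ W ≤ finrank ℂ F := by
  have h1 := Submodule.finrank_sup_add_finrank_inf_eq U W
  have h2 : U ⊓ W = ⊥ := by
    rw [eq_bot_iff]
    rintro x ⟨hx1, hx2⟩
    exact h x hx1 hx2
  rw [h2, finrank_bot, add_zero] at h1
  rw [← h1]
  exact Submodule.finrank_mono (sup_le hU hW)

/-- On the generalized eigenspace of an eigenvalue on the unit circle the form has a negative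
definite subspace complementary to the maximal positive ones. -/
lemma exists_negative_complement {μ : ℂ} (hμ : ‖μ‖ = 1) :
    ∃ Q : Submodule ℂ E, Q ≤ A.maxGenEigenspace μ ∧ (∀ z ∈ Q, z ≠ 0 → (κ z z).re < 0) ∧
      finrank ℂ Q + posIdx κ A μ = finrank ℂ (A.maxGenEigenspace μ) := by
  have hstar : (starRingEnd ℂ μ)⁻¹ = μ := by
    rw [← inv_eq_conj hμ, inv_inv]
  obtain ⟨P, hP, hpos, hPr⟩ := exists_posIdx κ A μ
  set F := A.maxGenEigenspace μ with hF
  have hfr := finrank_orthogonal_inf_maxGenEigenspace hκ hA hP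
  have hbot := orthogonal_inf_maxGenEigenspace hκ hA μ
  rw [hstar, ← hF] at hfr hbot
  set Q := P.orthogonalBilin κ ⊓ F with hQ
  -- A positive vector orthogonal to P would enlarge the maximal positive subspace P.
  have hnonpos : ∀ x ∈ Q, (κ x x).re ≤ 0 := by
    intro x hx
    by_contra! hxx
    have hdisj : ∀ y ∈ P, y ∈ Submodule.span ℂ {x} → y = 0 := by
      intro y hy hyx
      obtain ⟨c, rfl⟩ := Submodule.mem_span_singleton.mp hyx
      by_contra hne
      have h1 := hpos _ hy hne
      rw [map_smul, show κ (c • x) x = 0 from hx.1 _ hy, smul_zero, zero_re] at h1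
      exact lt_irrefl _ h1
    have h2 := finrank_add_le_of_disjoint (le_sup_left : P ≤ P ⊔ Submodule.span ℂ {x})
      le_sup_right hdisj
    have hx0 : x ≠ 0 := by
      rintro rfl
      simp at hxx
    rw [finrank_span_singleton hx0] at h2
    have h3 : finrank ℂ (P ⊔ Submodule.span ℂ {x} : Submodule ℂ E) ≤ posIdx κ A μ := by
      refine le_posIdx (sup_le hP ((Submodule.span_singleton_le_iff_mem _ _).mpr hx.2)) ?_
      intro z hz hz0
      obtain ⟨p, hp, w, hw, rfl⟩ := Submodule.mem_sup.mp hz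
      obtain ⟨c, rfl⟩ := Submodule.mem_span_singleton.mp hw
      have h4 : κ p (c • x) = 0 := by
        rw [map_smul, show κ p x = 0 from hx.1 p hp, smul_zero]
      have h5 : κ (c • x) (c • x) = (normSq c : ℂ) * κ x x := by
        rw [normSq_eq_conj_mul_self]
        simp only [map_smulₛₗ, LinearMap.smul_apply, smul_eq_mul, RingHom.id_apply]
        ring
      rw [form_add_of_ortho hκ h4, h5, add_re, re_ofReal_mul]
      rcases eq_or_ne p 0 with rfl | hp0
      · have hc : c ≠ 0 := by
          rintro rfl
          simp at hz0
        have := mul_pos (normSq_pos.mpr hc) hxx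
        simpa using this
      · exact add_pos_of_pos_of_nonneg (hpos p hp hp0) (mul_nonneg (normSq_nonneg _) hxx.le)
    omega
  have hPQ : P ⊔ Q = F := by
    have hd : P ⊓ Q = ⊥ := by
      rw [eq_bot_iff]
      rintro x ⟨hx1, hx2⟩
      by_contra hne
      have h1 := hpos x hx1 hne
      rw [show κ x x = 0 from hx2.1 x hx1, zero_re] at h1
      exact lt_irrefl _ h1
    refine Submodule.eq_of_le_of_finrank_le (sup_le hP inf_le_right) ?_
    have h1 := Submodule.finrank_sup_add_finrank_inf_eq P Q
    rw [hd, finrank_bot] at h1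
    omega
  refine ⟨Q, inf_le_right, fun x hx hx0 => lt_of_le_of_ne (hnonpos x hx) fun h0 => hx0 ?_, ?_⟩
  -- An isotropic vector of the semidefinite Q is orthogonal to Q, and to P by construction, hence
  -- to F = P ⊔ Q, where the form is nondegenerate.
  · have hmem : x ∈ F.orthogonalBilin κ ⊓ F := by
      refine ⟨?_, hx.2⟩
      rw [← hPQ]
      intro y hy
      obtain ⟨p, hp, q, hq, rfl⟩ := Submodule.mem_sup.mp hy
      have h1 := eq_zero_of_isotropic hκ.neg (U := Q) (fun z hz => by simpa using hnonpos z hz)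
        hx hq (by simpa using h0)
      have h2 : κ p x = 0 := hx.1 p hp
      have h3 : κ q x = 0 := hκ.eq_zero_comm (by simpa using h1)
      show κ (p + q) x = 0
      rw [map_add, LinearMap.add_apply, h2, h3, add_zero]
    rw [hbot] at hmem
    exact hmem
  · omega

lemma finrank_inf_le_posIdx {L : Submodule ℂ E} (hL : ∀ x ∈ L, 0 ≤ (κ x x).re) {μ : ℂ}
    (hμ : ‖μ‖ = 1) :
    finrank ℂ (L ⊓ A.maxGenEigenspace μ : Submodule ℂ E) ≤ posIdx κ A μ := by
  obtain ⟨Q, hQ, hneg, hfr⟩ := exists_negative_complement hκ hA hμ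
  have := finrank_add_le_of_disjoint (inf_le_right : L ⊓ A.maxGenEigenspace μ ≤ _) hQ
    (fun x hx hxQ => by
      by_contra hne
      exact absurd (hL x hx.1) (not_le.mpr (hneg x hxQ hne)))
  omega

omit hκ hA in
lemma posIdx_add_finrank_inf_le {N : Submodule ℂ E} (hN : ∀ x ∈ N, (κ x x).re ≤ 0) (μ : ℂ) :
    posIdx κ A μ + finrank ℂ (N ⊓ A.maxGenEigenspace μ : Submodule ℂ E)
      ≤ finrank ℂ (A.maxGenEigenspace μ) := by
  obtain ⟨P, hP, hpos, hfr⟩ := exists_posIdx κ A μ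
  rw [← hfr]
  refine finrank_add_le_of_disjoint hP inf_le_right fun x hx hxN => ?_
  by_contra hne
  exact absurd (hN x hxN.1) (not_le.mpr (hpos x hx hne))

omit [FiniteDimensional ℂ E] hκ hA in
lemma conj_inv_conj_inv (μ : ℂ) : (starRingEnd ℂ (starRingEnd ℂ μ)⁻¹)⁻¹ = μ := by
  rw [map_inv₀, conj_conj, inv_inv]

lemma sum_conj_inv (g : ℂ → ℕ) :
    ∑ μ ∈ A.charpoly.roots.toFinset, g (starRingEnd ℂ μ)⁻¹
      = ∑ μ ∈ A.charpoly.roots.toFinset, g μ := by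
  refine Finset.sum_bij' (fun μ _ => (starRingEnd ℂ μ)⁻¹) (fun μ _ => (starRingEnd ℂ μ)⁻¹)
    ?_ ?_ (fun μ _ => conj_inv_conj_inv μ) (fun μ _ => conj_inv_conj_inv μ) (fun _ _ => rfl)
  all_goals
    intro μ hμ
    rw [mem_roots_iff] at hμ ⊢
    rwa [finrank_maxGenEigenspace_conj_inv hκ hA]

/-- The multiplicities of the eigenvalues in an invariant pair of complementary dimensions. -/
lemma finrank_inf_of_isInvariantPair {L N : Submodule ℂ E} (h : IsInvariantPair κ A L N)
    (hLN : finrank ℂ E ≤ finrank ℂ L + finrank ℂ N) {μ : ℂ}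
    (hμ : μ ∈ A.charpoly.roots.toFinset) :
    (‖μ‖ = 1 → finrank ℂ (L ⊓ A.maxGenEigenspace μ : Submodule ℂ E) = posIdx κ A μ) ∧
    (‖μ‖ ≠ 1 → finrank ℂ (L ⊓ A.maxGenEigenspace μ : Submodule ℂ E)
      + finrank ℂ (L ⊓ A.maxGenEigenspace (starRingEnd ℂ μ)⁻¹ : Submodule ℂ E)
      = finrank ℂ (A.maxGenEigenspace μ)) := by
  set l : ℂ → ℕ := fun μ => finrank ℂ (L ⊓ A.maxGenEigenspace μ : Submodule ℂ E) with hl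
  set k : ℂ → ℕ := fun μ => finrank ℂ (N ⊓ A.maxGenEigenspace μ : Submodule ℂ E) with hk
  set m : ℂ → ℕ := fun μ => finrank ℂ (A.maxGenEigenspace μ) with hm
  have hstar : ∀ ν : ℂ, ‖ν‖ = 1 → (starRingEnd ℂ ν)⁻¹ = ν := fun ν hν => by
    rw [← inv_eq_conj hν, inv_inv]
  have hc1 : ∀ ν : ℂ, ‖ν‖ = 1 → l ν ≤ posIdx κ A ν := fun ν hν =>
    finrank_inf_le_posIdx hκ hA h.nonneg hν
  have hc2 : ∀ ν : ℂ, posIdx κ A ν + k ν ≤ m ν := posIdx_add_finrank_inf_le h.nonpos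
  have ho1 : ∀ ν : ℂ, ‖ν‖ ≠ 1 → l ν + l (starRingEnd ℂ ν)⁻¹ ≤ m ν := fun ν hν =>
    finrank_inf_add_conj_inv_le hκ hA h.nonneg hν
  have ho2 : ∀ ν : ℂ, ‖ν‖ ≠ 1 → k ν + k (starRingEnd ℂ ν)⁻¹ ≤ m ν := fun ν hν =>
    finrank_inf_add_conj_inv_le hκ.neg (fun x y => by simp [hA])
      (fun x hx => by simpa using h.nonpos x hx) hν
  have hle : ∀ ν ∈ A.charpoly.roots.toFinset,
      (l ν + l (starRingEnd ℂ ν)⁻¹) + (k ν + k (starRingEnd ℂ ν)⁻¹) ≤ 2 * m ν := by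
    intro ν _
    by_cases hν : ‖ν‖ = 1
    · rw [hstar ν hν]
      have := hc1 ν hν
      have := hc2 ν
      omega
    · have := ho1 ν hν
      have := ho2 ν hν
      omega
  -- Summed over the spectrum the left sides give 2 (dim L + dim N) and the right sides 2 dim E, so
  -- every local inequality is an equality.
  have hsum : ∑ ν ∈ A.charpoly.roots.toFinset,
      ((l ν + l (starRingEnd ℂ ν)⁻¹) + (k ν + k (starRingEnd ℂ ν)⁻¹))
      = ∑ ν ∈ A.charpoly.roots.toFinset, 2 * m ν := by
    refine le_antisymm (Finset.sum_le_sum hle) ?_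
    rw [Finset.sum_add_distrib, Finset.sum_add_distrib, Finset.sum_add_distrib,
      sum_conj_inv hκ hA l, sum_conj_inv hκ hA k, ← Finset.mul_sum, hl, hk, hm,
      sum_finrank_inf h.mapsTo_left, sum_finrank_inf h.mapsTo_right,
      sum_finrank_maxGenEigenspace]
    omega
  have heq := (Finset.sum_eq_sum_iff_of_le hle).mp hsum μ hμ
  refine ⟨fun hν => ?_, fun hν => ?_⟩
  · rw [hstar μ hν] at heq
    have := hc1 μ hν
    have := hc2 μ
    show l μ = posIdx κ A μ
    omega
  · have := ho1 μ hν
    have := ho2 μ hν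
    show l μ + l (starRingEnd ℂ μ)⁻¹ = m μ
    omega

omit [FiniteDimensional ℂ E] hκ hA in
lemma finrank_map_semilinear (c : E →ₗ⋆[ℂ] E) (hc : ∀ x, c (c x) = x) (U : Submodule ℂ E) :
    finrank ℂ (U.map c) = finrank ℂ U := by
  have hinj : Function.Injective c := fun x y h => by rw [← hc x, h, hc]
  let j : U →+ U.map c :=
    { toFun := fun x => ⟨c x, Submodule.mem_map_of_mem x.2⟩
      map_zero' := by ext; simp
      map_add' := fun x y => by ext; simp }
  have hj : Function.Bijective j := by
    refine ⟨fun x y h => Subtype.ext (hinj (congrArg Subtype.val h)), ?_⟩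
    rintro ⟨_, x, hx, rfl⟩
    exact ⟨⟨x, hx⟩, rfl⟩
  have := rank_eq_of_equiv_equiv (starRingEnd ℂ) (AddEquiv.ofBijective j hj)
    (starRingAut (R := ℂ)).bijective (fun r x => Subtype.ext (by simp [j]))
  rw [finrank, finrank, this]

/-- In the presence of a real structure the form is split on the generalized eigenspaces of `±1`. -/
lemma two_mul_posIdx (c : E →ₗ⋆[ℂ] E) (hc : ∀ x, c (c x) = x)
    (hcκ : ∀ x, (κ (c x) (c x)).re = -(κ x x).re) (hcA : ∀ x, A (c x) = c (A x)) {μ : ℂ}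
    (hμ : ‖μ‖ = 1) (hμr : starRingEnd ℂ μ = μ) :
    2 * posIdx κ A μ = finrank ℂ (A.maxGenEigenspace μ) := by
  have hmap : ∀ U : Submodule ℂ E, U ≤ A.maxGenEigenspace μ →
      U.map c ≤ A.maxGenEigenspace μ := by
    rintro U hU _ ⟨x, hx, rfl⟩
    obtain ⟨k, hk⟩ := (End.mem_maxGenEigenspace _ _ _).mp (hU hx)
    refine (End.mem_maxGenEigenspace _ _ _).mpr ⟨k, ?_⟩
    have : ∀ (k : ℕ) y, ((A - μ • (1 : End ℂ E)) ^ k) (c y)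
        = c (((A - μ • (1 : End ℂ E)) ^ k) y) := by
      intro k
      induction k with
      | zero => simp
      | succ k ih =>
        intro y
        rw [pow_succ, End.mul_apply, End.mul_apply, ← ih]
        congr 1
        simp [hcA, hμr]
    rw [this, hk, map_zero]
  have hinj : ∀ x, c x = 0 → x = 0 := fun x h => by rw [← hc x, h, map_zero]
  obtain ⟨P, hP, hpos, hPr⟩ := exists_posIdx κ A μ
  obtain ⟨Q, hQ, hneg, hQr⟩ := exists_negative_complement hκ hA hμ
  -- The real structure exchanges signs: c P is negative definite, so it meets P trivially, while c
  -- Q is positive definite. The two bounds together give equality.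
  have h1 : finrank ℂ P + finrank ℂ (P.map c) ≤ finrank ℂ (A.maxGenEigenspace μ) := by
    refine finrank_add_le_of_disjoint hP (hmap P hP) ?_
    rintro _ hx ⟨y, hy, rfl⟩
    by_contra hne
    have e1 := hpos _ hx hne
    have e2 := hpos y hy (by rintro rfl; simp at hne)
    rw [hcκ] at e1
    linarith
  have h2 : finrank ℂ (Q.map c) ≤ posIdx κ A μ := by
    refine le_posIdx (hmap Q hQ) ?_
    rintro _ ⟨y, hy, rfl⟩ hne
    rw [hcκ]
    have := hneg y hy (by rintro rfl; simp at hne)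
    linarith
  rw [finrank_map_semilinear c hc] at h1 h2
  omega

end Multiplicity

end SalamonZehnder

/-! ### Directions of products of eigenvalues. -/

namespace SalamonZehnder

open Module Complex

section Products

variable {S : Finset ℂ} {l m p : ℂ → ℕ}

lemma norm_star (μ : ℂ) : ‖(starRingEnd ℂ μ)⁻¹‖ = ‖μ‖⁻¹ := by
  rw [norm_inv, RCLike.norm_conj]

lemma direction_star {μ : ℂ} (hμ : μ ≠ 0) :
    (starRingEnd ℂ μ)⁻¹ / ‖(starRingEnd ℂ μ)⁻¹‖ = μ / ‖μ‖ := by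
  have h1 : (‖μ‖ : ℂ) ≠ 0 := by simpa using hμ
  have h2 : starRingEnd ℂ μ ≠ 0 := by simpa using hμ
  rw [norm_star, ofReal_inv, div_inv_eq_mul, eq_div_iff h1, inv_mul_eq_div, div_mul_eq_mul_div,
    div_eq_iff h2, mul_conj, normSq_eq_norm_sq, ofReal_pow, sq]

lemma prod_star {M : Type*} [CommMonoid M] (hS : ∀ μ ∈ S, (starRingEnd ℂ μ)⁻¹ ∈ S) (g : ℂ → M) :
    ∏ μ ∈ S, g (starRingEnd ℂ μ)⁻¹ = ∏ μ ∈ S, g μ :=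
  Finset.prod_bij' (fun μ _ => (starRingEnd ℂ μ)⁻¹) (fun μ _ => (starRingEnd ℂ μ)⁻¹) hS hS
    (fun μ _ => conj_inv_conj_inv μ) (fun μ _ => conj_inv_conj_inv μ) (fun _ _ => rfl)

lemma one_lt_norm_star {μ : ℂ} (h0 : μ ≠ 0) : 1 < ‖(starRingEnd ℂ μ)⁻¹‖ ↔ ‖μ‖ < 1 := by
  rw [norm_star, one_lt_inv₀ (norm_pos_iff.mpr h0)]

lemma norm_of_im_eq_zero {μ : ℂ} (h : μ.im = 0) : ‖μ‖ = |μ.re| := by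
  rw [show μ = (μ.re : ℂ) from Complex.ext rfl h]
  simp

/-- Outside the unit circle only the negative real eigenvalues contribute to the direction. -/
lemma prod_direction_outside (h0 : ∀ μ ∈ S, μ ≠ 0)
    (hconj : ∀ μ ∈ S, starRingEnd ℂ μ ∈ S) (hmc : ∀ μ, m (starRingEnd ℂ μ) = m μ) :
    ∏ μ ∈ S, (if 1 < ‖μ‖ then (μ / ‖μ‖ : ℂ) ^ m μ else 1)
      = (-1) ^ ∑ μ ∈ S, (if μ.im = 0 ∧ μ.re < -1 then m μ else 0) := by
  rw [← Finset.prod_pow_eq_pow_sum]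
  -- Nonreal eigenvalues cancel in complex conjugate pairs.
  have h1 : ∏ μ ∈ S, (if 1 < ‖μ‖ ∧ μ.im ≠ 0 then (μ / ‖μ‖ : ℂ) ^ m μ else 1) = 1 := by
    refine Finset.prod_involution (fun μ _ => starRingEnd ℂ μ) ?_ ?_ (fun μ hμ => hconj μ hμ)
      (fun μ _ => conj_conj μ)
    · intro μ hμ
      have hn : (‖μ‖ : ℂ) ≠ 0 := by simpa using h0 μ hμ
      rw [RCLike.norm_conj, conj_im, hmc]
      by_cases hc : 1 < ‖μ‖ ∧ μ.im ≠ 0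
      · rw [if_pos hc, if_pos ⟨hc.1, neg_ne_zero.mpr hc.2⟩, ← mul_pow]
        rw [div_mul_div_comm, mul_conj, normSq_eq_norm_sq, ofReal_pow, sq,
          div_self (mul_ne_zero hn hn), one_pow]
      · rw [if_neg hc, if_neg (by simpa using hc), one_mul]
    · intro μ _ hne heq
      apply hne
      rw [if_neg]
      rintro ⟨-, him⟩
      exact him (conj_eq_iff_im.mp heq)
  refine Eq.trans ?_ ((congrArg (_ * ·) h1).trans (mul_one _))
  rw [← Finset.prod_mul_distrib]
  refine Finset.prod_congr rfl fun μ hμ => ?_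
  by_cases him : μ.im = 0
  · rw [if_neg (c := 1 < ‖μ‖ ∧ μ.im ≠ 0) (by simp [him]), mul_one, norm_of_im_eq_zero him]
    have hre : μ = (μ.re : ℂ) := Complex.ext rfl him
    have hr0 : μ.re ≠ 0 := fun h => h0 μ hμ (by rw [hre, h, ofReal_zero])
    rcases lt_or_gt_of_ne hr0 with hneg | hpos
    · rw [abs_of_neg hneg]
      by_cases hlt : μ.re < -1
      · rw [if_pos (by linarith), if_pos ⟨him, hlt⟩]
        congr 1
        conv_lhs => rw [hre]
        have : (μ.re : ℂ) ≠ 0 := by exact_mod_cast hr0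
        simp only [ofReal_re]
        push_cast
        field_simp
      · rw [if_neg (by linarith), if_neg (fun h => hlt h.2), pow_zero]
    · rw [abs_of_pos hpos, if_neg (c := μ.im = 0 ∧ _) (fun h => by linarith [h.2]), pow_zero]
      have : (μ / (μ.re : ℂ) : ℂ) = 1 := by
        conv_lhs => rw [hre]
        simp only [ofReal_re]
        exact div_self (by exact_mod_cast hr0)
      rw [this, one_pow, ite_self]
  · rw [if_neg (c := μ.im = 0 ∧ _) (fun h => him h.1), pow_zero, one_mul]
    simp [him]

/-- The reflection μ ↦ 1/μ̄ exchanges (-1, 0) with (-∞, -1) and fixes -1. This accounts for the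
exponent m₀ / 2: half the multiplicity of -1 plus the multiplicities below -1. -/
lemma sum_negative (hstar : ∀ μ ∈ S, (starRingEnd ℂ μ)⁻¹ ∈ S)
    (hms : ∀ μ, m (starRingEnd ℂ μ)⁻¹ = m μ) (hmS : ∀ μ ∉ S, m μ = 0) :
    ∑ μ ∈ S, (if μ.im = 0 ∧ μ.re < 0 then m μ else 0)
      = m (-1) + 2 * ∑ μ ∈ S, (if μ.im = 0 ∧ μ.re < -1 then m μ else 0) := by
  have h1 : ∑ μ ∈ S, (if μ = -1 then m μ else 0) = m (-1) := by
    rw [Finset.sum_ite_eq']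
    split_ifs with h
    · rfl
    · exact (hmS _ h).symm
  have h2 : ∑ μ ∈ S, (if μ.im = 0 ∧ -1 < μ.re ∧ μ.re < 0 then m μ else 0)
      = ∑ μ ∈ S, (if μ.im = 0 ∧ μ.re < -1 then m μ else 0) := by
    have := Finset.sum_bij' (s := S) (t := S)
      (f := fun μ => if μ.im = 0 ∧ -1 < μ.re ∧ μ.re < 0 then m μ else 0)
      (g := fun μ => if μ.im = 0 ∧ μ.re < -1 then m μ else 0)
      (fun μ _ => (starRingEnd ℂ μ)⁻¹) (fun μ _ => (starRingEnd ℂ μ)⁻¹) hstar hstar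
      (fun μ _ => conj_inv_conj_inv μ) (fun μ _ => conj_inv_conj_inv μ) ?_
    · exact this
    · intro μ _
      rw [hms]
      refine if_congr ?_ rfl rfl
      by_cases him : μ.im = 0
      · have hre : μ = (μ.re : ℂ) := Complex.ext rfl him
        have e1 : (starRingEnd ℂ μ)⁻¹ = ((μ.re⁻¹ : ℝ) : ℂ) := by
          rw [hre, conj_ofReal]; simp
        rw [e1, ofReal_im, ofReal_re]
        simp only [him, true_and]
        constructor
        · rintro ⟨ha, hb⟩
          rw [inv_lt_of_neg hb (by norm_num)]
          norm_num
          exact ha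
        · intro h
          have hb : μ.re < 0 := by
            by_contra! hc
            have := inv_nonneg.mpr hc
            linarith
          rw [inv_lt_of_neg hb (by norm_num)] at h
          norm_num at h
          exact ⟨h, hb⟩
      · have : ((starRingEnd ℂ μ)⁻¹).im ≠ 0 := by
          rw [inv_im, conj_im, neg_neg, normSq_conj]
          refine div_ne_zero him (normSq_pos.mpr ?_).ne'
          rintro rfl
          simp at him
        exact iff_of_false (fun h => him h.1) (fun h => this h.1)
  rw [two_mul]
  nth_rewrite 1 [← h2]
  rw [← h1, ← Finset.sum_add_distrib, ← Finset.sum_add_distrib]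
  refine Finset.sum_congr rfl fun μ _ => ?_
  by_cases him : μ.im = 0
  · have hμ : μ = -1 ↔ μ.re = -1 := by
      rw [Complex.ext_iff]; simp [him]
    simp only [him, hμ, true_and]
    rcases lt_trichotomy μ.re (-1) with h | h | h
    · rw [if_pos (by linarith), if_neg h.ne, if_neg (by intro hh; linarith [hh.1]), if_pos h]
      omega
    · rw [if_pos (by linarith), if_pos h, if_neg (by intro hh; linarith [hh.1]),
        if_neg (by linarith)]
      omega
    · rw [if_neg (c := μ.re = -1) (by linarith), if_neg (c := μ.re < -1) (by linarith)]
      simp [h]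
  · have hμ : μ ≠ -1 := by
      rintro rfl
      simp at him
    simp [him, hμ]

/-- The direction of a product over eigenvalues with multiplicities of an invariant maximal
non-negative subspace. -/
lemma prod_eq_norm_mul (h0 : ∀ μ ∈ S, μ ≠ 0) (hstar : ∀ μ ∈ S, (starRingEnd ℂ μ)⁻¹ ∈ S)
    (hconj : ∀ μ ∈ S, starRingEnd ℂ μ ∈ S) (hms : ∀ μ, m (starRingEnd ℂ μ)⁻¹ = m μ)
    (hmc : ∀ μ, m (starRingEnd ℂ μ) = m μ) (hmS : ∀ μ ∉ S, m μ = 0)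
    (hl1 : ∀ μ ∈ S, ‖μ‖ = 1 → l μ = p μ)
    (hl2 : ∀ μ ∈ S, ‖μ‖ ≠ 1 → l μ + l (starRingEnd ℂ μ)⁻¹ = m μ) (hp : 2 * p (-1) = m (-1)) :
    ∏ μ ∈ S, μ ^ l μ = ‖∏ μ ∈ S, μ ^ l μ‖ *
      ((-1) ^ ((∑ μ ∈ S, (if μ.im = 0 ∧ μ.re < 0 then m μ else 0)) / 2) *
        ∏ μ ∈ S, (if ‖μ‖ = 1 ∧ μ ≠ 1 ∧ μ ≠ -1 then μ ^ p μ else 1)) := by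
  have h1 : ∏ μ ∈ S, μ ^ l μ
      = ‖∏ μ ∈ S, μ ^ l μ‖ * ∏ μ ∈ S, (μ / ‖μ‖ : ℂ) ^ l μ := by
    rw [norm_prod, ofReal_prod, ← Finset.prod_mul_distrib]
    refine Finset.prod_congr rfl fun μ hμ => ?_
    have hn : (‖μ‖ : ℂ) ≠ 0 := by simpa using h0 μ hμ
    rw [norm_pow, ofReal_pow, ← mul_pow, mul_div_cancel₀ _ hn]
  -- μ and 1/μ̄ have the same direction, so the factors inside the circle can be moved outside,
  -- where the two exponents add up to the full multiplicity m.
  have h2 : ∏ μ ∈ S, (if ‖μ‖ < 1 then (μ / ‖μ‖ : ℂ) ^ l μ else 1)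
      = ∏ μ ∈ S, (if 1 < ‖μ‖ then (μ / ‖μ‖ : ℂ) ^ l (starRingEnd ℂ μ)⁻¹ else 1) := by
    rw [← prod_star hstar (fun μ => if 1 < ‖μ‖ then (μ / ‖μ‖ : ℂ) ^ l (starRingEnd ℂ μ)⁻¹ else 1)]
    refine Finset.prod_congr rfl fun μ hμ => ?_
    rw [conj_inv_conj_inv, direction_star (h0 μ hμ)]
    exact if_congr (one_lt_norm_star (h0 μ hμ)).symm rfl rfl
  have h3 : ∏ μ ∈ S, (if μ = -1 then (-1 : ℂ) ^ p μ else 1) = (-1) ^ p (-1) := by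
    rw [Finset.prod_ite_eq']
    split_ifs with h
    · rfl
    · have := hmS _ h
      rw [show p (-1) = 0 by omega, pow_zero]
  have h4 : ∏ μ ∈ S, (μ / ‖μ‖ : ℂ) ^ l μ
      = (∏ μ ∈ S, (if μ = -1 then (-1 : ℂ) ^ p μ else 1)) *
        (∏ μ ∈ S, (if ‖μ‖ = 1 ∧ μ ≠ 1 ∧ μ ≠ -1 then μ ^ p μ else 1)) *
        ((∏ μ ∈ S, (if 1 < ‖μ‖ then (μ / ‖μ‖ : ℂ) ^ l μ else 1)) *
        ∏ μ ∈ S, (if ‖μ‖ < 1 then (μ / ‖μ‖ : ℂ) ^ l μ else 1)) := by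
    rw [← Finset.prod_mul_distrib, ← Finset.prod_mul_distrib, ← Finset.prod_mul_distrib]
    refine Finset.prod_congr rfl fun μ hμ => ?_
    rcases lt_trichotomy ‖μ‖ 1 with h | h | h
    · have hne : μ ≠ -1 := by
        rintro rfl
        simp at h
      simp [h, h.ne, h.le.not_gt, hne]
    · rw [hl1 μ hμ h, h]
      simp only [ofReal_one, div_one, lt_irrefl, if_false, mul_one, true_and]
      by_cases e1 : μ = -1
      · simp [e1]
      · by_cases e2 : μ = 1
        · rw [if_neg e1, if_neg (fun h => h.1 e2), e2, one_pow, one_mul]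
        · simp [e1, e2]
    · have hne : μ ≠ -1 := by
        rintro rfl
        simp at h
      simp [h, h.ne', h.le.not_gt, hne]
  have h5 : (∏ μ ∈ S, (if 1 < ‖μ‖ then (μ / ‖μ‖ : ℂ) ^ l μ else 1)) *
      ∏ μ ∈ S, (if 1 < ‖μ‖ then (μ / ‖μ‖ : ℂ) ^ l (starRingEnd ℂ μ)⁻¹ else 1)
      = ∏ μ ∈ S, (if 1 < ‖μ‖ then (μ / ‖μ‖ : ℂ) ^ m μ else 1) := by
    rw [← Finset.prod_mul_distrib]
    refine Finset.prod_congr rfl fun μ hμ => ?_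
    split_ifs with h
    · rw [← pow_add, hl2 μ hμ h.ne']
    · rw [one_mul]
  rw [sum_negative hstar hms hmS, ← hp, ← mul_add, Nat.mul_div_cancel_left _ two_pos, pow_add]
  refine h1.trans (congrArg _ ?_)
  rw [h4, h3, h2, h5, prod_direction_outside h0 hconj hmc]
  ring

end Products

end SalamonZehnder

/-! ### The complexified symplectic space and ρ as the direction of a determinant. -/

namespace SalamonZehnder

open Module Complex

section Complexification

variable {V : Type u} [AddCommGroup V] [Module ℝ V]

lemma conjC_tmul (a : ℂ) (v : V) : conjC V (a ⊗ₜ v) = (starRingEnd ℂ a) ⊗ₜ v := rfl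

lemma conjC_smul (a : ℂ) (z : ℂ ⊗[ℝ] V) : conjC V (a • z) = starRingEnd ℂ a • conjC V z := by
  induction z with
  | zero => simp
  | tmul b v => simp [TensorProduct.smul_tmul', conjC_tmul]
  | add x y hx hy => simp [smul_add, hx, hy]

lemma conjC_conjC (z : ℂ ⊗[ℝ] V) : conjC V (conjC V z) = z := by
  induction z with
  | zero => simp
  | tmul b v => simp [conjC_tmul]
  | add x y hx hy => simp [hx, hy]

/-- Complex conjugation as a semilinear map. -/
noncomputable def conjSemilinear (V : Type u) [AddCommGroup V] [Module ℝ V] :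
    (ℂ ⊗[ℝ] V) →ₗ⋆[ℂ] (ℂ ⊗[ℝ] V) where
  toFun := conjC V
  map_add' := map_add _
  map_smul' := conjC_smul

/-- The Hermitian form `i ω_ℂ(z̄, w)`. -/
noncomputable def kreinBilin (ω : LinearMap.BilinForm ℝ V) :
    (ℂ ⊗[ℝ] V) →ₗ⋆[ℂ] (ℂ ⊗[ℝ] V) →ₗ[ℂ] ℂ :=
  LinearMap.mk₂'ₛₗ (starRingEnd ℂ) (RingHom.id ℂ)
    (fun z w => I * (LinearMap.BilinForm.baseChange ℂ ω) (conjC V z) w)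
    (fun x y w => by simp [mul_add]) (fun c x w => by simp [conjC_smul]; ring)
    (fun x y w => by simp [mul_add]) (fun c x w => by simp; ring)

lemma kreinBilin_apply (ω : LinearMap.BilinForm ℝ V) (z w : ℂ ⊗[ℝ] V) :
    kreinBilin ω z w = I * (LinearMap.BilinForm.baseChange ℂ ω) (conjC V z) w := rfl

lemma kreinBilin_tmul (ω : LinearMap.BilinForm ℝ V) (a b : ℂ) (v w : V) :
    kreinBilin ω (a ⊗ₜ v) (b ⊗ₜ w) = I * (starRingEnd ℂ a * b * ω v w) := by
  rw [kreinBilin_apply, conjC_tmul, LinearMap.BilinForm.baseChange_tmul]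
  simp only [real_smul]
  ring

lemma kreinBilin_conjC (ω : LinearMap.BilinForm ℝ V) (z w : ℂ ⊗[ℝ] V) :
    kreinBilin ω (conjC V z) (conjC V w) = -starRingEnd ℂ (kreinBilin ω z w) := by
  induction z with
  | zero => simp
  | add x y hx hy => simp only [map_add, LinearMap.add_apply, hx, hy]; ring
  | tmul a v =>
    induction w with
    | zero => simp
    | add x y hx hy => simp only [map_add, hx, hy]; ring
    | tmul b w => simp [conjC_tmul, kreinBilin_tmul]

lemma kreinBilin_symm {ω : LinearMap.BilinForm ℝ V} (hω : ω.IsAlt) (z w : ℂ ⊗[ℝ] V) :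
    kreinBilin ω w z = starRingEnd ℂ (kreinBilin ω z w) := by
  induction z with
  | zero => simp
  | add x y hx hy => simp only [map_add, LinearMap.add_apply, hx, hy]
  | tmul a v =>
    induction w with
    | zero => simp
    | add x y hx hy => simp only [map_add, LinearMap.add_apply, hx, hy]
    | tmul b w =>
      have h := LinearMap.IsAlt.neg hω v w
      simp only [kreinBilin_tmul, ← h, map_mul, conj_I, conj_conj, conj_ofReal]
      push_cast
      ring

lemma exists_real_imag (z : ℂ ⊗[ℝ] V) :
    ∃ x y : V, z = (1 : ℂ) ⊗ₜ[ℝ] x + I ⊗ₜ[ℝ] y := by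
  induction z with
  | zero => exact ⟨0, 0, by simp⟩
  | tmul a v =>
    refine ⟨a.re • v, a.im • v, ?_⟩
    rw [TensorProduct.tmul_smul, TensorProduct.tmul_smul, TensorProduct.smul_tmul',
      TensorProduct.smul_tmul', ← TensorProduct.add_tmul]
    congr 1
    simp only [real_smul, mul_one]
    exact (re_add_im a).symm
  | add x y hx hy =>
    obtain ⟨a, b, rfl⟩ := hx
    obtain ⟨c, d, rfl⟩ := hy
    refine ⟨a + c, b + d, ?_⟩
    rw [TensorProduct.tmul_add, TensorProduct.tmul_add]
    abel

lemma isKrein_kreinBilin {ω : LinearMap.BilinForm ℝ V} (hω : ω.IsAlt) (hnd : ω.Nondegenerate) :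
    IsKrein (kreinBilin ω) := by
  refine ⟨kreinBilin_symm hω, fun z hz => ?_⟩
  obtain ⟨x, y, rfl⟩ := exists_real_imag z
  have h : ∀ w, ω x w = 0 ∧ ω y w = 0 := by
    intro w
    have := hz ((1 : ℂ) ⊗ₜ w)
    rw [map_add, LinearMap.add_apply, kreinBilin_tmul, kreinBilin_tmul] at this
    have h1 := congrArg re this
    have h2 := congrArg im this
    simp at h1 h2
    exact ⟨h2, h1⟩
  have hx : x = 0 := hnd.1 x fun w => (h w).1
  have hy : y = 0 := hnd.1 y fun w => (h w).2
  simp [hx, hy]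

lemma kreinBilin_baseChange {ω : LinearMap.BilinForm ℝ V} {A B : End ℝ V}
    {η : LinearMap.BilinForm ℝ V} (h : ∀ x y, ω (A x) (B y) = η x y) (z w : ℂ ⊗[ℝ] V) :
    kreinBilin ω (LinearMap.baseChange ℂ A z) (LinearMap.baseChange ℂ B w)
      = kreinBilin η z w := by
  induction z with
  | zero => simp
  | add x y hx hy => simp only [map_add, LinearMap.add_apply, hx, hy]
  | tmul a v =>
    induction w with
    | zero => simp
    | add x y hx hy => simp only [map_add, hx, hy]
    | tmul b w => simp [kreinBilin_tmul, h]

lemma baseChange_conjC (A : End ℝ V) (z : ℂ ⊗[ℝ] V) :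
    LinearMap.baseChange ℂ A (conjC V z) = conjC V (LinearMap.baseChange ℂ A z) := by
  induction z with
  | zero => simp
  | tmul a v => simp [conjC_tmul]
  | add x y hx hy => simp [hx, hy]

variable [FiniteDimensional ℝ V]

lemma finrank_maxGenEigenspace_conj (A : End ℝ V) (μ : ℂ) :
    finrank ℂ (End.maxGenEigenspace (LinearMap.baseChange ℂ A) (starRingEnd ℂ μ))
      = finrank ℂ (End.maxGenEigenspace (LinearMap.baseChange ℂ A) μ) := by
  rw [LinearMap.finrank_maxGenEigenspace_eq, LinearMap.finrank_maxGenEigenspace_eq,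
    Polynomial.eq_rootMultiplicity_map (starRingEnd ℂ).injective μ, LinearMap.charpoly_baseChange,
    Polynomial.map_map]
  congr 2
  ext x
  simp

lemma negCount_eq (A : End ℝ V) :
    negCount A = ∑ μ ∈ (LinearMap.baseChange ℂ A).charpoly.roots.toFinset,
      if μ.im = 0 ∧ μ.re < 0 then
        finrank ℂ (End.maxGenEigenspace (LinearMap.baseChange ℂ A) μ) else 0 := by
  classical
  rw [negCount, ← Finset.sum_filter, ← Multiset.toFinset_sum_count_eq]
  have hm : ∀ r : ℝ, finrank ℂ (End.maxGenEigenspace (LinearMap.baseChange ℂ A) (r : ℂ))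
      = A.charpoly.roots.count r := by
    intro r
    rw [LinearMap.finrank_maxGenEigenspace_eq, LinearMap.charpoly_baseChange,
      Polynomial.count_roots]
    exact (Polynomial.eq_rootMultiplicity_map (algebraMap ℝ ℂ).injective r).symm
  refine Finset.sum_bij (fun r _ => (r : ℂ)) ?_ (fun a _ b _ h => by exact_mod_cast h) ?_ ?_
  · intro r hr
    rw [Multiset.mem_toFinset, Multiset.mem_filter] at hr
    rw [Finset.mem_filter, mem_roots_iff, hm, Multiset.count_pos]
    exact ⟨hr.1, ofReal_im r, by simpa using hr.2⟩
  · intro μ hμ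
    rw [Finset.mem_filter, mem_roots_iff] at hμ
    have hre : (μ.re : ℂ) = μ := Complex.ext rfl hμ.2.1.symm
    rw [← hre, hm, Multiset.count_pos] at hμ
    exact ⟨μ.re, by
      rw [Multiset.mem_toFinset, Multiset.mem_filter]; exact ⟨hμ.1, by simpa using hμ.2.2⟩, hre⟩
  · intro r hr
    rw [Multiset.mem_toFinset, Multiset.mem_filter] at hr
    rw [hm, Multiset.count_filter_of_pos (p := fun r : ℝ => r < 0) hr.2]

lemma rho_eq (ω : LinearMap.BilinForm ℝ V) (A : End ℝ V) :
    rho ω A = (-1) ^ ((∑ μ ∈ (LinearMap.baseChange ℂ A).charpoly.roots.toFinset,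
      if μ.im = 0 ∧ μ.re < 0 then
        finrank ℂ (End.maxGenEigenspace (LinearMap.baseChange ℂ A) μ) else 0) / 2) *
      ∏ μ ∈ (LinearMap.baseChange ℂ A).charpoly.roots.toFinset,
        if ‖μ‖ = 1 ∧ μ ≠ 1 ∧ μ ≠ -1 then
          μ ^ posIdx (kreinBilin ω) (LinearMap.baseChange ℂ A) μ else 1 := by
  classical
  rw [rho, negCount_eq, circleEigenvalues, ← LinearMap.charpoly_baseChange, ← Finset.prod_filter]
  congr 1

/-- The Salamon--Zehnder map is the direction of the determinant on an invariant maximal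
non-negative subspace. -/
theorem det_restrict_eq_rho {ω : LinearMap.BilinForm ℝ V} (hω : ω.IsAlt)
    (hnd : ω.Nondegenerate) {A : End ℝ V} (hA : IsSymplecticMap ω A)
    {L N : Submodule ℂ (ℂ ⊗[ℝ] V)}
    (h : IsInvariantPair (kreinBilin ω) (LinearMap.baseChange ℂ A) L N)
    (hLN : finrank ℂ (ℂ ⊗[ℝ] V) ≤ finrank ℂ L + finrank ℂ N) :
    LinearMap.det ((LinearMap.baseChange ℂ A).restrict h.mapsTo_left)
      = ‖LinearMap.det ((LinearMap.baseChange ℂ A).restrict h.mapsTo_left)‖ * rho ω A := by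
  have hκ := isKrein_kreinBilin hω hnd
  have hAκ : ∀ x y, kreinBilin ω (LinearMap.baseChange ℂ A x) (LinearMap.baseChange ℂ A y)
      = kreinBilin ω x y := kreinBilin_baseChange hA
  have hinv := fun μ hμ => finrank_inf_of_isInvariantPair hκ hAκ h hLN (μ := μ) hμ
  rw [det_restrict_eq, rho_eq]
  refine prod_eq_norm_mul ?_ ?_ ?_ (finrank_maxGenEigenspace_conj_inv hκ hAκ)
    (finrank_maxGenEigenspace_conj A) ?_ (fun μ hμ => (hinv μ hμ).1)
    (fun μ hμ => (hinv μ hμ).2) ?_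
  · rintro μ hμ rfl
    rw [mem_roots_iff, finrank_maxGenEigenspace_zero hκ hAκ] at hμ
    exact lt_irrefl _ hμ
  · intro μ hμ
    rw [mem_roots_iff] at hμ ⊢
    rwa [finrank_maxGenEigenspace_conj_inv hκ hAκ]
  · intro μ hμ
    rw [mem_roots_iff] at hμ ⊢
    rwa [finrank_maxGenEigenspace_conj]
  · intro μ hμ
    rw [mem_roots_iff] at hμ
    omega
  · refine two_mul_posIdx hκ hAκ (conjSemilinear V) conjC_conjC (fun x => ?_)
      (baseChange_conjC A) (μ := -1) (by simp) (by simp)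
    show (kreinBilin ω (conjC V x) (conjC V x)).re = _
    rw [kreinBilin_conjC, neg_re, conj_re]

end Complexification

end SalamonZehnder

/-! ### Orthonormal bases of the complexification compatible with conjugation. -/

namespace SalamonZehnder

open Module Complex Matrix

section SplitBasis

variable {V : Type u} [AddCommGroup V] [Module ℝ V]

/-- A symplectic family, normalized to give an orthonormal family for the Krein form. -/
structure IsSymplecticFamily (ω : LinearMap.BilinForm ℝ V) {n : ℕ} (x y : Fin n → V) : Prop where
  left : ∀ i j, ω (x i) (x j) = 0
  right : ∀ i j, ω (y i) (y j) = 0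
  cross : ∀ i j, ω (x i) (y j) = if i = j then 1 / 2 else 0

lemma IsSymplecticFamily.linearIndependent {ω : LinearMap.BilinForm ℝ V} (hω : ω.IsAlt) {n : ℕ}
    {x y : Fin n → V} (h : IsSymplecticFamily ω x y) : LinearIndependent ℝ (Sum.elim x y) := by
  rw [Fintype.linearIndependent_iff]
  intro c hc
  have hyx : ∀ i j, ω (y i) (x j) = if i = j then -(1 / 2) else 0 := fun i j => by
    rw [← LinearMap.IsAlt.neg hω, h.cross]
    simp only [eq_comm (a := j)]
    split_ifs <;> simp
  rw [Fintype.sum_sum_type] at hc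
  simp only [Sum.elim_inl, Sum.elim_inr] at hc
  rintro (i | i)
  · have := congrArg (ω (y i)) hc
    simp only [map_add, map_sum, map_smul, hyx, h.right, smul_eq_mul, mul_ite, mul_zero,
      Finset.sum_ite_eq, Finset.mem_univ, if_true, map_zero, Finset.sum_const_zero, add_zero] at this
    linarith
  · have := congrArg (ω (x i)) hc
    simp only [map_add, map_sum, map_smul, h.cross, h.left, smul_eq_mul, mul_ite, mul_zero,
      Finset.sum_ite_eq, Finset.mem_univ, if_true, map_zero, Finset.sum_const_zero, zero_add] at this
    linarith

variable [FiniteDimensional ℝ V]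

lemma IsSymplecticFamily.two_mul_le {ω : LinearMap.BilinForm ℝ V} (hω : ω.IsAlt) {n : ℕ}
    {x y : Fin n → V} (h : IsSymplecticFamily ω x y) : 2 * n ≤ finrank ℝ V := by
  have := (h.linearIndependent hω).fintype_card_le_finrank
  simp only [Fintype.card_sum, Fintype.card_fin] at this
  omega

/-- Symplectic Gram–Schmidt: a nonzero vector a orthogonal to the family, and a partner of a made
orthogonal to the family without changing its pairing with a. -/
lemma IsSymplecticFamily.exists_larger {ω : LinearMap.BilinForm ℝ V} (hω : ω.IsAlt)
    (hnd : ω.Nondegenerate) {n : ℕ} {x y : Fin n → V} (h : IsSymplecticFamily ω x y)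
    (hn : 2 * n < finrank ℝ V) :
    ∃ x' y' : Fin (n + 1) → V, IsSymplecticFamily ω x' y' := by
  have hyx : ∀ i j, ω (y i) (x j) = if i = j then -(1 / 2) else 0 := fun i j => by
    rw [← LinearMap.IsAlt.neg hω, h.cross]
    simp only [eq_comm (a := j)]
    split_ifs <;> simp
  let φ : V →ₗ[ℝ] (Fin n ⊕ Fin n → ℝ) := LinearMap.pi fun k => ω (Sum.elim x y k)
  have hφ : LinearMap.ker φ ≠ ⊥ := LinearMap.ker_ne_bot_of_finrank_lt (by
    simp only [finrank_fintype_fun_eq_card, Fintype.card_sum, Fintype.card_fin]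
    omega)
  obtain ⟨a, ha, ha0⟩ := Submodule.exists_mem_ne_zero_of_ne_bot hφ
  have hxa : ∀ i, ω (x i) a = 0 := fun i => congrFun ha (Sum.inl i)
  have hya : ∀ i, ω (y i) a = 0 := fun i => congrFun ha (Sum.inr i)
  obtain ⟨b, hb⟩ : ∃ b, ω a b ≠ 0 := by
    by_contra! hall
    exact ha0 (hnd.1 a hall)
  set b' := (1 / 2 / ω a b) • b with hb'
  have hab' : ω a b' = 1 / 2 := by
    rw [hb', map_smul, smul_eq_mul]
    field_simp
  set e := b' + ∑ i, (2 * ω (y i) b') • x i - ∑ i, (2 * ω (x i) b') • y i with he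
  have hax : ∀ i, ω a (x i) = 0 := fun i => by rw [← LinearMap.IsAlt.neg hω, hxa, neg_zero]
  have hay : ∀ i, ω a (y i) = 0 := fun i => by rw [← LinearMap.IsAlt.neg hω, hya, neg_zero]
  have hae : ω a e = 1 / 2 := by simp [he, hax, hay, hab']
  have hxe : ∀ i, ω (x i) e = 0 := fun i => by
    simp only [he, map_sub, map_add, map_sum, map_smul, h.left, h.cross, smul_eq_mul, mul_ite,
      mul_zero, Finset.sum_const_zero, Finset.sum_ite_eq, Finset.mem_univ, if_true]
    ring
  have hye : ∀ i, ω (y i) e = 0 := fun i => by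
    simp only [he, map_sub, map_add, map_sum, map_smul, h.right, hyx, smul_eq_mul, mul_ite,
      mul_zero, Finset.sum_const_zero, Finset.sum_ite_eq, Finset.mem_univ, if_true]
    ring
  have hey : ∀ i, ω e (y i) = 0 := fun i => by rw [← LinearMap.IsAlt.neg hω, hye, neg_zero]
  refine ⟨Fin.cons a x, Fin.cons e y, ⟨?_, ?_, ?_⟩⟩
  · intro i j
    refine Fin.cases ?_ (fun i => ?_) i <;> refine Fin.cases ?_ (fun j => ?_) j
    · simpa using hω a
    · simpa using hax j
    · simpa using hxa i
    · simpa using h.left i j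
  · intro i j
    refine Fin.cases ?_ (fun i => ?_) i <;> refine Fin.cases ?_ (fun j => ?_) j
    · simpa using hω e
    · simpa using hey j
    · simpa using hye i
    · simpa using h.right i j
  · intro i j
    refine Fin.cases ?_ (fun i => ?_) i <;> refine Fin.cases ?_ (fun j => ?_) j
    · simpa using hae
    · simpa [Fin.succ_ne_zero, (Fin.succ_ne_zero j).symm] using hay j
    · simpa [Fin.succ_ne_zero] using hxe i
    · simpa using h.cross i j

lemma exists_isSymplecticFamily {ω : LinearMap.BilinForm ℝ V} (hω : ω.IsAlt)
    (hnd : ω.Nondegenerate) :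
    ∃ (n : ℕ) (x y : Fin n → V), IsSymplecticFamily ω x y ∧ finrank ℝ V = 2 * n := by
  set D : Set ℕ := {n | ∃ x y : Fin n → V, IsSymplecticFamily ω x y} with hD
  have hne : D.Nonempty := ⟨0, Fin.elim0, Fin.elim0, ⟨fun i => i.elim0, fun i => i.elim0,
    fun i => i.elim0⟩⟩
  have hbdd : BddAbove D := ⟨finrank ℝ V, by
    rintro n ⟨x, y, h⟩
    have := h.two_mul_le hω
    omega⟩
  obtain ⟨x, y, h⟩ := Nat.sSup_mem hne hbdd
  refine ⟨sSup D, x, y, h, ?_⟩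
  by_contra hcon
  have h1 := h.two_mul_le hω
  obtain ⟨x', y', h'⟩ := h.exists_larger hω hnd (by omega)
  have := le_csSup hbdd (show sSup D + 1 ∈ D from ⟨x', y', h'⟩)
  omega

/-- A basis of the complexification which is orthonormal for the Krein form and compatible with
complex conjugation. -/
structure IsSplitBasis (ω : LinearMap.BilinForm ℝ V) {n : ℕ}
    (b : Basis (Fin n ⊕ Fin n) ℂ (ℂ ⊗[ℝ] V)) : Prop where
  gram : ∀ k l, kreinBilin ω (b k) (b l)
    = (fromBlocks 1 0 0 (-1) : Matrix (Fin n ⊕ Fin n) (Fin n ⊕ Fin n) ℂ) k l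
  conj : ∀ i, b (Sum.inr i) = conjC V (b (Sum.inl i))

lemma finrank_complexification : finrank ℂ (ℂ ⊗[ℝ] V) = finrank ℝ V := finrank_baseChange

theorem exists_isSplitBasis {ω : LinearMap.BilinForm ℝ V} (hω : ω.IsAlt)
    (hnd : ω.Nondegenerate) : ∃ (n : ℕ) (b : Basis (Fin n ⊕ Fin n) ℂ (ℂ ⊗[ℝ] V)),
      finrank ℝ V = 2 * n ∧ IsSplitBasis ω b := by
  obtain ⟨n, x, y, h, hn⟩ := exists_isSymplecticFamily hω hnd
  have hyx : ∀ i j, ω (y i) (x j) = if i = j then -(1 / 2) else 0 := fun i j => by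
    rw [← LinearMap.IsAlt.neg hω, h.cross]
    simp only [eq_comm (a := j)]
    split_ifs <;> simp
  -- The form takes the value 2 ω(x, y) at x - i y, which is 1 by the normalization ω(xᵢ, yᵢ) = 1/2;
  -- at the conjugate vector it is -1.
  set e : Fin n → ℂ ⊗[ℝ] V := fun i => (1 : ℂ) ⊗ₜ x i + (-I) ⊗ₜ y i with he
  set v : Fin n ⊕ Fin n → ℂ ⊗[ℝ] V := Sum.elim e (fun i => conjC V (e i)) with hv
  have hee : ∀ i j, kreinBilin ω (e i) (e j) = if i = j then 1 else 0 := by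
    intro i j
    simp only [he, map_add, LinearMap.add_apply, kreinBilin_tmul, h.left, h.right, h.cross, hyx]
    split_ifs
    · push_cast
      simp only [map_neg, conj_I, map_one]
      linear_combination (-1 : ℂ) * I_mul_I
    · simp
  have hec : ∀ i j, kreinBilin ω (e i) (conjC V (e j)) = 0 := by
    intro i j
    simp only [he, map_add, LinearMap.add_apply, conjC_tmul, kreinBilin_tmul, h.left, h.right,
      h.cross, hyx]
    split_ifs
    · push_cast
      simp only [map_neg, conj_I, map_one]
      ring
    · simp
  have hgram : ∀ k l, kreinBilin ω (v k) (v l)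
      = (fromBlocks 1 0 0 (-1) : Matrix (Fin n ⊕ Fin n) (Fin n ⊕ Fin n) ℂ) k l := by
    rintro (i | i) (j | j)
    · simp [hv, hee, one_apply]
    · simp [hv, hec]
    · have : kreinBilin ω (conjC V (e i)) (e j) = 0 :=
        (isKrein_kreinBilin hω hnd).eq_zero_comm (hec j i)
      simp [hv, this]
    · simp only [hv, Sum.elim_inr, kreinBilin_conjC, hee]
      rw [fromBlocks_apply₂₂, Matrix.neg_apply, one_apply]
      split_ifs <;> simp
  have hli : LinearIndependent ℂ v := by
    rw [Fintype.linearIndependent_iff]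
    intro c hc k
    have := congrArg (kreinBilin ω (v k)) hc
    simp only [map_sum, map_smul, hgram, map_zero, smul_eq_mul] at this
    rcases k with i | i <;> rw [Fintype.sum_sum_type] at this <;> simpa [one_apply] using this
  have hcard : Fintype.card (Fin n ⊕ Fin n) = finrank ℂ (ℂ ⊗[ℝ] V) := by
    rw [finrank_complexification, hn]
    simp only [Fintype.card_sum, Fintype.card_fin]
    omega
  refine ⟨n, basisOfLinearIndependentOfCardEqFinrank' v hli hcard, hn, ⟨?_, ?_⟩⟩
  · simpa using hgram
  · intro i
    simp [hv]

end SplitBasis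

/-! ### Symplectic maps as matrices in U(n, n). -/

section MatrixOfMap

variable {V : Type u} [AddCommGroup V] [Module ℝ V]
  {ω : LinearMap.BilinForm ℝ V} {n : ℕ} {b : Basis (Fin n ⊕ Fin n) ℂ (ℂ ⊗[ℝ] V)}

lemma signature_apply (k l : Fin n ⊕ Fin n) :
    (fromBlocks 1 0 0 (-1) : Matrix (Fin n ⊕ Fin n) (Fin n ⊕ Fin n) ℂ) k l
      = if k = l then Sum.elim (fun _ => 1) (fun _ => -1) k else 0 := by
  rcases k with i | i <;> rcases l with j | j <;> simp [one_apply]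
  split_ifs <;> simp

lemma IsSplitBasis.apply_left (hb : IsSplitBasis ω b) (k : Fin n ⊕ Fin n) (z : ℂ ⊗[ℝ] V) :
    kreinBilin ω (b k) z = (Sum.elim (fun _ => 1) (fun _ => -1) k : ℂ) * b.repr z k := by
  conv_lhs => rw [← b.sum_repr z]
  simp only [map_sum, map_smul, hb.gram, signature_apply, smul_eq_mul, mul_ite, mul_zero,
    Finset.sum_ite_eq, Finset.mem_univ, if_true]
  ring

lemma IsSplitBasis.self_re (hb : IsSplitBasis ω b) (z : ℂ ⊗[ℝ] V) :
    (kreinBilin ω z z).re = splitForm (b.repr z) := by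
  have : kreinBilin ω z z = ∑ k, starRingEnd ℂ (b.repr z k)
      * ((Sum.elim (fun _ => 1) (fun _ => -1) k : ℂ) * b.repr z k) := by
    have h := congrArg (fun w => kreinBilin ω w z) (b.sum_repr z)
    simp only [map_sum, LinearMap.sum_apply, map_smulₛₗ, LinearMap.smul_apply, smul_eq_mul,
      hb.apply_left] at h
    exact h.symm
  rw [this, Fintype.sum_sum_type, splitForm]
  simp only [Sum.elim_inl, Sum.elim_inr, one_mul, neg_mul, mul_neg, add_re, re_sum, neg_re,
    ← normSq_eq_conj_mul_self, ofReal_re, Finset.sum_neg_distrib]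
  ring

/-- The matrix of the complexification of `A`. -/
noncomputable def matrixOf (b : Basis (Fin n ⊕ Fin n) ℂ (ℂ ⊗[ℝ] V)) (A : End ℝ V) :
    Matrix (Fin n ⊕ Fin n) (Fin n ⊕ Fin n) ℂ :=
  LinearMap.toMatrix b b (LinearMap.baseChange ℂ A)

lemma IsSplitBasis.gram_apply (hb : IsSplitBasis ω b) (A B : End ℝ V) (k l : Fin n ⊕ Fin n) :
    ((matrixOf b A)ᴴ * (fromBlocks 1 0 0 (-1) : Matrix (Fin n ⊕ Fin n) (Fin n ⊕ Fin n) ℂ)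
      * matrixOf b B) k l
      = kreinBilin ω (LinearMap.baseChange ℂ A (b k)) (LinearMap.baseChange ℂ B (b l)) := by
  have h := congrArg (fun w => kreinBilin ω w (LinearMap.baseChange ℂ B (b l)))
    (b.sum_repr (LinearMap.baseChange ℂ A (b k)))
  simp only [map_sum, LinearMap.sum_apply, map_smulₛₗ, LinearMap.smul_apply, smul_eq_mul,
    hb.apply_left] at h
  rw [← h, Matrix.mul_assoc, Matrix.mul_apply]
  refine Finset.sum_congr rfl fun i _ => ?_
  rw [conjTranspose_apply, Matrix.mul_apply]
  simp only [signature_apply, ite_mul, zero_mul, Finset.sum_ite_eq, Finset.mem_univ, if_true]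
  rw [matrixOf, matrixOf, LinearMap.toMatrix_apply, LinearMap.toMatrix_apply]
  rfl

lemma IsSplitBasis.isPseudoUnitary (hb : IsSplitBasis ω b) {A : End ℝ V}
    (hA : IsSymplecticMap ω A) : IsPseudoUnitary (matrixOf b A) := by
  ext k l
  rw [hb.gram_apply, kreinBilin_baseChange hA, hb.gram]

lemma sum_normSq_le_zero {x : Fin n → ℂ} (h : ∑ i, normSq (x i) ≤ 0) : x = 0 :=
  sum_normSq_eq_zero.mp (le_antisymm h (sum_normSq_nonneg x))

/-- The projection to the positive coordinates is injective on a non-negative subspace. -/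
lemma IsSplitBasis.finrank_nonneg_le (hb : IsSplitBasis ω b) {L : Submodule ℂ (ℂ ⊗[ℝ] V)}
    (hL : ∀ x ∈ L, 0 ≤ (kreinBilin ω x x).re) : finrank ℂ L ≤ n := by
  let φ : L →ₗ[ℂ] (Fin n → ℂ) :=
    (LinearMap.pi fun i => b.coord (Sum.inl i)).comp L.subtype
  have hφ : Function.Injective φ := by
    rw [← LinearMap.ker_eq_bot, LinearMap.ker_eq_bot']
    rintro ⟨z, hz⟩ h0
    have h1 : ∀ i, b.repr z (Sum.inl i) = 0 := fun i => congrFun h0 i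
    have h2 := hL z hz
    rw [hb.self_re, splitForm] at h2
    simp only [h1, map_zero, Finset.sum_const_zero, zero_sub, Left.nonneg_neg_iff] at h2
    have h3 := sum_normSq_le_zero h2
    apply Subtype.ext
    apply b.repr.injective
    ext (i | i)
    · simpa using h1 i
    · simpa using congrFun h3 i
  simpa using LinearMap.finrank_le_finrank_of_injective hφ

lemma IsSplitBasis.finrank_nonpos_le (hb : IsSplitBasis ω b) {N : Submodule ℂ (ℂ ⊗[ℝ] V)}
    (hN : ∀ x ∈ N, (kreinBilin ω x x).re ≤ 0) : finrank ℂ N ≤ n := by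
  let φ : N →ₗ[ℂ] (Fin n → ℂ) :=
    (LinearMap.pi fun i => b.coord (Sum.inr i)).comp N.subtype
  have hφ : Function.Injective φ := by
    rw [← LinearMap.ker_eq_bot, LinearMap.ker_eq_bot']
    rintro ⟨z, hz⟩ h0
    have h1 : ∀ i, b.repr z (Sum.inr i) = 0 := fun i => congrFun h0 i
    have h2 := hN z hz
    rw [hb.self_re, splitForm] at h2
    simp only [h1, map_zero, Finset.sum_const_zero, sub_zero] at h2
    have h3 := sum_normSq_le_zero h2
    apply Subtype.ext
    apply b.repr.injective
    ext (i | i)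
    · simpa using congrFun h3 i
    · simpa using h1 i
  simpa using LinearMap.finrank_le_finrank_of_injective hφ

/-- The Salamon--Zehnder map is the direction of the determinant of the upper left block, up to
the correction term. -/
theorem IsSplitBasis.exists_rho_eq [FiniteDimensional ℝ V] (hb : IsSplitBasis ω b)
    (hω : ω.IsAlt) (hnd : ω.Nondegenerate)
    (hn : finrank ℝ V = 2 * n) {A : End ℝ V} (hA : IsSymplecticMap ω A) :
    ∃ r : ℝ, 0 < r ∧ rho ω A
      = r * ((matrixOf b A).toBlocks₁₁.det * exp (correction (matrixOf b A) * I)) := by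
  have hκ := isKrein_kreinBilin hω hnd
  have hAκ : ∀ x y, kreinBilin ω (LinearMap.baseChange ℂ A x) (LinearMap.baseChange ℂ A y)
      = kreinBilin ω x y := kreinBilin_baseChange hA
  obtain ⟨L, N, h, hLN⟩ := exists_isInvariantPair hκ hAκ
  have hdet := det_restrict_eq_rho hω hnd hA h hLN
  -- Both dimensions are at most n and their sum is at least 2n.
  have hLn : finrank ℂ L = n := by
    have h1 := hb.finrank_nonneg_le h.nonneg
    have h2 := hb.finrank_nonpos_le h.nonpos
    rw [finrank_complexification, hn] at hLN
    omega
  let c : Basis (Fin n) ℂ L := finBasisOfFinrankEq ℂ L hLn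
  let B := (LinearMap.baseChange ℂ A).restrict h.mapsTo_left
  let f : Matrix (Fin n ⊕ Fin n) (Fin n) ℂ := LinearMap.toMatrix c b L.subtype
  have hfx : ∀ x : Fin n → ℂ, ∃ z : L, c.repr z = x ∧ f *ᵥ x = b.repr z := by
    intro x
    refine ⟨c.equivFun.symm x, ?_, ?_⟩
    · exact c.equivFun.apply_symm_apply x
    · have := LinearMap.toMatrix_mulVec_repr c b L.subtype (c.equivFun.symm x)
      rw [show ⇑(c.repr (c.equivFun.symm x)) = x from c.equivFun.apply_symm_apply x] at this
      exact this
  have hf : IsFrame f := by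
    refine ⟨fun x => ?_, fun x hx => ?_⟩
    · obtain ⟨z, -, hz⟩ := hfx x
      rw [hz, ← hb.self_re]
      exact h.nonneg z z.2
    · obtain ⟨z, hzx, hz⟩ := hfx x
      rw [hx] at hz
      have hz0 : (z : ℂ ⊗[ℝ] V) = 0 := by
        apply b.repr.injective
        ext k
        simpa using (congrFun hz k).symm
      have : z = 0 := Subtype.ext hz0
      rw [← hzx, this]
      simp
  have hR : matrixOf b A * f = f * LinearMap.toMatrix c c B := by
    rw [matrixOf, ← LinearMap.toMatrix_comp c b b, ← LinearMap.toMatrix_comp c c b]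
    rfl
  obtain ⟨r, hr, hrdet⟩ := exists_pos_det_eq (hb.isPseudoUnitary hA) hf hR
  rw [LinearMap.det_toMatrix, hdet] at hrdet
  have hne : LinearMap.det B ≠ 0 := by
    intro h0
    have h1 : LinearMap.det ((LinearMap.baseChange ℂ A).restrict h.mapsTo_left) = 0 := h0
    rw [h1, norm_zero, ofReal_zero, zero_mul] at hrdet
    have h2 := (hb.isPseudoUnitary hA).det_ne_zero
    have h3 := exp_ne_zero (correction (matrixOf b A) * I)
    exact mul_ne_zero (by exact_mod_cast hr.ne') (mul_ne_zero h2 h3) hrdet.symm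
  have hpos : 0 < ‖LinearMap.det B‖ := norm_pos_iff.mpr hne
  refine ⟨r / ‖LinearMap.det B‖, div_pos hr hpos, ?_⟩
  have hc : (‖LinearMap.det B‖ : ℂ) ≠ 0 := by exact_mod_cast hpos.ne'
  rw [ofReal_div, div_mul_eq_mul_div, ← hrdet]
  exact (mul_div_cancel_left₀ _ hc).symm

end MatrixOfMap

end SalamonZehnder

/-! ### Continuous arguments and the direction of rotation. -/

namespace SalamonZehnder

open Module Complex Matrix

section Lifts

/-- A nowhere vanishing continuous function on an interval has a continuous argument. -/
lemma exists_continuous_arg {a b : ℝ} (hab : a ≤ b) {z : ℝ → ℂ}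
    (hz : ContinuousOn z (Set.Icc a b)) (h0 : ∀ t ∈ Set.Icc a b, z t ≠ 0) :
    ∃ θ : ℝ → ℝ, ContinuousOn θ (Set.Icc a b) ∧
      ∀ t ∈ Set.Icc a b, z t = ‖z t‖ * exp (θ t * I) := by
  set g : ℝ → ℂ := Set.IccExtend hab (Set.domRestrict (Set.Icc a b) z) with hg
  have hgc : Continuous g := (continuousOn_iff_continuous_domRestrict.mp hz).Icc_extend'
  have hg0 : ∀ t, g t ≠ 0 := fun t => h0 _ (Set.projIcc a b hab t).2
  have hgz : ∀ t ∈ Set.Icc a b, g t = z t := fun t ht => by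
    rw [hg, Set.IccExtend_of_mem hab _ ht]
    rfl
  have hn : ∀ t, (‖g t‖ : ℂ) ≠ 0 := fun t => by simpa using hg0 t
  have hmem : ∀ t, ‖g t / ‖g t‖‖ = 1 := fun t => by
    rw [norm_div, norm_real, norm_norm, div_self (norm_ne_zero_iff.mpr (hg0 t))]
  let f : C(ℝ, Circle) :=
    { toFun := fun t => ⟨g t / ‖g t‖, mem_sphere_zero_iff_norm.mpr (hmem t)⟩
      continuous_toFun := by
        refine Continuous.subtype_mk ?_ _
        exact hgc.div (continuous_ofReal.comp hgc.norm) hn }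
  obtain ⟨θ, ⟨-, hθ⟩, -⟩ := Circle.isCoveringMap_exp.existsUnique_continuousMap_lifts f 0
    (arg (f 0)) (Circle.exp_arg (f 0))
  refine ⟨θ, θ.continuous.continuousOn, fun t ht => ?_⟩
  have h1 : Circle.exp (θ t) = f t := congrFun hθ t
  have h2 : exp (θ t * I) = g t / ‖g t‖ := by
    rw [← Circle.coe_exp, h1]
    rfl
  rw [h2, hgz t ht, mul_div_cancel₀]
  rw [← hgz t ht]
  exact hn t

/-- Near t the difference θ(s) - θ(t) lies in (-π, π), so it is the imaginary part of the principal
logarithm of z(s)/z(t), whose derivative at t is w. -/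
lemma hasDerivAt_continuous_arg {z : ℝ → ℂ} {θ : ℝ → ℝ} {t : ℝ} {w : ℂ}
    (hθ : ContinuousAt θ t) (h0 : z t ≠ 0) (hz : HasDerivAt z (z t * w) t)
    (h : ∀ᶠ s in nhds t, z s = ‖z s‖ * exp (θ s * I)) : HasDerivAt θ w.im t := by
  have h1 : HasDerivAt (fun s => z s / z t) w t := by
    have := hz.div_const (z t)
    rwa [mul_div_cancel_left₀ _ h0] at this
  have h2 : HasDerivAt (fun s => Complex.log (z s / z t)) w t := by
    have := h1.clog_real (by rw [div_self h0]; exact one_mem_slitPlane)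
    simpa [div_self h0] using this
  have h3 : HasDerivAt (fun s => θ t + (Complex.log (z s / z t)).im) w.im t :=
    (imCLM.hasFDerivAt.comp_hasDerivAt t h2).const_add (θ t)
  refine h3.congr_of_eventuallyEq ?_
  have h4 : ∀ᶠ s in nhds t, z s ≠ 0 := hz.continuousAt.eventually_ne h0
  have h5 : ∀ᶠ s in nhds t, θ s - θ t ∈ Set.Ioo (-Real.pi) Real.pi := by
    have : ContinuousAt (fun s => θ s - θ t) t := hθ.sub continuousAt_const
    refine this.eventually_mem (isOpen_Ioo.mem_nhds ?_)
    rw [sub_self]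
    exact ⟨neg_lt_zero.mpr Real.pi_pos, Real.pi_pos⟩
  filter_upwards [h, h4, h5] with s hs hs0 hsm
  have ht := h.self_of_nhds
  have h6 : z s / z t = ((‖z s‖ / ‖z t‖ : ℝ) : ℂ)
      * (Complex.cos ((θ s - θ t : ℝ) : ℂ) + Complex.sin ((θ s - θ t : ℝ) : ℂ) * I) := by
    rw [← exp_mul_I, ofReal_sub, sub_mul, exp_sub]
    conv_lhs => rw [hs, ht]
    push_cast
    rw [mul_div_mul_comm]
  rw [log_im, h6, arg_mul_cos_add_sin_mul_I
    (div_pos (norm_pos_iff.mpr hs0) (norm_pos_iff.mpr h0)) ⟨hsm.1, hsm.2.le⟩]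
  ring

lemma monotoneOn_continuous_arg {a b : ℝ} {z w : ℝ → ℂ} {θ : ℝ → ℝ}
    (hθ : ContinuousOn θ (Set.Icc a b)) (h0 : ∀ t ∈ Set.Icc a b, z t ≠ 0)
    (hz : ∀ t ∈ Set.Icc a b, HasDerivWithinAt z (z t * w t) (Set.Icc a b) t)
    (hw : ∀ t ∈ Set.Icc a b, 0 ≤ (w t).im)
    (h : ∀ t ∈ Set.Icc a b, z t = ‖z t‖ * exp (θ t * I)) : MonotoneOn θ (Set.Icc a b) := by
  have hd : ∀ t ∈ interior (Set.Icc a b), HasDerivAt θ (w t).im t := by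
    intro t ht
    have hn : Set.Icc a b ∈ nhds t := mem_interior_iff_mem_nhds.mp ht
    have htm := interior_subset ht
    refine hasDerivAt_continuous_arg (hθ.continuousAt hn) (h0 t htm)
      ((hz t htm).hasDerivAt hn) ?_
    filter_upwards [hn] with s hs using h s hs
  refine monotoneOn_of_deriv_nonneg (convex_Icc a b) hθ
    (fun t ht => (hd t ht).differentiableAt.differentiableWithinAt) (fun t ht => ?_)
  rw [(hd t ht).deriv]
  exact hw t (interior_subset ht)

variable {n : ℕ}

/-- Jacobi's formula. -/
lemma hasDerivWithinAt_det {a : ℝ → Matrix (Fin n) (Fin n) ℂ} {a' : Matrix (Fin n) (Fin n) ℂ}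
    {S : Set ℝ} {t : ℝ} (h : ∀ i j, HasDerivWithinAt (fun s => a s i j) (a' i j) S t) :
    HasDerivWithinAt (fun s => (a s).det) ((adjugate (a t) * a').trace) S t := by
  have htr : (adjugate (a t) * a').trace = ∑ i, ((a t).updateCol i (fun k => a' k i)).det := by
    refine Finset.sum_congr rfl fun i _ => ?_
    rw [← cramer_apply, cramer_eq_adjugate_mulVec]
    rfl
  have h1 : HasDerivWithinAt (fun s => (a s).det) (∑ σ : Equiv.Perm (Fin n),
      ((Equiv.Perm.sign σ : ℤ) : ℂ) * ∑ i, (∏ j ∈ Finset.univ.erase i, a t (σ j) j) • a' (σ i) i)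
      S t := by
    simp only [det_apply']
    exact HasDerivWithinAt.fun_sum fun σ _ =>
      (HasDerivWithinAt.fun_finsetProd fun i _ => h (σ i) i).const_mul _
  convert! h1 using 1
  rw [htr]
  simp only [det_apply', Finset.mul_sum]
  rw [Finset.sum_comm]
  refine Finset.sum_congr rfl fun σ _ => Finset.sum_congr rfl fun i _ => ?_
  rw [← Finset.mul_prod_erase _ _ (Finset.mem_univ i), updateCol_self, smul_eq_mul, mul_comm (a' _ _)]
  congr 2
  refine Finset.prod_congr rfl fun j hj => ?_
  rw [updateCol_ne (Finset.ne_of_mem_erase hj)]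

/-- A real non-negative quadratic form rotates maximal positive subspaces in the positive
direction. -/
lemma trace_im_nonneg {ι : Type*} [Fintype ι] {a c : Matrix (Fin n) (Fin n) ℂ} (ha : a.det ≠ 0)
    (hac : ∀ x, ∑ i, normSq ((c *ᵥ x) i) ≤ ∑ i, normSq ((a *ᵥ x) i)) {q : ι → ℝ}
    (hq : ∀ m, 0 ≤ q m) (v : ι → Fin n → ℂ) :
    0 ≤ (a⁻¹ * ∑ m, (I * q m) • vecMulVec (star (v m)) (v m ᵥ* a + star (v m) ᵥ* c)).trace.im := by
  have hterm : ∀ u : Fin n → ℂ,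
      0 ≤ (a⁻¹ * vecMulVec (star u) (u ᵥ* a + star u ᵥ* c)).trace.re := by
    intro u
    set y := a⁻¹ *ᵥ star u with hy
    have hay : a *ᵥ y = star u := by
      rw [hy, mulVec_mulVec, Matrix.mul_nonsing_inv _ ha.isUnit, one_mulVec]
    -- The trace is |u|² plus the pairing of u with c y, where a y = ū; since |c y| ≤ |a y| = |u|,
    -- its real part is non-negative.
    have h1 : (a⁻¹ * vecMulVec (star u) (u ᵥ* a + star u ᵥ* c)).trace
        = ((∑ i, normSq (u i) : ℝ) : ℂ) + star u ⬝ᵥ (c *ᵥ y) := by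
      rw [mul_vecMulVec, trace_vecMulVec, ← hy, dotProduct_comm, add_dotProduct,
        ← dotProduct_mulVec, ← dotProduct_mulVec, hay, sum_normSq_eq, dotProduct_comm u]
    have h2 := re_dotProduct_ge u (c *ᵥ y)
    have h3 := hac y
    rw [hay] at h3
    have h4 : ∑ i, normSq (star u i) = ∑ i, normSq (u i) := by simp
    rw [h1, add_re, ofReal_re]
    linarith
  rw [Matrix.mul_sum, trace_sum, im_sum]
  refine Finset.sum_nonneg fun m _ => ?_
  rw [Matrix.mul_smul, trace_smul, smul_eq_mul, mul_assoc, I_mul_im, re_ofReal_mul]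
  exact mul_nonneg (hq m) (hterm (v m))

end Lifts

/-! ### Diagonalization of non-negative real forms. -/

section NonnegativeForms

variable {V : Type u} [AddCommGroup V] [Module ℝ V]

lemma exists_complexified_functional (l : V →ₗ[ℝ] ℝ) :
    ∃ L : (ℂ ⊗[ℝ] V) →ₗ[ℂ] ℂ, ∀ a v, L (a ⊗ₜ v) = a * l v := by
  refine ⟨(TensorProduct.AlgebraTensorModule.rid ℝ ℂ ℂ).toLinearMap.comp
    (LinearMap.baseChange ℂ l), fun a v => ?_⟩
  simp [mul_comm]

/-- The complexification of a non-negative real form is a sum of squares. -/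
lemma exists_kreinBilin_eq_sum [FiniteDimensional ℝ V] {p : LinearMap.BilinForm ℝ V}
    (hp : LinearMap.IsSymm p) (hp0 : ∀ x, 0 ≤ p x x) :
    ∃ (q : Fin (finrank ℝ V) → ℝ) (L : Fin (finrank ℝ V) → (ℂ ⊗[ℝ] V) →ₗ[ℂ] ℂ),
      (∀ m, 0 ≤ q m) ∧ (∀ m z, L m (conjC V z) = starRingEnd ℂ (L m z)) ∧
      ∀ z w, kreinBilin p z w = ∑ m, I * q m * (starRingEnd ℂ (L m z) * L m w) := by
  obtain ⟨v, hv⟩ := LinearMap.BilinForm.exists_orthogonal_basis hp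
  choose L hL using fun m => exists_complexified_functional (v.coord m)
  have hsum : ∀ x y, p x y = ∑ m, p (v m) (v m) * (v.coord m x * v.coord m y) := by
    intro x y
    conv_lhs => rw [← v.sum_repr x, ← v.sum_repr y]
    simp only [map_sum, LinearMap.sum_apply, map_smul, LinearMap.smul_apply, smul_eq_mul]
    refine Finset.sum_congr rfl fun m _ => ?_
    rw [Finset.sum_eq_single m]
    · simp only [Basis.coord_apply]
      ring
    · intro k _ hk
      rw [show p (v k) (v m) = 0 from hv hk]
      simp
    · simp
  refine ⟨fun m => p (v m) (v m), L, fun m => hp0 _, fun m z => ?_, fun z w => ?_⟩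
  · induction z with
    | zero => simp
    | tmul a x => simp [conjC_tmul, hL]
    | add x y hx hy => simp only [map_add, hx, hy]
  · induction z with
    | zero => simp
    | add x y hx hy =>
      simp only [map_add, LinearMap.add_apply, hx, hy, ← Finset.sum_add_distrib]
      exact Finset.sum_congr rfl fun m _ => by ring
    | tmul a x =>
      induction w with
      | zero => simp
      | add y y' hy hy' =>
        simp only [map_add, hy, hy', ← Finset.sum_add_distrib]
        exact Finset.sum_congr rfl fun m _ => by ring
      | tmul c y =>
        rw [kreinBilin_tmul, hsum]
        push_cast
        rw [Finset.mul_sum, Finset.mul_sum]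
        refine Finset.sum_congr rfl fun m _ => ?_
        simp only [hL, map_mul, conj_ofReal]
        ring

end NonnegativeForms

/-! ### Linear Hamiltonian flows. -/

section Flows

variable {V : Type u} [AddCommGroup V] [Module ℝ V] [FiniteDimensional ℝ V]
  {ω : LinearMap.BilinForm ℝ V} {T : ℝ}

/-- By nondegeneracy every linear functional is ω(w, ·) for some w, so the weak Hamilton equation
gives the derivative of every coordinate. -/
lemma IsHamiltonianFlow.exists_derivative (hω : ω.IsAlt) (hnd : ω.Nondegenerate)
    {H : ℝ → QuadraticForm ℝ V} {Φ : ℝ → End ℝ V} (h : IsHamiltonianFlow ω H T Φ) {t : ℝ}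
    (ht : t ∈ Set.Icc 0 T) (v : V) :
    ∃ D : V, (∀ w, ω w D = QuadraticMap.polar (H t) (Φ t v) w) ∧
      ∀ φ : V →ₗ[ℝ] ℝ, HasDerivWithinAt (fun s => φ (Φ s v)) (φ D) (Set.Icc 0 T) t := by
  set D := -(ω.toDual hnd).symm ((QuadraticMap.polarBilin (H t)) (Φ t v)) with hD
  have hD1 : ∀ w, ω w D = QuadraticMap.polar (H t) (Φ t v) w := by
    intro w
    rw [← LinearMap.IsAlt.neg hω, hD, map_neg, LinearMap.neg_apply, neg_neg,
      LinearMap.BilinForm.apply_toDual_symm_apply]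
    rfl
  refine ⟨D, hD1, fun φ => ?_⟩
  have hφ : ∀ x, φ x = ω ((ω.toDual hnd).symm φ) x := fun x =>
    (LinearMap.BilinForm.apply_toDual_symm_apply (hB := hnd) φ x).symm
  simp only [hφ, hD1]
  exact h.2 t ht v _

omit [FiniteDimensional ℝ V] in
lemma hasDerivWithinAt_bilin [FiniteDimensional ℝ V] (η : LinearMap.BilinForm ℝ V)
    {f g : ℝ → V} {f' g' : V} {S : Set ℝ} {t : ℝ}
    (hf : ∀ φ : V →ₗ[ℝ] ℝ, HasDerivWithinAt (fun s => φ (f s)) (φ f') S t)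
    (hg : ∀ φ : V →ₗ[ℝ] ℝ, HasDerivWithinAt (fun s => φ (g s)) (φ g') S t) :
    HasDerivWithinAt (fun s => η (f s) (g s)) (η f' (g t) + η (f t) g') S t := by
  let β := finBasis ℝ V
  have hη : ∀ x y, η x y = ∑ k, β.coord k x * η (β k) y := by
    intro x y
    conv_lhs => rw [← β.sum_repr x]
    simp only [map_sum, map_smul, LinearMap.sum_apply, LinearMap.smul_apply, smul_eq_mul,
      Basis.coord_apply]
  rw [show (fun s => η (f s) (g s)) = _ from funext fun s => hη (f s) (g s), hη f' (g t),
    hη (f t) g', ← Finset.sum_add_distrib]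
  exact HasDerivWithinAt.fun_sum fun k _ => (hf (β.coord k)).mul (hg (η (β k)))

/-- The derivative of the symplectic pairing of two Hamiltonian flows. -/
lemma hasDerivWithinAt_pairing (hω : ω.IsAlt) (hnd : ω.Nondegenerate)
    {H₀ H₁ : ℝ → QuadraticForm ℝ V} {Φ₀ Φ₁ : ℝ → End ℝ V} (h₀ : IsHamiltonianFlow ω H₀ T Φ₀)
    (h₁ : IsHamiltonianFlow ω H₁ T Φ₁) {t : ℝ} (ht : t ∈ Set.Icc 0 T) (v w : V) :
    HasDerivWithinAt (fun s => ω (Φ₀ s v) (Φ₁ s w))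
      (QuadraticMap.polarBilin (H₁ t - H₀ t) (Φ₀ t v) (Φ₁ t w)) (Set.Icc 0 T) t := by
  obtain ⟨D₀, e₀, hD₀⟩ := h₀.exists_derivative hω hnd ht v
  obtain ⟨D₁, e₁, hD₁⟩ := h₁.exists_derivative hω hnd ht w
  convert! hasDerivWithinAt_bilin ω hD₀ hD₁ using 1
  rw [← LinearMap.IsAlt.neg hω, e₀, e₁, QuadraticMap.polarBilin_apply_apply,
    QuadraticMap.polar_comm (H₁ t)]
  simp only [QuadraticMap.polar, _root_.sub_apply]
  ring

/-- The pairing of a flow with itself has derivative given by the polar form of H - H = 0, so it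
keeps its initial value. -/
lemma IsHamiltonianFlow.isSymplecticMap (hω : ω.IsAlt) (hnd : ω.Nondegenerate)
    {H : ℝ → QuadraticForm ℝ V} {Φ : ℝ → End ℝ V} (h : IsHamiltonianFlow ω H T Φ) {t : ℝ}
    (ht : t ∈ Set.Icc 0 T) : IsSymplecticMap ω (Φ t) := by
  intro x y
  have hd : ∀ s ∈ Set.Icc 0 T,
      HasDerivWithinAt (fun s => ω (Φ s x) (Φ s y)) 0 (Set.Icc 0 T) s := by
    intro s hs
    have := hasDerivWithinAt_pairing hω hnd h h hs x y
    rwa [sub_self, QuadraticMap.polarBilin_apply_apply, show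
      QuadraticMap.polar (0 : QuadraticForm ℝ V) (Φ s x) (Φ s y) = 0 by
        simp [QuadraticMap.polar]] at this
  have := constant_of_derivWithin_zero (fun s hs => (hd s hs).differentiableWithinAt)
    (fun s hs => (hd s ⟨hs.1, hs.2.le⟩).derivWithin
      (uniqueDiffOn_Icc (hs.1.trans_lt hs.2) s ⟨hs.1, hs.2.le⟩)) t ht
  rw [this]
  exact h.1 x y

lemma hasDerivWithinAt_kreinBilin (hω : ω.IsAlt) (hnd : ω.Nondegenerate)
    {H₀ H₁ : ℝ → QuadraticForm ℝ V} {Φ₀ Φ₁ : ℝ → End ℝ V} (h₀ : IsHamiltonianFlow ω H₀ T Φ₀)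
    (h₁ : IsHamiltonianFlow ω H₁ T Φ₁) {t : ℝ} (ht : t ∈ Set.Icc 0 T) (z w : ℂ ⊗[ℝ] V) :
    HasDerivWithinAt (fun s => kreinBilin ω (LinearMap.baseChange ℂ (Φ₀ s) z)
        (LinearMap.baseChange ℂ (Φ₁ s) w))
      (kreinBilin (QuadraticMap.polarBilin (H₁ t - H₀ t)) (LinearMap.baseChange ℂ (Φ₀ t) z)
        (LinearMap.baseChange ℂ (Φ₁ t) w)) (Set.Icc 0 T) t := by
  induction z with
  | zero => simpa using hasDerivWithinAt_const t (Set.Icc 0 T) (0 : ℂ)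
  | add x y hx hy => simpa only [map_add, LinearMap.add_apply] using hx.fun_add hy
  | tmul a v =>
    induction w with
    | zero => simpa using hasDerivWithinAt_const t (Set.Icc 0 T) (0 : ℂ)
    | add x y hx hy => simpa only [map_add] using hx.fun_add hy
    | tmul c w =>
      simp only [LinearMap.baseChange_tmul, kreinBilin_tmul]
      exact ((hasDerivWithinAt_pairing hω hnd h₀ h₁ ht v w).ofReal_comp.const_mul _).const_mul _

lemma continuousOn_matrixOf (hω : ω.IsAlt) (hnd : ω.Nondegenerate) {n : ℕ}
    (b : Basis (Fin n ⊕ Fin n) ℂ (ℂ ⊗[ℝ] V))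
    {H : ℝ → QuadraticForm ℝ V} {Φ : ℝ → End ℝ V} (h : IsHamiltonianFlow ω H T Φ) :
    ContinuousOn (fun t => matrixOf b (Φ t)) (Set.Icc 0 T) := by
  have hφ : ∀ (φ : V →ₗ[ℝ] ℝ) v, ContinuousOn (fun t => φ (Φ t v)) (Set.Icc 0 T) := by
    intro φ v t ht
    obtain ⟨D, -, hD⟩ := h.exists_derivative hω hnd ht v
    exact (hD φ).continuousWithinAt
  have hlin : ∀ (ψ : (ℂ ⊗[ℝ] V) →ₗ[ℂ] ℂ) z,
      ContinuousOn (fun t => ψ (LinearMap.baseChange ℂ (Φ t) z)) (Set.Icc 0 T) := by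
    intro ψ z
    induction z with
    | zero => simpa using continuousOn_const
    | add x y hx hy => simpa only [map_add] using hx.fun_add hy
    | tmul a v =>
      let φr : V →ₗ[ℝ] ℝ := reLm ∘ₗ (ψ.restrictScalars ℝ) ∘ₗ TensorProduct.mk ℝ ℂ V a
      let φi : V →ₗ[ℝ] ℝ := imLm ∘ₗ (ψ.restrictScalars ℝ) ∘ₗ TensorProduct.mk ℝ ℂ V a
      have : ∀ t, ψ (LinearMap.baseChange ℂ (Φ t) (a ⊗ₜ v))
          = (φr (Φ t v) : ℂ) + (φi (Φ t v) : ℂ) * I := by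
        intro t
        rw [LinearMap.baseChange_tmul]
        exact (re_add_im _).symm
      simp only [this]
      exact (continuous_ofReal.comp_continuousOn (hφ φr v)).add
        ((continuous_ofReal.comp_continuousOn (hφ φi v)).mul continuousOn_const)
  refine continuousOn_pi.mpr fun k => continuousOn_pi.mpr fun l => ?_
  have : ∀ t, matrixOf b (Φ t) k l = b.coord k (LinearMap.baseChange ℂ (Φ t) (b l)) := by
    intro t
    rw [matrixOf, LinearMap.toMatrix_apply]
    rfl
  simp only [this]
  exact hlin _ _

lemma IsAngle.delta_eq {Φ : ℝ → End ℝ V} {θ : ℝ → ℝ} (h : IsAngle ω Φ 0 T θ) {t : ℝ}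
    (ht : t ∈ Set.Icc 0 T) : Delta ω Φ 0 t = (θ t - θ 0) / Real.pi := by
  have hsub : Set.Icc 0 t ⊆ Set.Icc 0 T := Set.Icc_subset_Icc_right ht.2
  have hθ : IsAngle ω Φ 0 t θ := ⟨h.1.mono hsub, fun s hs => h.2 s (hsub hs)⟩
  have hex : ∃ θ : ℝ → ℝ, IsAngle ω Φ 0 t θ := ⟨θ, hθ⟩
  rw [Delta, dif_pos hex]
  have hc := hex.choose_spec
  have := sub_eq_sub_of_exp_eq (isPreconnected_Icc (a := (0 : ℝ)) (b := t)) hc.1 hθ.1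
    (fun s hs => by rw [← hc.2 s hs, ← hθ.2 s hs])
    (Set.right_mem_Icc.mpr ht.1) (Set.left_mem_Icc.mpr ht.1)
  congr 1
  linarith

/-- The Salamon--Zehnder map takes values in the unit circle. -/
lemma norm_rho (ω : LinearMap.BilinForm ℝ V) (A : End ℝ V) : ‖rho ω A‖ = 1 := by
  rw [rho, norm_mul, norm_pow, norm_neg, norm_one, one_pow, one_mul, norm_prod]
  refine Finset.prod_eq_one fun μ hμ => ?_
  rw [circleEigenvalues, Finset.mem_filter] at hμ
  rw [norm_pow, hμ.2.1, one_pow]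

/-- An argument of the determinant of the upper left block gives one of the Salamon--Zehnder
map. -/
lemma isAngle_of_arg (hω : ω.IsAlt) (hnd : ω.Nondegenerate) {n : ℕ}
    {b : Basis (Fin n ⊕ Fin n) ℂ (ℂ ⊗[ℝ] V)} (hb : IsSplitBasis ω b)
    (hn : finrank ℝ V = 2 * n) {H : ℝ → QuadraticForm ℝ V} {Φ : ℝ → End ℝ V}
    (h : IsHamiltonianFlow ω H T Φ) {θ : ℝ → ℝ} (hθ : ContinuousOn θ (Set.Icc 0 T))
    (hθe : ∀ t ∈ Set.Icc 0 T, (matrixOf b (Φ t)).toBlocks₁₁.det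
      = ‖(matrixOf b (Φ t)).toBlocks₁₁.det‖ * exp (θ t * I)) :
    IsAngle ω Φ 0 T (fun t => θ t + correction (matrixOf b (Φ t))) := by
  have hs : ∀ t ∈ Set.Icc 0 T, IsSymplecticMap ω (Φ t) := fun t ht =>
    h.isSymplecticMap hω hnd ht
  refine ⟨hθ.add (continuousOn_correction (continuousOn_matrixOf hω hnd b h)
    fun t ht => hb.isPseudoUnitary (hs t ht)), fun t ht => ?_⟩
  obtain ⟨r, hr, hre⟩ := hb.exists_rho_eq hω hnd hn (hs t ht)
  rw [hθe t ht] at hre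
  have h1 : rho ω (Φ t) = ((r * ‖(matrixOf b (Φ t)).toBlocks₁₁.det‖ : ℝ) : ℂ)
      * exp (((θ t + correction (matrixOf b (Φ t)) : ℝ) : ℂ) * I) := by
    rw [hre, ofReal_add, add_mul, exp_add, ofReal_mul]
    ring
  -- Both ρ and the exponential have modulus 1, so the positive factor between them is 1.
  have h2 := congrArg norm h1
  rw [norm_rho, norm_mul, norm_exp_ofReal_mul_I, mul_one, norm_real,
    Real.norm_of_nonneg (mul_nonneg hr.le (norm_nonneg _))] at h2
  rw [h1, ← h2, ofReal_one, one_mul]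

end Flows

end SalamonZehnder

/-! ### Comparison of two flows. -/

namespace SalamonZehnder

open Module Complex Matrix

section Comparison

variable {V : Type u} [AddCommGroup V] [Module ℝ V] [FiniteDimensional ℝ V]
  {ω : LinearMap.BilinForm ℝ V} {T : ℝ} {n : ℕ}

/-- The matrix of `A⁻¹ B` for a symplectic map `A`. -/
noncomputable def quotientMatrix (b : Basis (Fin n ⊕ Fin n) ℂ (ℂ ⊗[ℝ] V)) (A B : End ℝ V) :
    Matrix (Fin n ⊕ Fin n) (Fin n ⊕ Fin n) ℂ :=
  fromBlocks 1 0 0 (-1) * ((matrixOf b A)ᴴ *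
    (fromBlocks 1 0 0 (-1) : Matrix (Fin n ⊕ Fin n) (Fin n ⊕ Fin n) ℂ) * matrixOf b B)

lemma isPseudoUnitary_signature :
    IsPseudoUnitary (fromBlocks 1 0 0 (-1) : Matrix (Fin n ⊕ Fin n) (Fin n ⊕ Fin n) ℂ) := by
  have h : (fromBlocks 1 0 0 (-1) : Matrix (Fin n ⊕ Fin n) (Fin n ⊕ Fin n) ℂ)ᴴ
      = fromBlocks 1 0 0 (-1) := by simp [fromBlocks_conjTranspose]
  rw [IsPseudoUnitary, h, signature_mul_self, Matrix.one_mul]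

variable {b : Basis (Fin n ⊕ Fin n) ℂ (ℂ ⊗[ℝ] V)}

omit [FiniteDimensional ℝ V] in
lemma IsSplitBasis.isPseudoUnitary_quotientMatrix (hb : IsSplitBasis ω b) {A B : End ℝ V}
    (hA : IsSymplecticMap ω A) (hB : IsSymplecticMap ω B) :
    IsPseudoUnitary (quotientMatrix b A B) :=
  isPseudoUnitary_signature.mul
    (((hb.isPseudoUnitary hA).conjTranspose.mul isPseudoUnitary_signature).mul
      (hb.isPseudoUnitary hB))

omit [FiniteDimensional ℝ V] in
lemma IsSplitBasis.mul_quotientMatrix (hb : IsSplitBasis ω b) {A : End ℝ V}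
    (hA : IsSymplecticMap ω A) (B : End ℝ V) :
    matrixOf b A * quotientMatrix b A B = matrixOf b B := by
  have h := (hb.isPseudoUnitary hA).conjTranspose
  rw [IsPseudoUnitary, conjTranspose_conjTranspose] at h
  rw [quotientMatrix, ← Matrix.mul_assoc, ← Matrix.mul_assoc, ← Matrix.mul_assoc, h,
    signature_mul_self, Matrix.one_mul]

omit [FiniteDimensional ℝ V] in
lemma IsSplitBasis.quotientMatrix_inl (hb : IsSplitBasis ω b) (A B : End ℝ V) (i : Fin n)
    (l : Fin n ⊕ Fin n) : quotientMatrix b A B (Sum.inl i) l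
      = kreinBilin ω (LinearMap.baseChange ℂ A (b (Sum.inl i)))
          (LinearMap.baseChange ℂ B (b l)) := by
  rw [quotientMatrix, Matrix.mul_apply]
  simp only [signature_apply, ite_mul, zero_mul, Finset.sum_ite_eq, Finset.mem_univ, if_true,
    Sum.elim_inl, one_mul]
  exact hb.gram_apply A B _ _

omit [FiniteDimensional ℝ V] in
lemma IsSplitBasis.baseChange_eq_sum (hb : IsSplitBasis ω b) {A : End ℝ V}
    (hA : IsSymplecticMap ω A) (B : End ℝ V) (l : Fin n ⊕ Fin n) :
    LinearMap.baseChange ℂ B (b l)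
      = ∑ k, quotientMatrix b A B k l • LinearMap.baseChange ℂ A (b k) := by
  apply b.repr.injective
  ext k
  have h := congrFun (congrFun (hb.mul_quotientMatrix hA B) k) l
  rw [Matrix.mul_apply] at h
  rw [matrixOf, matrixOf] at h
  simp only [LinearMap.toMatrix_apply] at h
  rw [← h, map_sum, Finsupp.finsetSum_apply]
  refine Finset.sum_congr rfl fun m _ => ?_
  rw [map_smul, Finsupp.smul_apply, smul_eq_mul, mul_comm]

/-- The image of (x, 0) under M keeps the form value |x|² ≥ 0. This is the domination hypothesis of
`trace_im_nonneg`. -/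
lemma IsPseudoUnitary.block_le {M : Matrix (Fin n ⊕ Fin n) (Fin n ⊕ Fin n) ℂ}
    (hM : IsPseudoUnitary M) (x : Fin n → ℂ) :
    ∑ i, normSq ((M.toBlocks₂₁ *ᵥ x) i) ≤ ∑ i, normSq ((M.toBlocks₁₁ *ᵥ x) i) := by
  have h := hM.splitForm_mulVec (Sum.elim x 0)
  rw [← fromBlocks_toBlocks M, fromBlocks_mulVec] at h
  simp only [Sum.elim_comp_inl, Sum.elim_comp_inr, mulVec_zero, add_zero, splitForm_sumElim,
    Pi.zero_apply, map_zero, Finset.sum_const_zero, sub_zero] at h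
  have := sum_normSq_nonneg x
  linarith

/-- The determinant of the upper left block of the quotient of two flows rotates in the positive
direction if the Hamiltonians are ordered. -/
lemma hasDerivWithinAt_det_quotientMatrix (hb : IsSplitBasis ω b) (hω : ω.IsAlt)
    (hnd : ω.Nondegenerate) {H₀ H₁ : ℝ → QuadraticForm ℝ V} {Φ₀ Φ₁ : ℝ → End ℝ V}
    (h₀ : IsHamiltonianFlow ω H₀ T Φ₀) (h₁ : IsHamiltonianFlow ω H₁ T Φ₁) {t : ℝ}
    (ht : t ∈ Set.Icc 0 T) (hle : ∀ x, H₀ t x ≤ H₁ t x) :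
    ∃ w : ℂ, 0 ≤ w.im ∧
      HasDerivWithinAt (fun s => (quotientMatrix b (Φ₀ s) (Φ₁ s)).toBlocks₁₁.det)
        ((quotientMatrix b (Φ₀ t) (Φ₁ t)).toBlocks₁₁.det * w) (Set.Icc 0 T) t := by
  have hs₀ := h₀.isSymplecticMap hω hnd ht
  have hs₁ := h₁.isSymplecticMap hω hnd ht
  set p := QuadraticMap.polarBilin (H₁ t - H₀ t) with hp
  obtain ⟨q, L, hq, hLc, hL⟩ := exists_kreinBilin_eq_sum (p := p)
    ⟨fun x y => by
      rw [hp, QuadraticMap.polarBilin_apply_apply, QuadraticMap.polarBilin_apply_apply,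
        QuadraticMap.polar_comm]
      rfl⟩
    (fun x => by
      rw [hp, QuadraticMap.polarBilin_apply_apply, QuadraticMap.polar_self, _root_.sub_apply]
      exact smul_nonneg (by norm_num) (sub_nonneg.mpr (hle x)))
  set N := quotientMatrix b (Φ₀ t) (Φ₁ t) with hN
  have hNu : IsPseudoUnitary N := hb.isPseudoUnitary_quotientMatrix hs₀ hs₁
  set v : Fin (finrank ℝ V) → Fin n → ℂ :=
    fun m i => L m (LinearMap.baseChange ℂ (Φ₀ t) (b (Sum.inl i))) with hv
  -- The derivative of the upper left block, with Φ₁ b_j expanded in the vectors Φ₀ b_k with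
  -- coefficients from N. The functionals L m are real and the second half of the basis is conjugate
  -- to the first, so the lower block of N appears with the conjugate of v m.
  set D : Matrix (Fin n) (Fin n) ℂ := ∑ m, (I * q m) •
    vecMulVec (star (v m)) (v m ᵥ* N.toBlocks₁₁ + star (v m) ᵥ* N.toBlocks₂₁) with hD
  have hder : ∀ i j, HasDerivWithinAt
      (fun s => (quotientMatrix b (Φ₀ s) (Φ₁ s)).toBlocks₁₁ i j) (D i j) (Set.Icc 0 T) t := by
    intro i j
    have h1 : ∀ s, (quotientMatrix b (Φ₀ s) (Φ₁ s)).toBlocks₁₁ i j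
        = kreinBilin ω (LinearMap.baseChange ℂ (Φ₀ s) (b (Sum.inl i)))
          (LinearMap.baseChange ℂ (Φ₁ s) (b (Sum.inl j))) := fun s =>
      hb.quotientMatrix_inl _ _ _ _
    simp only [h1]
    convert! hasDerivWithinAt_kreinBilin hω hnd h₀ h₁ ht (b (Sum.inl i)) (b (Sum.inl j)) using 1
    rw [← hp, hL, hD, Matrix.sum_apply]
    refine Finset.sum_congr rfl fun m _ => ?_
    rw [Matrix.smul_apply, vecMulVec_apply, smul_eq_mul, hb.baseChange_eq_sum hs₀ (Φ₁ t),
      map_sum, Fintype.sum_sum_type, Pi.add_apply, vecMul, vecMul, dotProduct, dotProduct]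
    congr 3
    · refine Finset.sum_congr rfl fun k _ => ?_
      rw [map_smul, smul_eq_mul, mul_comm]
      rfl
    · refine Finset.sum_congr rfl fun k _ => ?_
      rw [map_smul, smul_eq_mul, mul_comm, hb.conj, baseChange_conjC, hLc]
      rfl
  have hdet := hNu.det_ne_zero
  refine ⟨(N.toBlocks₁₁⁻¹ * D).trace, trace_im_nonneg hdet hNu.block_le hq v, ?_⟩
  convert! hasDerivWithinAt_det hder using 1
  rw [Matrix.inv_def, Ring.inverse_eq_inv', Matrix.smul_mul, trace_smul, smul_eq_mul,
    mul_inv_cancel_left₀ hdet]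

omit [FiniteDimensional ℝ V] in
lemma continuousOn_quotientMatrix {b : Basis (Fin n ⊕ Fin n) ℂ (ℂ ⊗[ℝ] V)} {Φ₀ Φ₁ : ℝ → End ℝ V}
    {s : Set ℝ} (h₀ : ContinuousOn (fun t => matrixOf b (Φ₀ t)) s)
    (h₁ : ContinuousOn (fun t => matrixOf b (Φ₁ t)) s) :
    ContinuousOn (fun t => quotientMatrix b (Φ₀ t) (Φ₁ t)) s := by
  have key : ∀ (G : Matrix (Fin n ⊕ Fin n) (Fin n ⊕ Fin n) ℂ)
      (M N : ℝ → Matrix (Fin n ⊕ Fin n) (Fin n ⊕ Fin n) ℂ), ContinuousOn M s → ContinuousOn N s →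
      ContinuousOn (fun t => G * ((M t)ᴴ * G * N t)) s := fun G M N hM hN => by
    rw [continuousOn_iff_continuous_domRestrict] at *
    exact continuous_const.matrix_mul
      ((hM.matrix_conjTranspose.matrix_mul continuous_const).matrix_mul hN)
  exact key _ _ _ h₀ h₁

/-- Sturm comparison for the arguments, with an explicit constant. -/
theorem exists_angles (hb : IsSplitBasis ω b) (hω : ω.IsAlt) (hnd : ω.Nondegenerate)
    (hn : finrank ℝ V = 2 * n) (hT : 0 ≤ T) {H₀ H₁ : ℝ → QuadraticForm ℝ V}
    {Φ₀ Φ₁ : ℝ → End ℝ V} (hle : ∀ t ∈ Set.Icc 0 T, ∀ x, H₀ t x ≤ H₁ t x)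
    (h₀ : IsHamiltonianFlow ω H₀ T Φ₀) (h₁ : IsHamiltonianFlow ω H₁ T Φ₁) :
    ∃ θ₀ θ₁ : ℝ → ℝ, IsAngle ω Φ₀ 0 T θ₀ ∧ IsAngle ω Φ₁ 0 T θ₁ ∧
      ∀ t ∈ Set.Icc 0 T, θ₀ t - θ₀ 0 - 3 * n * Real.pi ≤ θ₁ t - θ₁ 0 := by
  have hs₀ : ∀ t ∈ Set.Icc 0 T, IsSymplecticMap ω (Φ₀ t) := fun t ht =>
    h₀.isSymplecticMap hω hnd ht
  have hs₁ : ∀ t ∈ Set.Icc 0 T, IsSymplecticMap ω (Φ₁ t) := fun t ht =>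
    h₁.isSymplecticMap hω hnd ht
  have hu₀ := fun t ht => hb.isPseudoUnitary (hs₀ t ht)
  have hu₁ := fun t ht => hb.isPseudoUnitary (hs₁ t ht)
  have hc₀ := continuousOn_matrixOf hω hnd b h₀
  have hc₁ := continuousOn_matrixOf hω hnd b h₁
  set N : ℝ → Matrix (Fin n ⊕ Fin n) (Fin n ⊕ Fin n) ℂ :=
    fun t => quotientMatrix b (Φ₀ t) (Φ₁ t) with hN
  have huN : ∀ t ∈ Set.Icc 0 T, IsPseudoUnitary (N t) := fun t ht =>
    hb.isPseudoUnitary_quotientMatrix (hs₀ t ht) (hs₁ t ht)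
  have hcN : ContinuousOn N (Set.Icc 0 T) :=
    continuousOn_quotientMatrix hc₀ hc₁
  have hblock : Continuous fun M : Matrix (Fin n ⊕ Fin n) (Fin n ⊕ Fin n) ℂ =>
      M.toBlocks₁₁.det := by
    unfold toBlocks₁₁
    fun_prop
  obtain ⟨θ, hθ, hθe⟩ := exists_continuous_arg hT (hblock.comp_continuousOn hc₀)
    (fun t ht => (hu₀ t ht).det_ne_zero)
  obtain ⟨η, hη, hηe⟩ := exists_continuous_arg hT (hblock.comp_continuousOn hcN)
    (fun t ht => (huN t ht).det_ne_zero)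
  simp only [Function.comp_apply] at hθe hηe
  have hmono : MonotoneOn η (Set.Icc 0 T) := by
    have hex : ∀ t, ∃ w : ℂ, t ∈ Set.Icc 0 T → 0 ≤ w.im ∧
        HasDerivWithinAt (fun s => (N s).toBlocks₁₁.det) ((N t).toBlocks₁₁.det * w)
          (Set.Icc 0 T) t := by
      intro t
      by_cases ht : t ∈ Set.Icc 0 T
      · obtain ⟨w, hw⟩ := hasDerivWithinAt_det_quotientMatrix hb hω hnd h₀ h₁ ht (hle t ht)
        exact ⟨w, fun _ => hw⟩
      · exact ⟨0, fun h => absurd h ht⟩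
    choose w hw using hex
    exact monotoneOn_continuous_arg hη (fun t ht => (huN t ht).det_ne_zero)
      (fun t ht => (hw t ht).2) (fun t ht => (hw t ht).1) hηe
  set ζ : ℝ → ℝ := fun t => relArg (matrixOf b (Φ₀ t)) (N t * stdFrame n) with hζ
  have hfr : ∀ t ∈ Set.Icc 0 T, IsFrame (N t * stdFrame n) := fun t ht =>
    isFrame_stdFrame.mul (huN t ht)
  have hcζ : ContinuousOn ζ (Set.Icc 0 T) := by
    refine continuousOn_relArg hc₀ ?_ hu₀ hfr
    exact (Continuous.matrix_mul continuous_id continuous_const).comp_continuousOn hcN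
  -- Upper left blocks are not multiplicative; the defect in Φ₁ = Φ₀ N is exactly the accretive
  -- determinant with argument ζ.
  have hprod : ∀ t ∈ Set.Icc 0 T, (matrixOf b (Φ₁ t)).toBlocks₁₁.det
      = ((‖(matrixOf b (Φ₀ t)).toBlocks₁₁.det‖ * ‖(N t).toBlocks₁₁.det‖
        * ‖(relMatrix (matrixOf b (Φ₀ t)) (N t * stdFrame n)).det‖ : ℝ) : ℂ)
        * exp (((θ t + η t + ζ t : ℝ) : ℂ) * I) := by
    intro t ht
    have hacc := accretive_relMatrix (hu₀ t ht) (hfr t ht)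
    have e1 : (relMatrix (matrixOf b (Φ₀ t)) (N t * stdFrame n)).det
        = (matrixOf b (Φ₁ t)).toBlocks₁₁.det / (matrixOf b (Φ₀ t)).toBlocks₁₁.det
          / (N t).toBlocks₁₁.det := by
      rw [relMatrix, ← Matrix.mul_assoc, hN, hb.mul_quotientMatrix (hs₀ t ht),
        mul_stdFrame_toRows₁, mul_stdFrame_toRows₁]
      simp only [det_mul, det_nonsing_inv, Ring.inverse_eq_inv']
      ring
    have e2 : (matrixOf b (Φ₁ t)).toBlocks₁₁.det = (matrixOf b (Φ₀ t)).toBlocks₁₁.det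
        * (N t).toBlocks₁₁.det * (relMatrix (matrixOf b (Φ₀ t)) (N t * stdFrame n)).det := by
      have d0 := (hu₀ t ht).det_ne_zero
      have d1 := (huN t ht).det_ne_zero
      rw [e1]
      field_simp
    rw [e2]
    conv_lhs => rw [hθe t ht, hηe t ht, hacc.det_eq]
    simp only [ofReal_add, ofReal_mul, add_mul, exp_add, hζ, relArg]
    ring
  have hangle₁ : ∀ t ∈ Set.Icc 0 T, (matrixOf b (Φ₁ t)).toBlocks₁₁.det
      = ‖(matrixOf b (Φ₁ t)).toBlocks₁₁.det‖ * exp (((θ t + η t + ζ t : ℝ) : ℂ) * I) := by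
    intro t ht
    have h1 := congrArg norm (hprod t ht)
    rw [norm_mul, norm_exp_ofReal_mul_I, mul_one, norm_real,
      Real.norm_of_nonneg (by positivity)] at h1
    rw [h1]
    exact hprod t ht
  refine ⟨_, _, isAngle_of_arg hω hnd hb hn h₀ hθ hθe,
    isAngle_of_arg hω hnd hb hn h₁ ((hθ.add hη).add hcζ) hangle₁, fun t ht => ?_⟩
  have h0 : (0 : ℝ) ∈ Set.Icc 0 T := Set.left_mem_Icc.mpr hT
  have m1 := hmono h0 ht ht.1
  have b1 := abs_le.mp (abs_correction_le (hu₀ t ht))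
  have b2 := abs_le.mp (abs_correction_le (hu₀ 0 h0))
  have b3 := abs_le.mp (abs_correction_le (hu₁ t ht))
  have b4 := abs_le.mp (abs_correction_le (hu₁ 0 h0))
  have b5 := abs_le.mp (abs_relArg_le (hu₀ t ht) (hfr t ht))
  have b6 := abs_le.mp (abs_relArg_le (hu₀ 0 h0) (hfr 0 h0))
  simp only [hζ, Pi.add_apply]
  -- Six error terms, the corrections of both flows and ζ at the times 0 and t, each at most nπ/2,
  -- add up to 3nπ.
  linarith [b1.1, b1.2, b2.1, b2.2, b3.1, b3.2, b4.1, b4.2, b5.1, b5.2, b6.1, b6.2]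

end Comparison

end SalamonZehnder

theorem proposition2p1 (d : ℕ) :
    ∃ C : ℝ, 0 < C ∧
      ∀ (V : Type u) [AddCommGroup V] [Module ℝ V] [FiniteDimensional ℝ V]
        (ω : LinearMap.BilinForm ℝ V) (T : ℝ) (H₀ H₁ : ℝ → QuadraticForm ℝ V)
        (Φ₀ Φ₁ : ℝ → Module.End ℝ V),
        Module.finrank ℝ V = d → ω.IsAlt → ω.Nondegenerate → 0 ≤ T →
        (∀ x : V, ContinuousOn (fun t => H₀ t x) (Set.Icc 0 T)) →
        (∀ x : V, ContinuousOn (fun t => H₁ t x) (Set.Icc 0 T)) →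
        (∀ t ∈ Set.Icc 0 T, ∀ x : V, H₀ t x ≤ H₁ t x) →
        SalamonZehnder.IsHamiltonianFlow ω H₀ T Φ₀ →
        SalamonZehnder.IsHamiltonianFlow ω H₁ T Φ₁ →
        (∃ θ₀ : ℝ → ℝ, SalamonZehnder.IsAngle ω Φ₀ 0 T θ₀) ∧
        (∃ θ₁ : ℝ → ℝ, SalamonZehnder.IsAngle ω Φ₁ 0 T θ₁) ∧
        ∀ t ∈ Set.Icc 0 T,
          SalamonZehnder.Delta ω Φ₁ 0 t ≥ SalamonZehnder.Delta ω Φ₀ 0 t - C := by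
  -- After division by π the error is 3n ≤ 3d; the extra 1 keeps the constant positive for d = 0.
  refine ⟨3 * d + 1, by positivity, ?_⟩
  intro V _ _ _ ω T H₀ H₁ Φ₀ Φ₁ hd hω hnd hT _ _ hle h₀ h₁
  obtain ⟨n, b, hn, hb⟩ := SalamonZehnder.exists_isSplitBasis hω hnd
  obtain ⟨θ₀, θ₁, ha₀, ha₁, h⟩ := SalamonZehnder.exists_angles hb hω hnd hn hT hle h₀ h₁
  refine ⟨⟨θ₀, ha₀⟩, ⟨θ₁, ha₁⟩, fun t ht => ?_⟩
  rw [ha₀.delta_eq ht, ha₁.delta_eq ht, ge_iff_le, sub_le_iff_le_add,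
    div_le_iff₀ Real.pi_pos, add_mul, div_mul_cancel₀ _ Real.pi_ne_zero]
  have hnd' : (n : ℝ) ≤ d := by
    have : n ≤ d := by omega
    exact_mod_cast this
  nlinarith [h t ht, Real.pi_pos, mul_le_mul_of_nonneg_right hnd' Real.pi_pos.le]
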